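/- Let $R$ be a commutative ring with unit and let $H=\bigoplus_{i\in\mathbb Z}H^i$ be a graded commutative associative $R$-algebra (not necessarily unital): $ab=(-1)^{|a||b|}ba$ for homogeneous $a,b$. All signs below are those of the bar construction. An $A_\infty$-structure on $H$ is a sequence of multilinear operations $m_i:H^{\otimes i}\to H$, $i\ge 1$, $\deg m_i=2-i$, with $$\sum_{k=0}^{n-1}\sum_{j=1}^{n-k}\pm\, m_{n-j+1}(a_1\otimes\dots\otimes a_k\otimes m_j(a_{k+1}\otimes\dots\otimes a_{k+j})\otimes\dots\otimes a_n)=0\qquad(n\ge 1).$$ It is a $C_\infty$-structure if every $m_i$ vanishes on all shuffle products $(a_1\otimes\dots\otimes a_k)*_{sh}(a_{k+1}\otimes\dots\otimes a_i)$, $0<k<i$. A minimal $C_\infty$-structure on the algebra $H$ is one with $m_1=0$ and $m_2(a\otimes b)=ab$. A $C_\infty$-morphism $\{f_i\}:(H,\{m_i\})\to(H,\{m'_i\})$ is a sequence of maps $f_i:H^{\otimes i}\to H$, $i\ge1$, $\deg f_i=1-i$, vanishing on shuffles, with $$\sum_{k,j}\pm f_{n-j+1}(a_1\otimes\dots\otimes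 m_j(a_{k+1}\otimes\dots\otimes a_{k+j})\otimes\dots\otimes a_n)=\sum_{t}\sum_{k_1+\dots+k_t=n}\pm m'_t(f_{k_1}(a_1\otimes\dots\otimes a_{k_1})\otimes\dots\otimes f_{k_t}(\dots\otimes a_n));$$ it is a $C_\infty$-isomorphism if it has a two-sided inverse $C_\infty$-morphism with respect to the composition $(g f)_n=\sum\pm g_t(f_{k_1}\otimes\dots\otimes f_{k_t})$ (sum over all $k_1+\dots+k_t=n$), the identity being $(\mathrm{id},0,0,\dots)$. Let $\bar C^{n,k}(H,H)$ be the module of degree $k$ multilinear maps $H^{\otimes n}\to H$ vanishing on shuffles, with the Hochschild differential $$\delta f(a_1\otimes\dots\otimes a_{n+1})=(-1)^{k|a_1|}a_1f(a_2\otimes\dots\otimes a_{n+1})+\sum_{j=1}^{n}(-1)^jf(a_1\otimes\dots\otimes a_ja_{j+1}\otimes\dots\otimes a_{n+1})+(-1)^{n+1}f(a_1\otimes\dots\otimes a_n)a_{n+1},$$ and let the Harrison cohomology $Harr^{n,k}(H,H)$ be the $n$-th cohomology module of the complex $(\bar C^{*,k}(H,H),\delta)$. **Theorem.** Suppose $Harr^{n,2-n}(H,H)=0$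 for all $n\ge 3$. Then every minimal $C_\infty$-structure $\{m_i\}$ on $H$ is degenerate: there is a $C_\infty$-isomorphism $\{f_i\}$, with $f_1=\mathrm{id}_H$, from $(H,\{m_i\})$ to $(H,\{m_1=0,\ m_2,\ m_3=0,\ m_4=0,\dots\})$, the latter being a minimal $C_\infty$-structure on $H$. -/

import Mathlib

open scoped DirectSum

noncomputable section

namespace CInfty

/-! ### Words of homogeneous elements and signs

A graded module is given as an `R`-module `H` with a decomposition `𝒜 : ℤ → Submodule R H`.
A word `a₁ ⊗ ⋯ ⊗ aₙ` of homogeneous elements is a list of pairs `(degree, element)`. -/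

section Words

variable {R H H' : Type*} [CommRing R] [AddCommGroup H] [Module R H]
  [AddCommGroup H'] [Module R H']

/-- Every letter lies in the graded piece named by its recorded degree. -/
def IsHomogeneousWord (𝒜 : ℤ → Submodule R H) (w : List (ℤ × H)) : Prop :=
  ∀ x ∈ w, x.2 ∈ 𝒜 x.1

/-- The degree `|a₁| + ⋯ + |aₙ|`. -/
def wordDeg (w : List (ℤ × H)) : ℤ := (w.map Prod.fst).sum

/-- The degree of `[a₁, …, aₙ]` in the bar construction: `∑ (|aᵢ| - 1)`. -/
def barDeg (w : List (ℤ × H)) : ℤ := (w.map fun x => x.1 - 1).sum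

/-- The exponent `∑ (n - i) |aᵢ|` of the Koszul sign that arises when the `n` suspensions are
moved to the left across `a₁ ⊗ ⋯ ⊗ aₙ`. -/
def suspExp : List (ℤ × H) → ℤ
  | [] => 0
  | x :: w => (w.length : ℤ) * x.1 + suspExp w

/-- A homogeneous multilinear map of degree `k`. -/
def HasDegree (𝒜 : ℤ → Submodule R H) (ℬ : ℤ → Submodule R H') {n : ℕ}
    (f : MultilinearMap R (fun _ : Fin n => H) H') (k : ℤ) : Prop :=
  ∀ (d : Fin n → ℤ) (a : Fin n → H), (∀ i, a i ∈ 𝒜 (d i)) → f a ∈ ℬ (∑ i, d i + k)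

/-- The map induced by `f` on the suspension (as it enters the bar construction), evaluated at
a word of length `n`: `[a₁, …, aₙ] ↦ (-1)^{∑ (n - i) |aᵢ|} f (a₁ ⊗ ⋯ ⊗ aₙ)`.
(The default value in `getD` is never used for words of length `n`.) -/
def barEval {n : ℕ} (f : MultilinearMap R (fun _ : Fin n => H) H') (w : List (ℤ × H)) : H' :=
  (suspExp w).negOnePow • f (fun i => (w.getD i (0, 0)).2)

/-- The same for a sequence `f₁, f₂, …` of maps with `deg fₙ = e - n`, the value being recorded
together with its degree. -/
def barLetter (f : ∀ n : ℕ, MultilinearMap R (fun _ : Fin n => H) H') (e : ℤ)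
    (w : List (ℤ × H)) : ℤ × H' :=
  (wordDeg w + e - w.length, barEval (f w.length) w)

/-! ### Shuffles -/

/-- All shuffles of two words, each listed once, with its sign in the bar construction: the
Koszul sign for the degrees `|a| - 1`, i.e. a factor `(-1)^{(|a| - 1)(|b| - 1)}` for every letter
`b` of the second word that is moved in front of a letter `a` of the first word. -/
def shuffles : List (ℤ × H) → List (ℤ × H) → List (ℤˣ × List (ℤ × H))
  | [], v => [(1, v)]
  | a :: u, [] => [(1, a :: u)]
  | a :: u, b :: v =>
      (shuffles u (b :: v)).map (fun s => (s.1, a :: s.2)) ++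
      (shuffles (a :: u) v).map
        (fun s => (((b.1 - 1) * barDeg (a :: u)).negOnePow * s.1, b :: s.2))
  termination_by u v => u.length + v.length

/-- `f` vanishes on all shuffle products `(a₁ ⊗ ⋯ ⊗ aₖ) * (aₖ₊₁ ⊗ ⋯ ⊗ aₙ)`, `0 < k < n`.
For `n = 2` this says `f (a ⊗ b) = (-1)^{|a||b|} f (b ⊗ a)`; in general, the sign of a shuffle
as seen by `f` itself is the signature of the permutation times the Koszul sign for the
degrees `|aᵢ|`. -/
def VanishesOnShuffles (𝒜 : ℤ → Submodule R H) {n : ℕ}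
    (f : MultilinearMap R (fun _ : Fin n => H) H') : Prop :=
  ∀ u v : List (ℤ × H), u ≠ [] → v ≠ [] → u.length + v.length = n →
    IsHomogeneousWord 𝒜 u → IsHomogeneousWord 𝒜 v →
    ((shuffles u v).map fun s => s.1 • barEval f s.2).sum = 0

/-! ### `A_∞`- and `C_∞`-structures and their morphisms

Sequences of operations are indexed by `ℕ`; the component of arity `0` is required to be zero. -/

/-- `m = (m₁, m₂, …)` is an `A_∞`-structure on the graded module `(H, 𝒜)`: `deg mₙ = 2 - n` and
`∑ ± m_{n-j+1}(a₁ ⊗ ⋯ ⊗ aₖ ⊗ m_j(aₖ₊₁ ⊗ ⋯ ⊗ aₖ₊ⱼ) ⊗ ⋯ ⊗ aₙ) = 0`, the signs being those of the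
bar construction. Written out, `±` is `(-1)^{k + j(n-k-j) + j(|a₁| + ⋯ + |aₖ|)}`, up to a common
sign. -/
structure IsAInfty (𝒜 : ℤ → Submodule R H)
    (m : ∀ n : ℕ, MultilinearMap R (fun _ : Fin n => H) H) : Prop where
  zero : m 0 = 0
  degree : ∀ n : ℕ, HasDegree 𝒜 𝒜 (m n) (2 - n)
  rel : ∀ w : List (ℤ × H), w ≠ [] → IsHomogeneousWord 𝒜 w →
    ∑ k ∈ Finset.range w.length, ∑ j ∈ Finset.Icc 1 (w.length - k),
      (barDeg (w.take k)).negOnePow •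
        barEval (m (w.length - j + 1))
          (w.take k ++ [barLetter m 2 ((w.drop k).take j)] ++ w.drop (k + j)) = 0

/-- A `C_∞`-structure: an `A_∞`-structure whose operations vanish on shuffles. -/
structure IsCInfty (𝒜 : ℤ → Submodule R H)
    (m : ∀ n : ℕ, MultilinearMap R (fun _ : Fin n => H) H) : Prop extends IsAInfty 𝒜 m where
  shuffle : ∀ n : ℕ, VanishesOnShuffles 𝒜 (m n)

/-- `f = (f₁, f₂, …)` is a morphism of `A_∞`-algebras `(H, m) → (H', m')`: `deg fₙ = 1 - n` and
`∑ ± f_{n-j+1}(a₁ ⊗ ⋯ ⊗ m_j(aₖ₊₁ ⊗ ⋯ ⊗ aₖ₊ⱼ) ⊗ ⋯ ⊗ aₙ)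
  = ∑ ± m'_t(f_{k₁}(a₁ ⊗ ⋯ ) ⊗ ⋯ ⊗ f_{k_t}( ⋯ ⊗ aₙ))`,
the second sum being over all compositions `k₁ + ⋯ + k_t = n`. -/
structure IsAInftyHom (𝒜 : ℤ → Submodule R H) (ℬ : ℤ → Submodule R H')
    (m : ∀ n : ℕ, MultilinearMap R (fun _ : Fin n => H) H)
    (m' : ∀ n : ℕ, MultilinearMap R (fun _ : Fin n => H') H')
    (f : ∀ n : ℕ, MultilinearMap R (fun _ : Fin n => H) H') : Prop where
  zero : f 0 = 0
  degree : ∀ n : ℕ, HasDegree 𝒜 ℬ (f n) (1 - n)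
  rel : ∀ w : List (ℤ × H), w ≠ [] → IsHomogeneousWord 𝒜 w →
    ∑ k ∈ Finset.range w.length, ∑ j ∈ Finset.Icc 1 (w.length - k),
      (barDeg (w.take k)).negOnePow •
        barEval (f (w.length - j + 1))
          (w.take k ++ [barLetter m 2 ((w.drop k).take j)] ++ w.drop (k + j))
    = ∑ c : Composition w.length,
        barEval (m' c.length) ((w.splitWrtComposition c).map (barLetter f 1))

/-- A morphism of `C_∞`-algebras: an `A_∞`-morphism whose components vanish on shuffles. -/
structure IsCInftyHom (𝒜 : ℤ → Submodule R H) (ℬ : ℤ → Submodule R H')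
    (m : ∀ n : ℕ, MultilinearMap R (fun _ : Fin n => H) H)
    (m' : ∀ n : ℕ, MultilinearMap R (fun _ : Fin n => H') H')
    (f : ∀ n : ℕ, MultilinearMap R (fun _ : Fin n => H) H') : Prop
    extends IsAInftyHom 𝒜 ℬ m m' f where
  shuffle : ∀ n : ℕ, VanishesOnShuffles 𝒜 (f n)

/-- The composite of `f` and `g` is the identity morphism `(id, 0, 0, …)`, where the composite is
`(g ∘ f)ₙ(a₁ ⊗ ⋯ ⊗ aₙ) = ∑ ± g_t(f_{k₁}(a₁ ⊗ ⋯) ⊗ ⋯ ⊗ f_{k_t}(⋯ ⊗ aₙ))`, the sum being over all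
compositions `k₁ + ⋯ + k_t = n`. -/
def CompEqId (𝒜 : ℤ → Submodule R H)
    (f : ∀ n : ℕ, MultilinearMap R (fun _ : Fin n => H) H')
    (g : ∀ n : ℕ, MultilinearMap R (fun _ : Fin n => H') H) : Prop :=
  ∀ w : List (ℤ × H), w ≠ [] → IsHomogeneousWord 𝒜 w →
    ∑ c : Composition w.length,
        barEval (g c.length) ((w.splitWrtComposition c).map (barLetter f 1))
    = if w.length = 1 then (w.getD 0 (0, 0)).2 else 0

/-- `f` is an isomorphism of `C_∞`-algebras: a `C_∞`-morphism with a two-sided inverse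
`C_∞`-morphism. -/
def IsCInftyIso (𝒜 : ℤ → Submodule R H) (ℬ : ℤ → Submodule R H')
    (m : ∀ n : ℕ, MultilinearMap R (fun _ : Fin n => H) H)
    (m' : ∀ n : ℕ, MultilinearMap R (fun _ : Fin n => H') H')
    (f : ∀ n : ℕ, MultilinearMap R (fun _ : Fin n => H) H') : Prop :=
  IsCInftyHom 𝒜 ℬ m m' f ∧
    ∃ g : ∀ n : ℕ, MultilinearMap R (fun _ : Fin n => H') H,
      IsCInftyHom ℬ 𝒜 m' m g ∧ CompEqId 𝒜 f g ∧ CompEqId ℬ g f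

end Words

/-! ### The Hochschild differential and Harrison cohomology -/

section Harrison

variable {R H : Type*} [CommRing R] [NonUnitalRing H] [Module R H]

/-- A minimal `C_∞`-structure on the graded algebra `H`: `m₁ = 0` and `m₂` is the product. -/
structure IsMinimalCInfty (𝒜 : ℤ → Submodule R H)
    (m : ∀ n : ℕ, MultilinearMap R (fun _ : Fin n => H) H) : Prop extends IsCInfty 𝒜 m where
  minimal : m 1 = 0
  product : ∀ a b : H, m 2 ![a, b] = a * b

/-- Graded commutativity `ab = (-1)^{|a||b|} ba`. -/
def IsGradedCommutative (𝒜 : ℤ → Submodule R H) : Prop :=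
  ∀ (i j : ℤ) (a b : H), a ∈ 𝒜 i → b ∈ 𝒜 j → a * b = (i * j).negOnePow • (b * a)

/-- The linear map `a ↦ (-1)^{k|a|} a`. -/
def koszulTwist (𝒜 : ℤ → Submodule R H) [DirectSum.Decomposition 𝒜] (k : ℤ) : H →ₗ[R] H :=
  (DirectSum.toModule R ℤ H fun i => (k * i).negOnePow • (𝒜 i).subtype) ∘ₗ
    (DirectSum.decomposeLinearEquiv 𝒜).toLinearMap

theorem koszulTwist_apply (𝒜 : ℤ → Submodule R H) [DirectSum.Decomposition 𝒜] (k : ℤ)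
    {i : ℤ} {a : H} (ha : a ∈ 𝒜 i) : koszulTwist 𝒜 k a = (k * i).negOnePow • a := by
  lift a to 𝒜 i using ha
  simp only [koszulTwist, LinearMap.comp_apply, LinearEquiv.coe_coe,
    DirectSum.decomposeLinearEquiv_apply, DirectSum.decompose_coe]
  erw [DirectSum.toModule_lof]
  rfl

/-- Replacing `aⱼ, aⱼ₊₁` by their product is linear in each letter. -/
theorem exists_contractNth_update [IsScalarTower R H H] [SMulCommClass R H H] {n : ℕ} (j : Fin n)
    (a : Fin (n + 1) → H) (i : Fin (n + 1)) :
    ∃ (i' : Fin n) (ψ : H →ₗ[R] H), ∀ x,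
      j.castSucc.contractNth (· * ·) (Function.update a i x)
        = Function.update (j.castSucc.contractNth (· * ·) a) i' (ψ x) := by
  rcases lt_trichotomy i.val j.val with h | h | h
  · refine ⟨⟨i, by omega⟩, LinearMap.id, fun x => ?_⟩
    ext k
    simp only [Fin.contractNth, Function.update_apply, Fin.ext_iff, Fin.val_castSucc, Fin.val_succ,
      LinearMap.id_apply]
    grind
  · refine ⟨j, (LinearMap.mul R H).flip (a j.succ), fun x => ?_⟩
    ext k
    simp only [Fin.contractNth, Function.update_apply, Fin.ext_iff, Fin.val_castSucc, Fin.val_succ,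
      LinearMap.flip_apply, LinearMap.mul_apply']
    grind
  · rcases Nat.lt_or_ge (j.val + 1) i.val with h' | h'
    · refine ⟨⟨i - 1, by omega⟩, LinearMap.id, fun x => ?_⟩
      ext k
      simp only [Fin.contractNth, Function.update_apply, Fin.ext_iff, Fin.val_castSucc,
        Fin.val_succ, LinearMap.id_apply]
      grind
    · refine ⟨j, LinearMap.mul R H (a j.castSucc), fun x => ?_⟩
      ext k
      simp only [Fin.contractNth, Function.update_apply, Fin.ext_iff, Fin.val_castSucc,
        Fin.val_succ, LinearMap.mul_apply']
      grind

variable [IsScalarTower R H H] [SMulCommClass R H H]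

/-- `a₁ ⊗ ⋯ ⊗ aₙ₊₁ ↦ f (a₁ ⊗ ⋯ ⊗ aⱼ aⱼ₊₁ ⊗ ⋯ ⊗ aₙ₊₁)`. -/
def contract {n : ℕ} (j : Fin n) (f : MultilinearMap R (fun _ : Fin n => H) H) :
    MultilinearMap R (fun _ : Fin (n + 1) => H) H where
  toFun a := f (j.castSucc.contractNth (· * ·) a)
  map_update_add' a i x y := by
    rename_i inst
    obtain rfl : inst = instDecidableEqFin _ := Subsingleton.elim _ _
    obtain ⟨i', ψ, h⟩ := exists_contractNth_update (R := R) j a i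
    simp only [h, map_add, MultilinearMap.map_update_add]
  map_update_smul' a i r x := by
    rename_i inst
    obtain rfl : inst = instDecidableEqFin _ := Subsingleton.elim _ _
    obtain ⟨i', ψ, h⟩ := exists_contractNth_update (R := R) j a i
    simp only [h, map_smul, MultilinearMap.map_update_smul]

/-- `a₁ ⊗ ⋯ ⊗ aₙ₊₁ ↦ (-1)^{k|a₁|} a₁ f (a₂ ⊗ ⋯ ⊗ aₙ₊₁)`. -/
def leftMul (𝒜 : ℤ → Submodule R H) [DirectSum.Decomposition 𝒜] {n : ℕ} (k : ℤ)
    (f : MultilinearMap R (fun _ : Fin n => H) H) :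
    MultilinearMap R (fun _ : Fin (n + 1) => H) H :=
  LinearMap.uncurryLeft (M := fun _ : Fin (n + 1) => H)
    { toFun := fun a => (LinearMap.mul R H (koszulTwist 𝒜 k a)).compMultilinearMap f
      map_add' := fun a b => by ext v; simp
      map_smul' := fun r a => by ext v; simp }

/-- `a₁ ⊗ ⋯ ⊗ aₙ₊₁ ↦ f (a₁ ⊗ ⋯ ⊗ aₙ) aₙ₊₁`. -/
def rightMul {n : ℕ} (f : MultilinearMap R (fun _ : Fin n => H) H) :
    MultilinearMap R (fun _ : Fin (n + 1) => H) H :=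
  MultilinearMap.uncurryRight (M := fun _ : Fin (n + 1) => H)
    ((LinearMap.mul R H).compMultilinearMap f)

/-- The Hochschild differential on cochains of arity `n` and internal degree `k`:
`δf (a₁ ⊗ ⋯ ⊗ aₙ₊₁) = (-1)^{k|a₁|} a₁ f(a₂ ⊗ ⋯ ⊗ aₙ₊₁)
  + ∑_{j=1}^{n} (-1)^j f(a₁ ⊗ ⋯ ⊗ aⱼ aⱼ₊₁ ⊗ ⋯ ⊗ aₙ₊₁) + (-1)^{n+1} f(a₁ ⊗ ⋯ ⊗ aₙ) aₙ₊₁`. -/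
def hochschildD (𝒜 : ℤ → Submodule R H) [DirectSum.Decomposition 𝒜] (n : ℕ) (k : ℤ) :
    MultilinearMap R (fun _ : Fin n => H) H →ₗ[R]
      MultilinearMap R (fun _ : Fin (n + 1) => H) H where
  toFun f :=
    leftMul 𝒜 k f + ∑ j : Fin n, (-1 : ℤ) ^ (j.val + 1) • contract j f
      + (-1 : ℤ) ^ (n + 1) • rightMul f
  map_add' f g := by
    ext a
    simp [leftMul, rightMul, contract, Finset.sum_add_distrib]
    abel
  map_smul' r f := by
    ext a
    simp [leftMul, rightMul, contract, Finset.smul_sum, smul_comm r]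

theorem hochschildD_apply (𝒜 : ℤ → Submodule R H) [DirectSum.Decomposition 𝒜] {n : ℕ} (k : ℤ)
    (f : MultilinearMap R (fun _ : Fin n => H) H) (a : Fin (n + 1) → H) :
    hochschildD 𝒜 n k f a =
      koszulTwist 𝒜 k (a 0) * f (fun i => a i.succ)
      + ∑ j : Fin n, (-1 : ℤ) ^ (j.val + 1) • f (j.castSucc.contractNth (· * ·) a)
      + (-1 : ℤ) ^ (n + 1) • (f (fun i => a i.castSucc) * a (Fin.last n)) := by
  simp [hochschildD, leftMul, rightMul, contract, Fin.tail_def,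
    Fin.init_def]

/-- The Harrison cochains `C̄^{n,k}(H, H)`: multilinear maps `H^{⊗n} → H` of degree `k` that
vanish on shuffles. -/
def harrisonCochains (𝒜 : ℤ → Submodule R H) (n : ℕ) (k : ℤ) :
    Submodule R (MultilinearMap R (fun _ : Fin n => H) H) where
  carrier := {f | HasDegree 𝒜 𝒜 f k ∧ VanishesOnShuffles 𝒜 f}
  zero_mem' := ⟨fun d a _ => by simp, fun u v _ _ _ _ _ => by simp [barEval]⟩
  add_mem' {f g} hf hg := ⟨fun d a h => add_mem (hf.1 d a h) (hg.1 d a h),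
    fun u v hu hv hn h h' => by
      have h1 := hf.2 u v hu hv hn h h'
      have h2 := hg.2 u v hu hv hn h h'
      simp only [barEval, add_apply, smul_add, List.sum_map_add] at h1 h2 ⊢
      rw [h1, h2, add_zero]⟩
  smul_mem' r f hf := ⟨fun d a h => Submodule.smul_mem _ r (hf.1 d a h),
    fun u v hu hv hn h h' => by
      have h1 := hf.2 u v hu hv hn h h'
      have h2 : ∀ s : ℤˣ × List (ℤ × H), s.1 • barEval (r • f) s.2 = r • s.1 • barEval f s.2 := by
        intro s
        simp only [barEval, smul_apply, Units.smul_def, smul_comm r]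
      have h3 := congrArg (fun x => r • x) h1
      simp only [List.smul_sum, List.map_map, Function.comp_def, smul_zero] at h3
      simpa only [h2] using h3⟩

/-- Harrison cocycles: `δf = 0`. -/
def harrisonCocycles (𝒜 : ℤ → Submodule R H) [DirectSum.Decomposition 𝒜] (n : ℕ) (k : ℤ) :
    Submodule R (MultilinearMap R (fun _ : Fin n => H) H) :=
  harrisonCochains 𝒜 n k ⊓ LinearMap.ker (hochschildD 𝒜 n k)

/-- Harrison coboundaries: the image of `C̄^{n-1,k}` under `δ`. -/
def harrisonCoboundaries (𝒜 : ℤ → Submodule R H) [DirectSum.Decomposition 𝒜] (n : ℕ) (k : ℤ) :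
    Submodule R (MultilinearMap R (fun _ : Fin n => H) H) :=
  match n with
  | 0 => ⊥
  | n + 1 => (harrisonCochains 𝒜 n k).map (hochschildD 𝒜 n k)

/-- Harrison cohomology `Harr^{n,k}(H, H)`: the quotient of the cocycles by the coboundaries
(those are cocycles; `comap` regards them as a submodule of the cocycles). -/
abbrev HarrisonCohomology (𝒜 : ℤ → Submodule R H) [DirectSum.Decomposition 𝒜] (n : ℕ) (k : ℤ) :
    Type _ :=
  harrisonCocycles 𝒜 n k ⧸
    (harrisonCoboundaries 𝒜 n k).comap (harrisonCocycles 𝒜 n k).subtype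

end Harrison

end CInfty

end

/-! The bar construction turns sequences of operations into linear maps on a coalgebra. The tensor
algebra carries the deconcatenation coproduct; a sequence of multilinear maps, twisted by suspension
signs, is one linear map into `H` (`bar`, with inverse construction `unbar`). A linear map `m` of
bar degree 1 extends to an odd coderivation `coder 𝒜 m`, a map `φ` of degree 0 to a coalgebra map
`cohom φ`. The `A_∞`-relations become `m ∘ coder m = 0`, and the morphism equations become `φ ∘
coder m = m' ∘ cohom φ` (`sum_insertion_eq`, `sum_composition_eq`). Vanishing on shuffles makes
`coder m` a derivation and `cohom φ` a homomorphism for the signed shuffle product (`coder_shuffle`,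
`cohom_shuffle`).

The morphism is built arity by arity, starting from the identity, with the bare product as target.
Suppose the obstruction `φ ∘ coder m - m' ∘ cohom φ` vanishes on words of length at most `n`, where
`n ≥ 2`. Its part of arity `n + 1` has internal degree `2 - (n + 1)`, kills shuffles because `coder`
and `cohom` preserve the span of shuffles, and is a Hochschild cocycle because `coder m` and the
coderivation of the product both square to zero (`obstruction_cocycle`, `hochschildD_obstruction`).
By hypothesis it equals `δh` for a Harrison cochain `h` of arity `n`. Adding `h` to `φ` removes the
obstruction in length `n + 1`; it creates none in shorter lengths, since both structures have no
unary operation (`IsPartialMorphism.exists_extension`). Each component changes only finitely often,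
so the process has a limit (`exists_forall_isPartialMorphism`).

The limit is the identity on letters, so `cohom φ` differs from the identity by a map that shortens
words, and is bijective. Its inverse is a coalgebra map preserving bar degree and the span of
shuffles; its projection to letters is the inverse `C_∞`-morphism (`exists_inverse`). -/

namespace CInfty

open scoped TensorProduct

/-! ### Signs under linear and bilinear maps -/

section Signs

variable {R M N A : Type*} [CommRing R] [AddCommGroup M] [Module R M] [AddCommGroup N] [Module R N]
  [NonUnitalRing A]

theorem map_unit_smul (f : M →ₗ[R] N) (u : ℤˣ) (x : M) : f (u • x) = u • f x := by
  simp only [Units.smul_def, map_zsmul]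

theorem unit_smul_mul (u : ℤˣ) (x y : A) : (u • x) * y = u • (x * y) := by
  simp only [Units.smul_def, smul_mul_assoc]

theorem mul_unit_smul (u : ℤˣ) (x y : A) : x * (u • y) = u • (x * y) := by
  simp only [Units.smul_def, mul_smul_comm]

theorem unit_smul_tmul (u : ℤˣ) (x : M) (y : N) : (u • x) ⊗ₜ[R] y = u • (x ⊗ₜ[R] y) :=
  map_unit_smul ((TensorProduct.mk R M N).flip y) u x

theorem tmul_unit_smul (u : ℤˣ) (x : M) (y : N) : x ⊗ₜ[R] (u • y) = u • (x ⊗ₜ[R] y) :=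
  map_unit_smul (TensorProduct.mk R M N x) u y

theorem unit_smul_mem (p : Submodule R M) (u : ℤˣ) {x : M} (hx : x ∈ p) : u • x ∈ p := by
  rw [Units.smul_def]; exact zsmul_mem hx _

end Signs

/-! ### Sums over the splittings of a word -/

section SplitSum

variable {X M N : Type*} [AddCommGroup M] [AddCommGroup N]

/-- The sum of `g u v` over all factorizations `w = u ++ v`. -/
def splitSum : List X → (List X → List X → M) → M
  | [], g => g [] []
  | a :: w, g => g [] (a :: w) + splitSum w fun u v => g (a :: u) v

@[simp] theorem splitSum_nil (g : List X → List X → M) : splitSum [] g = g [] [] := rfl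

theorem splitSum_cons (a : X) (w : List X) (g : List X → List X → M) :
    splitSum (a :: w) g = g [] (a :: w) + splitSum w fun u v => g (a :: u) v := rfl

theorem splitSum_congr {w : List X} {g g' : List X → List X → M}
    (h : ∀ u v, u ++ v = w → g u v = g' u v) : splitSum w g = splitSum w g' := by
  induction w generalizing g g' with
  | nil => exact h [] [] rfl
  | cons a w ih =>
    rw [splitSum_cons, splitSum_cons, h [] (a :: w) rfl,
      ih fun u v huv => h (a :: u) v (by rw [List.cons_append, huv])]

theorem splitSum_zero {w : List X} {g : List X → List X → M}
    (h : ∀ u v, u ++ v = w → g u v = 0) : splitSum w g = 0 := by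
  induction w generalizing g with
  | nil => exact h [] [] rfl
  | cons a w ih =>
    rw [splitSum_cons, h [] (a :: w) rfl, zero_add,
      ih fun u v huv => h (a :: u) v (by rw [List.cons_append, huv])]

theorem splitSum_mem {S : Type*} [SetLike S M] [AddSubmonoidClass S M] (p : S) {w : List X}
    {g : List X → List X → M} (h : ∀ u v, u ++ v = w → g u v ∈ p) : splitSum w g ∈ p := by
  induction w generalizing g with
  | nil => exact h [] [] rfl
  | cons a w ih =>
    exact add_mem (h [] (a :: w) rfl) (ih fun u v huv => h (a :: u) v (by rw [List.cons_append, huv]))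

theorem splitSum_add (w : List X) (g g' : List X → List X → M) :
    splitSum w (fun u v => g u v + g' u v) = splitSum w g + splitSum w g' := by
  induction w generalizing g g' with
  | nil => rfl
  | cons a w ih => simp only [splitSum_cons, ih]; abel

theorem splitSum_sub (w : List X) (g g' : List X → List X → M) :
    splitSum w (fun u v => g u v - g' u v) = splitSum w g - splitSum w g' := by
  rw [eq_sub_iff_add_eq, ← splitSum_add]
  simp

theorem map_splitSum {F : Type*} [FunLike F M N] [AddMonoidHomClass F M N] (f : F) (w : List X)
    (g : List X → List X → M) : f (splitSum w g) = splitSum w fun u v => f (g u v) := by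
  induction w generalizing g with
  | nil => rfl
  | cons a w ih => simp only [splitSum_cons, map_add, ih]

theorem splitSum_smul (s : ℤˣ) (w : List X) (g : List X → List X → M) :
    splitSum w (fun u v => s • g u v) = s • splitSum w g := by
  induction w generalizing g with
  | nil => rfl
  | cons a w ih => simp only [splitSum_cons, smul_add, ih]

/-- Coassociativity of deconcatenation: both sides run over the factorizations of `w` into three
words. -/
theorem splitSum_assoc (w : List X) (g : List X → List X → List X → M) :
    splitSum w (fun u v => splitSum u fun u₁ u₂ => g u₁ u₂ v) =
      splitSum w fun u v => splitSum v fun v₁ v₂ => g u v₁ v₂ := by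
  induction w generalizing g with
  | nil => rfl
  | cons a w ih =>
    simp only [splitSum_cons, splitSum_nil, splitSum_add, ih]
    abel

theorem splitSum_comm {Y : Type*} (w : List X) (z : List Y)
    (g : List X → List X → List Y → List Y → M) :
    splitSum w (fun u v => splitSum z fun s t => g u v s t) =
      splitSum z fun s t => splitSum w fun u v => g u v s t := by
  induction w generalizing g with
  | nil => rfl
  | cons a w ih => simp only [splitSum_cons, splitSum_add, ih]

theorem splitSum_eq_range (w : List X) (g : List X → List X → M) :
    splitSum w g = ∑ i ∈ Finset.range (w.length + 1), g (w.take i) (w.drop i) := by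
  induction w generalizing g with
  | nil => simp
  | cons a w ih => rw [splitSum_cons, ih, List.length_cons, Finset.sum_range_succ' _ (w.length + 1), add_comm]; simp

/-- Only the splitting off of the first letter contributes. -/
theorem splitSum_eq_first {a : X} {w : List X} {g : List X → List X → M}
    (h : ∀ u v, u ++ v = a :: w → u.length ≠ 1 → g u v = 0) : splitSum (a :: w) g = g [a] w := by
  rw [splitSum_cons, h [] (a :: w) rfl (by simp), zero_add]
  cases w with
  | nil => rfl
  | cons b w =>
    rw [splitSum_cons, splitSum_zero, add_zero]
    intro u v huv
    exact h _ _ (by simp [huv]) (by simp)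

theorem mul_splitSum {A : Type*} [Ring A] (x : A) (w : List X) (g : List X → List X → A) :
    x * splitSum w g = splitSum w fun u v => x * g u v :=
  map_splitSum (AddMonoidHom.mulLeft x) w g

theorem tmul_splitSum {R : Type*} [CommRing R] [Module R M] [Module R N] (x : N) (w : List X)
    (g : List X → List X → M) : x ⊗ₜ[R] splitSum w g = splitSum w fun u v => x ⊗ₜ[R] g u v :=
  map_splitSum (TensorProduct.mk R N M x) w g

theorem splitSum_tmul {R : Type*} [CommRing R] [Module R M] [Module R N] (x : N) (w : List X)
    (g : List X → List X → M) : splitSum w g ⊗ₜ[R] x = splitSum w fun u v => g u v ⊗ₜ[R] x :=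
  map_splitSum ((TensorProduct.mk R M N).flip x) w g

end SplitSum

/-! ### The tensor algebra as deconcatenation coalgebra -/

section TensorCoalgebra

set_option linter.unusedSectionVars false

variable {R H M N P : Type*} [CommRing R] [AddCommGroup H] [Module R H] [AddCommGroup M] [Module R M]
  [AddCommGroup N] [Module R N] [AddCommGroup P] [Module R P]

/-- The linear map out of the tensor algebra with `a₁ ⊗ ⋯ ⊗ aₙ ↦ s a₁ (s a₂ (⋯ (s aₙ m)))`. -/
noncomputable def fold (s : H →ₗ[R] Module.End R M) (m : M) : TensorAlgebra R H →ₗ[R] M :=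
  LinearMap.applyₗ m ∘ₗ (TensorAlgebra.lift R s).toLinearMap

@[simp] theorem fold_one (s : H →ₗ[R] Module.End R M) (m : M) : fold s m 1 = m := by
  simp [fold]

@[simp] theorem fold_ι_mul (s : H →ₗ[R] Module.End R M) (m : M) (a : H) (x : TensorAlgebra R H) :
    fold s m (TensorAlgebra.ι R a * x) = s a (fold s m x) := by
  simp [fold]

theorem eq_top_of_ι_mul_mem {p : Submodule R (TensorAlgebra R H)} (h1 : 1 ∈ p)
    (h : ∀ a : H, ∀ x ∈ p, TensorAlgebra.ι R a * x ∈ p) : p = ⊤ := by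
  -- Stability under left multiplication by every `x`, rather than membership of `x`, is what passes
  -- through the product case of the induction.
  have key : ∀ x : TensorAlgebra R H, ∀ y ∈ p, x * y ∈ p := by
    intro x
    induction x using TensorAlgebra.induction with
    | algebraMap r => intro y hy; rw [← Algebra.smul_def]; exact Submodule.smul_mem _ r hy
    | ι a => exact h a
    | mul a b ha hb => intro y hy; rw [mul_assoc]; exact ha _ (hb y hy)
    | add a b ha hb => intro y hy; rw [add_mul]; exact add_mem (ha y hy) (hb y hy)
  exact eq_top_iff.2 fun x _ => by simpa using key x 1 h1

variable (R) in
/-- The element `a₁ ⊗ ⋯ ⊗ aₙ` of the tensor algebra. -/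
noncomputable def word (w : List (ℤ × H)) : TensorAlgebra R H :=
  (w.map fun x => TensorAlgebra.ι R x.2).prod

@[simp] theorem word_nil : word R ([] : List (ℤ × H)) = 1 := rfl

@[simp] theorem word_cons (a : ℤ × H) (w : List (ℤ × H)) :
    word R (a :: w) = TensorAlgebra.ι R a.2 * word R w := by simp [word]

theorem word_append (u v : List (ℤ × H)) : word R (u ++ v) = word R u * word R v := by
  simp [word]

variable (R H) in
/-- The recursion step for the deconcatenation coproduct. -/
noncomputable def deconStep : H →ₗ[R] Module.End R
    (TensorAlgebra R H × TensorAlgebra R H ⊗[R] TensorAlgebra R H) :=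
  -- The coproduct of `a x` involves `x` as well as its coproduct, so the fold carries both; the
  -- first component merely rebuilds the element.
  LinearMap.mk₂ R (fun a p => (TensorAlgebra.ι R a * p.1,
      1 ⊗ₜ[R] (TensorAlgebra.ι R a * p.1) + (TensorAlgebra.ι R a ⊗ₜ[R] 1) * p.2))
    (fun a b p => by
      ext <;> simp [add_mul, TensorProduct.tmul_add, TensorProduct.add_tmul]; abel)
    (fun r a p => by
      ext
      · simp
      · simp only [map_smul, smul_mul_assoc, TensorProduct.tmul_smul, TensorProduct.smul_tmul',
          Prod.smul_snd, smul_add]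
        rw [← smul_mul_assoc, TensorProduct.smul_tmul'])
    (fun a p q => by
      ext <;> simp [mul_add, TensorProduct.tmul_add]; abel)
    (fun r a p => by ext <;> simp)

/-- The deconcatenation coproduct. -/
noncomputable def decon : TensorAlgebra R H →ₗ[R] TensorAlgebra R H ⊗[R] TensorAlgebra R H :=
  LinearMap.snd R (TensorAlgebra R H) _ ∘ₗ fold (deconStep R H) (1, 1 ⊗ₜ 1)

theorem decon_word (w : List (ℤ × H)) :
    decon (word R w) = splitSum w fun u v => word R u ⊗ₜ[R] word R v := by
  suffices h : fold (deconStep R H) (1, 1 ⊗ₜ 1) (word R w) =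
      (word R w, splitSum w fun u v => word R u ⊗ₜ[R] word R v) from congrArg Prod.snd h
  induction w with
  | nil => simp
  | cons a w ih =>
    rw [word_cons, fold_ι_mul, ih, deconStep, LinearMap.mk₂_apply, splitSum_cons]
    simp only [word_nil, word_cons]
    rw [show ∀ x y : TensorAlgebra R H ⊗[R] TensorAlgebra R H,
      x * y = LinearMap.mulLeft R x y from fun _ _ => rfl, map_splitSum]
    simp

theorem decon_ι_mul (a : H) (x : TensorAlgebra R H) :
    decon (TensorAlgebra.ι R a * x) =
      1 ⊗ₜ (TensorAlgebra.ι R a * x) + (TensorAlgebra.ι R a ⊗ₜ 1) * decon x := by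
  have h : LinearMap.fst R _ _ ∘ₗ fold (deconStep R H) (1, 1 ⊗ₜ 1) = LinearMap.id := by
    refine LinearMap.eqLocus_eq_top.1 (eq_top_of_ι_mul_mem (by simp) fun a x hx => ?_)
    simp only [LinearMap.mem_eqLocus, LinearMap.comp_apply, LinearMap.fst_apply,
      LinearMap.id_apply] at hx
    simp only [LinearMap.mem_eqLocus, LinearMap.comp_apply, fold_ι_mul]
    simp only [deconStep, LinearMap.mk₂_apply, LinearMap.fst_apply] at hx ⊢
    rw [hx, LinearMap.id_apply]
  have h' := LinearMap.congr_fun h x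
  simp only [decon, LinearMap.comp_apply, fold_ι_mul]
  simp only [deconStep, LinearMap.comp_apply, LinearMap.mk₂_apply, LinearMap.fst_apply,
    LinearMap.snd_apply, LinearMap.id_apply] at h' ⊢
  rw [h']

theorem ι_mul_mem_span_word {p : Submodule R (TensorAlgebra R H)} {S : Set (List (ℤ × H))}
    (hp : p = Submodule.span R (word R '' S)) (a : ℤ × H) (h : ∀ w ∈ S, a :: w ∈ S)
    {x : TensorAlgebra R H} (hx : x ∈ p) : TensorAlgebra.ι R a.2 * x ∈ p := by
  subst hp
  induction hx using Submodule.span_induction with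
  | mem x hx =>
    obtain ⟨w, hw, rfl⟩ := hx
    exact Submodule.subset_span ⟨a :: w, h w hw, by simp⟩
  | zero => simp
  | add x y _ _ hx hy => rw [mul_add]; exact add_mem hx hy
  | smul r x _ hx => rw [mul_smul_comm]; exact Submodule.smul_mem _ r hx

theorem isHomogeneousWord_nil (𝒜 : ℤ → Submodule R H) : IsHomogeneousWord 𝒜 [] := by
  simp [IsHomogeneousWord]

theorem isHomogeneousWord_cons {𝒜 : ℤ → Submodule R H} {a : ℤ × H} {w : List (ℤ × H)} :
    IsHomogeneousWord 𝒜 (a :: w) ↔ a.2 ∈ 𝒜 a.1 ∧ IsHomogeneousWord 𝒜 w := by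
  simp [IsHomogeneousWord]

theorem isHomogeneousWord_append {𝒜 : ℤ → Submodule R H} {u v : List (ℤ × H)} :
    IsHomogeneousWord 𝒜 (u ++ v) ↔ IsHomogeneousWord 𝒜 u ∧ IsHomogeneousWord 𝒜 v := by
  simp only [IsHomogeneousWord, List.mem_append, or_imp, forall_and]

theorem barDeg_cons (a : ℤ × H) (w : List (ℤ × H)) : barDeg (a :: w) = a.1 - 1 + barDeg w := by
  simp [barDeg]

@[simp] theorem barDeg_nil : barDeg ([] : List (ℤ × H)) = 0 := rfl

theorem barDeg_append (u v : List (ℤ × H)) : barDeg (u ++ v) = barDeg u + barDeg v := by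
  simp [barDeg]

theorem splitSum_congr_homogeneous {𝒜 : ℤ → Submodule R H} {w : List (ℤ × H)} (hw : IsHomogeneousWord 𝒜 w)
    {g g' : List (ℤ × H) → List (ℤ × H) → M}
    (h : ∀ u v, IsHomogeneousWord 𝒜 u → IsHomogeneousWord 𝒜 v → u ++ v = w → g u v = g' u v) :
    splitSum w g = splitSum w g' := by
  refine splitSum_congr fun u v huv => ?_
  rw [← huv, isHomogeneousWord_append] at hw
  exact h u v hw.1 hw.2 huv

/-- The convolution `x ↦ ∑ β (φ x₁) (ψ x₂)`. -/
noncomputable def conv (β : M →ₗ[R] N →ₗ[R] P) (φ : TensorAlgebra R H →ₗ[R] M)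
    (ψ : TensorAlgebra R H →ₗ[R] N) : TensorAlgebra R H →ₗ[R] P :=
  TensorProduct.lift (β.compl₁₂ φ ψ) ∘ₗ decon

theorem conv_word (β : M →ₗ[R] N →ₗ[R] P) (φ : TensorAlgebra R H →ₗ[R] M)
    (ψ : TensorAlgebra R H →ₗ[R] N) (w : List (ℤ × H)) :
    conv β φ ψ (word R w) = splitSum w fun u v => β (φ (word R u)) (ψ (word R v)) := by
  simp [conv, decon_word, map_splitSum]

variable (𝒜 : ℤ → Submodule R H) [DirectSum.Decomposition 𝒜]

theorem span_word_eq_top :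
    Submodule.span R (word R '' {w : List (ℤ × H) | IsHomogeneousWord 𝒜 w}) = ⊤ := by
  set p := Submodule.span R (word R '' {w : List (ℤ × H) | IsHomogeneousWord 𝒜 w}) with hp
  refine eq_top_of_ι_mul_mem (Submodule.subset_span ⟨[], isHomogeneousWord_nil 𝒜, rfl⟩)
    fun a y hy => ?_
  induction a using DirectSum.Decomposition.inductionOn 𝒜 with
  | zero => simp
  | @homogeneous i a =>
    exact ι_mul_mem_span_word hp (i, (a : H)) (fun w hw => isHomogeneousWord_cons.2 ⟨a.2, hw⟩) hy
  | add a b ha hb => rw [map_add, add_mul]; exact add_mem ha hb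

/-- Signs can be evaluated only on homogeneous words; as these span, identities between linear maps
may be tested there. -/
theorem linearMap_ext_word {f g : TensorAlgebra R H →ₗ[R] M}
    (h : ∀ w, IsHomogeneousWord 𝒜 w → f (word R w) = g (word R w)) : f = g := by
  refine LinearMap.ext_on (span_word_eq_top 𝒜) ?_
  rintro _ ⟨w, hw, rfl⟩
  exact h w hw

end TensorCoalgebra

/-! ### Gradings and signs on the tensor algebra -/

section Grading

variable {R H : Type*} [CommRing R] [AddCommGroup H] [Module R H]

/-- The submodule of the tensor algebra of elements of bar degree `d`. -/
def barGrade (𝒜 : ℤ → Submodule R H) (d : ℤ) : Submodule R (TensorAlgebra R H) :=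
  Submodule.span R (word R '' {w | IsHomogeneousWord 𝒜 w ∧ barDeg w = d})

theorem word_mem_barGrade {𝒜 : ℤ → Submodule R H} {w : List (ℤ × H)}
    (hw : IsHomogeneousWord 𝒜 w) : word R w ∈ barGrade 𝒜 (barDeg w) :=
  Submodule.subset_span ⟨w, ⟨hw, rfl⟩, rfl⟩

/-- Suspension lowers degrees by one, so a letter in `𝒜 (d + 1)` contributes `d` to the bar degree.
-/
theorem ι_mul_mem_barGrade {𝒜 : ℤ → Submodule R H} {d e : ℤ} {a : H} (ha : a ∈ 𝒜 (d + 1))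
    {x : TensorAlgebra R H} (hx : x ∈ barGrade 𝒜 e) :
    TensorAlgebra.ι R a * x ∈ barGrade 𝒜 (d + e) := by
  induction hx using Submodule.span_induction with
  | mem x hx =>
    obtain ⟨w, ⟨hw, rfl⟩, rfl⟩ := hx
    refine Submodule.subset_span ⟨(d + 1, a) :: w, ⟨isHomogeneousWord_cons.2 ⟨ha, hw⟩, ?_⟩, by simp⟩
    rw [barDeg_cons]; ring
  | zero => simp
  | add x y _ _ hx hy => rw [mul_add]; exact add_mem hx hy
  | smul r x _ hx => rw [mul_smul_comm]; exact Submodule.smul_mem _ r hx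

theorem mem_of_mem_barGrade {𝒜 : ℤ → Submodule R H} {M : Type*} [AddCommGroup M] [Module R M]
    {f : TensorAlgebra R H →ₗ[R] M} {p : Submodule R M} {d : ℤ}
    (h : ∀ w, IsHomogeneousWord 𝒜 w → barDeg w = d → f (word R w) ∈ p)
    {x : TensorAlgebra R H} (hx : x ∈ barGrade 𝒜 d) : f x ∈ p := by
  have : barGrade 𝒜 d ≤ p.comap f :=
    Submodule.span_le.2 (by rintro _ ⟨w, ⟨hw, hd⟩, rfl⟩; exact h w hw hd)
  exact this hx

variable (𝒜 : ℤ → Submodule R H) [DirectSum.Decomposition 𝒜]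

/-- The linear map multiplying `a ∈ 𝒜 i` by `c i`. -/
noncomputable def gradedScale (c : ℤ → ℤ) : H →ₗ[R] H :=
  (DirectSum.toModule R ℤ H fun i => c i • (𝒜 i).subtype) ∘ₗ
    (DirectSum.decomposeLinearEquiv 𝒜).toLinearMap

theorem gradedScale_apply (c : ℤ → ℤ) {i : ℤ} {a : H} (ha : a ∈ 𝒜 i) :
    gradedScale 𝒜 c a = c i • a := by
  lift a to 𝒜 i using ha
  simp only [gradedScale, LinearMap.comp_apply, LinearEquiv.coe_coe,
    DirectSum.decomposeLinearEquiv_apply, DirectSum.decompose_coe]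
  erw [DirectSum.toModule_lof]
  rfl

/-- The sign `a ↦ (-1)^{|a| - 1} a`. -/
noncomputable def barSign : H →ₗ[R] H := gradedScale 𝒜 fun i => ((i - 1).negOnePow : ℤ)

theorem barSign_apply {i : ℤ} {a : H} (ha : a ∈ 𝒜 i) : barSign 𝒜 a = (i - 1).negOnePow • a :=
  gradedScale_apply 𝒜 _ ha

/-- The sign of the bar degree on the tensor algebra. -/
noncomputable def barSignT : TensorAlgebra R H →ₗ[R] TensorAlgebra R H :=
  (TensorAlgebra.lift R (TensorAlgebra.ι R ∘ₗ barSign 𝒜)).toLinearMap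

@[simp] theorem barSignT_one : barSignT 𝒜 1 = 1 := by simp [barSignT]

@[simp] theorem barSignT_ι_mul (a : H) (x : TensorAlgebra R H) :
    barSignT 𝒜 (TensorAlgebra.ι R a * x) = TensorAlgebra.ι R (barSign 𝒜 a) * barSignT 𝒜 x := by
  simp [barSignT]

theorem barSignT_word {w : List (ℤ × H)} (hw : IsHomogeneousWord 𝒜 w) :
    barSignT 𝒜 (word R w) = (barDeg w).negOnePow • word R w := by
  induction w with
  | nil => simp
  | cons a w ih =>
    rw [isHomogeneousWord_cons] at hw
    rw [word_cons, barSignT_ι_mul, ih hw.2, barSign_apply 𝒜 hw.1, map_unit_smul, mul_unit_smul,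
      unit_smul_mul, smul_smul, barDeg_cons, Int.negOnePow_add, mul_comm (Int.negOnePow _)]

theorem barSignT_of_mem {d : ℤ} {x : TensorAlgebra R H} (hx : x ∈ barGrade 𝒜 d) :
    barSignT 𝒜 x = d.negOnePow • x := by
  have := mem_of_mem_barGrade (f := barSignT 𝒜 - (d.negOnePow : ℤ) • LinearMap.id) (p := ⊥)
    (fun w hw hd => by
      simp only [LinearMap.sub_apply, LinearMap.smul_apply, LinearMap.id_apply, Submodule.mem_bot]
      rw [barSignT_word 𝒜 hw, hd, Units.smul_def, sub_self]) hx
  rw [Submodule.mem_bot, LinearMap.sub_apply, sub_eq_zero] at this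
  rw [this, Units.smul_def]; rfl

theorem barSignT_barSignT (x : TensorAlgebra R H) : barSignT 𝒜 (barSignT 𝒜 x) = x := by
  refine LinearMap.congr_fun (f := barSignT 𝒜 ∘ₗ barSignT 𝒜) (g := LinearMap.id)
    (linearMap_ext_word 𝒜 fun w hw => ?_) x
  rw [LinearMap.comp_apply, barSignT_word 𝒜 hw, map_unit_smul, barSignT_word 𝒜 hw, smul_smul,
    ← Int.negOnePow_add, Int.negOnePow_even _ ⟨_, rfl⟩, one_smul, LinearMap.id_apply]

end Grading

/-! ### The counit and the projection to words of length one -/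

section Projection

variable {R H : Type*} [CommRing R] [AddCommGroup H] [Module R H]

/-- `word` ignores the degree labels, so arbitrary words span and the label `0` can be given to any
letter. This serves identities in which no sign has to be evaluated. -/
theorem linearMap_ext_words {M : Type*} [AddCommGroup M] [Module R M]
    {f g : TensorAlgebra R H →ₗ[R] M} (h : ∀ w, f (word R w) = g (word R w)) : f = g := by
  refine LinearMap.eqLocus_eq_top.1 (top_unique ?_)
  have h' := eq_top_of_ι_mul_mem (R := R) (H := H) (p := Submodule.span R (word R '' Set.univ))
    (Submodule.subset_span ⟨[], Set.mem_univ _, rfl⟩)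
    fun a x hx => ι_mul_mem_span_word rfl (0, a) (fun _ _ => Set.mem_univ _) hx
  rw [← h']
  exact Submodule.span_le.2 (by rintro _ ⟨w, -, rfl⟩; exact h w)

variable (R H) in
/-- The counit of the tensor coalgebra. -/
noncomputable def counit : TensorAlgebra R H →ₗ[R] R := TensorAlgebra.algebraMapInv.toLinearMap

@[simp] theorem counit_one : counit R H 1 = 1 := by simp [counit]

@[simp] theorem counit_ι_mul (a : H) (x : TensorAlgebra R H) :
    counit R H (TensorAlgebra.ι R a * x) = 0 := by
  simp [counit, TensorAlgebra.algebraMapInv]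

variable (R H) in
/-- The projection to words of length one. -/
noncomputable def proj : TensorAlgebra R H →ₗ[R] H :=
  -- The second component of the fold is the counit of the part already read; a new letter survives
  -- only in front of a constant.
  LinearMap.fst R H R ∘ₗ fold (LinearMap.mk₂ R (fun a p => (p.2 • a, 0))
    (fun a b p => by ext <;> simp) (fun r a p => by ext <;> simp [smul_comm r])
    (fun a p q => by ext <;> simp [add_smul]) (fun r a p => by ext <;> simp [mul_smul])) (0, 1)

@[simp] theorem proj_one : proj R H 1 = 0 := by simp [proj]

@[simp] theorem proj_ι_mul (a : H) (x : TensorAlgebra R H) :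
    proj R H (TensorAlgebra.ι R a * x) = counit R H x • a := by
  rw [proj]
  set s : H →ₗ[R] Module.End R (H × R) := LinearMap.mk₂ R _ _ _ _ _ with hs
  have h : LinearMap.snd R H R ∘ₗ fold s (0, 1) = counit R H := by
    refine LinearMap.eqLocus_eq_top.1 (eq_top_of_ι_mul_mem (by simp) fun a x _ => ?_)
    simp only [LinearMap.mem_eqLocus, LinearMap.comp_apply, fold_ι_mul, counit_ι_mul]
    simp [hs]
  rw [← h]
  simp only [LinearMap.comp_apply, fold_ι_mul]
  simp only [hs, LinearMap.mk₂_apply, LinearMap.fst_apply, LinearMap.snd_apply]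

theorem proj_ι (a : H) : proj R H (TensorAlgebra.ι R a) = a := by
  rw [← mul_one (TensorAlgebra.ι R a), proj_ι_mul, counit_one, one_smul]

theorem proj_word (w : List (ℤ × H)) :
    proj R H (word R w) = if w.length = 1 then (w.getD 0 (0, 0)).2 else 0 := by
  match w with
  | [] => simp
  | [a] => simp [proj_ι]
  | a :: b :: w => simp

theorem counit_word (w : List (ℤ × H)) : counit R H (word R w) = if w = [] then 1 else 0 := by
  match w with
  | [] => simp
  | a :: w => simp

/-- Splitting off the first letter. Applied to the value of a coalgebra map or coderivation, this
gives a recursion along splittings, which is how such maps are recovered from their projection to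
letters. -/
theorem eq_counit_add_conv (x : TensorAlgebra R H) : x = algebraMap R _ (counit R H x) +
    conv (LinearMap.mul R _) (TensorAlgebra.ι R ∘ₗ proj R H) LinearMap.id x := by
  refine LinearMap.congr_fun (f := LinearMap.id) (g := Algebra.linearMap R _ ∘ₗ counit R H +
    conv (LinearMap.mul R _) (TensorAlgebra.ι R ∘ₗ proj R H) LinearMap.id)
    (linearMap_ext_words fun w => ?_) x
  rw [LinearMap.add_apply, conv_word, LinearMap.comp_apply, counit_word]
  cases w with
  | nil => simp
  | cons a w =>
    rw [splitSum_eq_first]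
    · simp [proj_ι]
    · intro u v _ hu
      simp [proj_word, hu]

end Projection


/-! ### Coalgebra morphisms and coderivations of the tensor coalgebra -/

section CoalgebraMaps

set_option linter.unusedSectionVars false

variable {R H M N P : Type*} [CommRing R] [AddCommGroup H] [Module R H] [AddCommGroup M] [Module R M]
  [AddCommGroup N] [Module R N] [AddCommGroup P] [Module R P]

theorem conv_apply (β : M →ₗ[R] N →ₗ[R] P) (φ : TensorAlgebra R H →ₗ[R] M)
    (ψ : TensorAlgebra R H →ₗ[R] N) (x : TensorAlgebra R H) :
    conv β φ ψ x = TensorProduct.lift (β.compl₁₂ φ ψ) (decon x) := rfl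

/-- A recursion along splittings determines its solution. -/
theorem eq_zero_of_splitSum {X : Type*} {S : List X → Prop} (hS : ∀ u v, S (u ++ v) → S v)
    {Y : List X → M} (β : List X → M → M) (hβ : ∀ x, β [] x = 0) (hβ' : ∀ u, β u 0 = 0)
    (h : ∀ w, S w → Y w = splitSum w fun u v => β u (Y v)) : ∀ w, S w → Y w = 0 := by
  intro w
  induction hn : w.length using Nat.strong_induction_on generalizing w with
  | _ n ih =>
    intro hw
    rw [h w hw]
    refine splitSum_zero fun u v huv => ?_
    -- An empty first factor contributes nothing, and a nonempty one leaves a shorter word `v`.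
    cases u with
    | nil => exact hβ _
    | cons a u =>
      rw [ih v.length (by rw [← hn, ← huv]; simp) v rfl (hS (a :: u) v (huv ▸ hw)), hβ']

/-- A linear map compatible with unit, counit and deconcatenation. -/
structure IsCoalgHom (F : TensorAlgebra R H →ₗ[R] TensorAlgebra R H) : Prop where
  map_one : F 1 = 1
  counit_map : ∀ x, counit R H (F x) = counit R H x
  decon_map : ∀ x, decon (F x) = TensorProduct.map F F (decon x)

theorem IsCoalgHom.conv_map {F : TensorAlgebra R H →ₗ[R] TensorAlgebra R H} (hF : IsCoalgHom F)
    (β : M →ₗ[R] N →ₗ[R] P) (φ : TensorAlgebra R H →ₗ[R] M) (ψ : TensorAlgebra R H →ₗ[R] N)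
    (x : TensorAlgebra R H) : conv β φ ψ (F x) = conv β (φ ∘ₗ F) (ψ ∘ₗ F) x := by
  rw [conv_apply, conv_apply, hF.decon_map, ← LinearMap.comp_apply]
  congr 1
  ext; simp

/-- Split the first letter off `F x` and move the coproduct through `F`: the first letter is the
image of an initial block under `proj ∘ F`, and `F` acts on what remains. -/
theorem IsCoalgHom.apply_eq {F : TensorAlgebra R H →ₗ[R] TensorAlgebra R H} (hF : IsCoalgHom F)
    (x : TensorAlgebra R H) : F x = algebraMap R _ (counit R H x) +
      conv (LinearMap.mul R _) (TensorAlgebra.ι R ∘ₗ proj R H ∘ₗ F) F x := by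
  conv_lhs => rw [eq_counit_add_conv (F x), hF.counit_map, hF.conv_map]
  rfl

/-- The step of the recursion for `cohom`: a letter is appended to the current block, or it starts
a new one. -/
noncomputable def cohomStep (φ : TensorAlgebra R H →ₗ[R] H) :
    H →ₗ[R] Module.End R (Module.End R (TensorAlgebra R H)) :=
  LinearMap.mk₂ R (fun a X => X ∘ₗ LinearMap.mulRight R (TensorAlgebra.ι R a) +
      LinearMap.mulRight R (X (TensorAlgebra.ι R a)) ∘ₗ TensorAlgebra.ι R ∘ₗ φ)
    (fun a b X => by ext; simp [mul_add]; abel)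
    (fun r a X => by ext; simp)
    (fun a X Y => by ext; simp [mul_add]; abel)
    (fun r a X => by ext; simp)

/-- The coalgebra map with
`a₁ ⊗ ⋯ ⊗ aₙ ↦ ∑ φ(a₁ ⊗ ⋯ ⊗ aₖ₁) ⊗ φ(aₖ₁₊₁ ⊗ ⋯) ⊗ ⋯ ⊗ φ(⋯ ⊗ aₙ)`. -/
noncomputable def cohom (φ : TensorAlgebra R H →ₗ[R] H) :
    TensorAlgebra R H →ₗ[R] TensorAlgebra R H :=
  -- The fold yields a function of the block currently being read, evaluated at the empty block `1`.
  -- Its base value closes a block by `φ`; the counit term supplies the value `1` for the empty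
  -- word.
  LinearMap.applyₗ 1 ∘ₗ
    fold (cohomStep φ) (TensorAlgebra.ι R ∘ₗ φ + Algebra.linearMap R _ ∘ₗ counit R H)

theorem splitSum_eq_last {X : Type*} (w : List X) (g : List X → M) :
    (splitSum w fun u v => (if v = [] then (1 : R) else 0) • g u) = g w := by
  induction w generalizing g with
  | nil => simp
  | cons b w ih => rw [splitSum_cons, ih]; simp

section Cohom

variable {φ : TensorAlgebra R H →ₗ[R] H}

theorem cohom_one (hφ : φ 1 = 0) : cohom φ 1 = 1 := by simp [cohom, hφ]

theorem cohom_ι_mul (hφ : φ 1 = 0) (a : H) (x : TensorAlgebra R H) : cohom φ (TensorAlgebra.ι R a * x) =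
    fold (cohomStep φ) (TensorAlgebra.ι R ∘ₗ φ + Algebra.linearMap R _ ∘ₗ counit R H) x
      (TensorAlgebra.ι R a) := by
  simp only [cohom, LinearMap.comp_apply, fold_ι_mul]
  simp [cohomStep, hφ]

theorem cohom_cons (hφ : φ 1 = 0) (a : ℤ × H) (w : List (ℤ × H)) : cohom φ (word R (a :: w)) =
    splitSum w fun u v => TensorAlgebra.ι R (φ (word R (a :: u))) * cohom φ (word R v) := by
  -- The block read so far is generalized to any `z` without constant term, so that the induction
  -- may append letters to it.
  have key : ∀ (w : List (ℤ × H)) (z : TensorAlgebra R H), counit R H z = 0 →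
      fold (cohomStep φ) (TensorAlgebra.ι R ∘ₗ φ + Algebra.linearMap R _ ∘ₗ counit R H) (word R w) z
      = splitSum w fun u v => TensorAlgebra.ι R (φ (z * word R u)) * cohom φ (word R v) := by
    intro w
    induction w with
    | nil => intro z hz; simp [hz, cohom_one hφ]
    | cons a w ih =>
      intro z hz
      have hza : counit R H (z * TensorAlgebra.ι R a.2) = 0 := by
        simp only [counit, AlgHom.toLinearMap_apply] at hz ⊢
        rw [map_mul, hz, zero_mul]
      rw [word_cons, fold_ι_mul, splitSum_cons, cohomStep, LinearMap.mk₂_apply, ← cohomStep]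
      simp only [LinearMap.add_apply, LinearMap.comp_apply, LinearMap.mulRight_apply, word_nil,
        mul_one, ih _ hza, word_cons, mul_assoc, cohom_ι_mul hφ]
      rw [add_comm]
  rw [word_cons, cohom_ι_mul hφ, key _ _ (by simpa using counit_ι_mul a.2 1)]
  simp

theorem cohom_word (hφ : φ 1 = 0) {w : List (ℤ × H)} (hw : w ≠ []) : cohom φ (word R w) =
    splitSum w fun u v => TensorAlgebra.ι R (φ (word R u)) * cohom φ (word R v) := by
  cases w with
  | nil => exact absurd rfl hw
  | cons a w => rw [cohom_cons hφ, splitSum_cons]; simp [hφ]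

theorem isCoalgHom_cohom (hφ : φ 1 = 0) : IsCoalgHom (cohom φ) where
  map_one := cohom_one hφ
  counit_map x := by
    refine LinearMap.congr_fun (f := counit R H ∘ₗ cohom φ) (linearMap_ext_words fun w => ?_) x
    cases w with
    | nil => simp [cohom_one hφ]
    | cons a w =>
      rw [LinearMap.comp_apply, cohom_cons hφ, map_splitSum, word_cons, counit_ι_mul]
      exact splitSum_zero fun u v _ => counit_ι_mul _ _
  decon_map x := by
    refine LinearMap.congr_fun (f := decon ∘ₗ cohom φ)
      (g := TensorProduct.map (cohom φ) (cohom φ) ∘ₗ decon) (linearMap_ext_words fun w => ?_) x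
    induction hn : w.length using Nat.strong_induction_on generalizing w with
    | _ n ih =>
      cases w with
      | nil => simp [decon, cohom_one hφ]
      | cons a w =>
        simp only [LinearMap.comp_apply] at ih ⊢
        rw [decon_word, map_splitSum, splitSum_cons, cohom_cons hφ, map_splitSum]
        simp only [decon_ι_mul, splitSum_add, TensorProduct.map_tmul, word_nil, cohom_one hφ]
        congr 1
        · rw [cohom_cons hφ, tmul_splitSum]
        -- Cutting after the first block produces factorizations into three parts: the rest of the
        -- first block, the rest of the left tensor factor, and the right tensor factor.
        -- Coassociativity matches the two groupings.
        · trans splitSum w fun u v => splitSum v fun v₁ v₂ =>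
            (TensorAlgebra.ι R (φ (word R (a :: u))) * cohom φ (word R v₁)) ⊗ₜ[R]
              cohom φ (word R v₂)
          · refine splitSum_congr fun u v huv => ?_
            rw [ih v.length (by rw [← hn, ← huv]; simp) v rfl, decon_word, map_splitSum,
              mul_splitSum]
            simp
          · rw [← splitSum_assoc]
            refine splitSum_congr fun u v _ => ?_
            rw [cohom_cons hφ, splitSum_tmul]

theorem proj_cohom (hφ : φ 1 = 0) : proj R H ∘ₗ cohom φ = φ := by
  refine linearMap_ext_words fun w => ?_
  cases w with
  | nil => simp [cohom_one hφ, hφ]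
  | cons a w =>
    rw [LinearMap.comp_apply, cohom_cons hφ, map_splitSum]
    simp only [proj_ι_mul, (isCoalgHom_cohom hφ).counit_map, counit_word]
    exact splitSum_eq_last _ _

end Cohom

/-- A coalgebra map is determined by its projection to words of length one. -/
theorem IsCoalgHom.eq_cohom {F : TensorAlgebra R H →ₗ[R] TensorAlgebra R H} (hF : IsCoalgHom F) :
    F = cohom (proj R H ∘ₗ F) := by
  have h0 : (proj R H ∘ₗ F) 1 = 0 := by simp [hF.map_one]
  refine linearMap_ext_words fun w => ?_
  rw [← sub_eq_zero]
  refine eq_zero_of_splitSum (S := fun _ => True) (fun _ _ _ => trivial)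
    (Y := fun w => F (word R w) - cohom (proj R H ∘ₗ F) (word R w))
    (fun u x => TensorAlgebra.ι R (proj R H (F (word R u))) * x)
    (by simp [hF.map_one]) (by simp) (fun w _ => ?_) w trivial
  rw [hF.apply_eq, (isCoalgHom_cohom h0).apply_eq, proj_cohom h0, conv_word, conv_word,
    add_sub_add_left_eq_sub, ← splitSum_sub]
  simp [mul_sub]

/-! #### Coderivations -/

variable (𝒜 : ℤ → Submodule R H) [DirectSum.Decomposition 𝒜]

/-- The map `a₁ ⊗ ⋯ ⊗ aₙ ↦ ∑ m(a₁ ⊗ ⋯ ⊗ aⱼ) ⊗ aⱼ₊₁ ⊗ ⋯ ⊗ aₙ`. -/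
noncomputable def headOp (m : TensorAlgebra R H →ₗ[R] H) :
    TensorAlgebra R H →ₗ[R] TensorAlgebra R H :=
  conv (LinearMap.mul R _) (TensorAlgebra.ι R ∘ₗ m) LinearMap.id

/-- The odd coderivation with
`a₁ ⊗ ⋯ ⊗ aₙ ↦ ∑ ± a₁ ⊗ ⋯ ⊗ aₖ ⊗ m(aₖ₊₁ ⊗ ⋯ ⊗ aₖ₊ⱼ) ⊗ aₖ₊ⱼ₊₁ ⊗ ⋯ ⊗ aₙ`. -/
noncomputable def coder (m : TensorAlgebra R H →ₗ[R] H) :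
    TensorAlgebra R H →ₗ[R] TensorAlgebra R H :=
  conv (LinearMap.mul R _) (barSignT 𝒜) (headOp m)

theorem headOp_word (m : TensorAlgebra R H →ₗ[R] H) (w : List (ℤ × H)) :
    headOp m (word R w) = splitSum w fun u v => TensorAlgebra.ι R (m (word R u)) * word R v := by
  rw [headOp, conv_word]; rfl

variable {m : TensorAlgebra R H →ₗ[R] H}

theorem coder_one (hm : m 1 = 0) : coder 𝒜 m 1 = 0 := by
  have := conv_word (LinearMap.mul R _) (barSignT 𝒜) (headOp m) []
  rw [word_nil] at this
  rw [coder, this, splitSum_nil, headOp_word]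
  simp [hm]

/-- Either the inserted operation starts at the first letter, or it passes that letter and acquires
its sign. -/
theorem coder_cons (a : ℤ × H) (w : List (ℤ × H)) : coder 𝒜 m (word R (a :: w)) =
    headOp m (word R (a :: w)) + TensorAlgebra.ι R (barSign 𝒜 a.2) * coder 𝒜 m (word R w) := by
  rw [coder, conv_word, conv_word, splitSum_cons, mul_splitSum]
  simp [mul_assoc]

/-- A cut falls either before the output letter of `m` or somewhere after it; in the second case the
left part is again an operation on an initial segment. -/
theorem decon_headOp (w : List (ℤ × H)) : decon (headOp m (word R w)) =
    1 ⊗ₜ headOp m (word R w) + splitSum w fun u v => headOp m (word R u) ⊗ₜ word R v := by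
  rw [headOp_word, map_splitSum]
  simp only [decon_ι_mul, splitSum_add, tmul_splitSum, decon_word, mul_splitSum, headOp_word,
    splitSum_tmul, splitSum_assoc]
  simp

/-- The co-Leibniz rule, by induction on letters. `barSignT` is the Koszul sign for moving the odd
map past the left tensor factor. -/
theorem decon_coder (hm : m 1 = 0) (x : TensorAlgebra R H) : decon (coder 𝒜 m x) =
    TensorProduct.map (coder 𝒜 m) LinearMap.id (decon x) +
      TensorProduct.map (barSignT 𝒜) (coder 𝒜 m) (decon x) := by
  refine LinearMap.congr_fun (f := decon ∘ₗ coder 𝒜 m)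
    (g := TensorProduct.map (coder 𝒜 m) LinearMap.id ∘ₗ decon +
      TensorProduct.map (barSignT 𝒜) (coder 𝒜 m) ∘ₗ decon) (linearMap_ext_words fun w => ?_) x
  simp only [LinearMap.comp_apply, LinearMap.add_apply, decon_word, map_splitSum,
    TensorProduct.map_tmul, LinearMap.id_apply]
  induction w with
  | nil => simp [coder_one 𝒜 hm]
  | cons a w ih =>
    have h0 : headOp m (1 : TensorAlgebra R H) = 0 := by
      rw [← word_nil, headOp_word]; simp [hm]
    have hb : ∀ u, barSignT 𝒜 (word R (a :: u)) =
        TensorAlgebra.ι R (barSign 𝒜 a.2) * barSignT 𝒜 (word R u) := by simp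
    rw [coder_cons, map_add, decon_ι_mul, decon_headOp, ih]
    simp only [splitSum_cons, coder_cons 𝒜, word_nil, coder_one 𝒜 hm, h0, TensorProduct.zero_tmul,
      zero_add, barSignT_one, TensorProduct.add_tmul, TensorProduct.tmul_add, splitSum_add,
      mul_add, mul_splitSum, Algebra.TensorProduct.tmul_mul_tmul, one_mul, hb]
    abel

theorem counit_coder (hm : m 1 = 0) (x : TensorAlgebra R H) : counit R H (coder 𝒜 m x) = 0 := by
  refine LinearMap.congr_fun (f := counit R H ∘ₗ coder 𝒜 m) (g := 0)
    (linearMap_ext_words fun w => ?_) x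
  rw [LinearMap.comp_apply, LinearMap.zero_apply]
  cases w with
  | nil => simp [coder_one 𝒜 hm]
  | cons a w =>
    rw [coder_cons, map_add, counit_ι_mul, headOp_word, map_splitSum, add_zero]
    exact splitSum_zero fun u v _ => counit_ι_mul _ _

theorem proj_coder (hm : m 1 = 0) : proj R H ∘ₗ coder 𝒜 m = m := by
  refine linearMap_ext_words fun w => ?_
  cases w with
  | nil => simp [coder_one 𝒜 hm, hm]
  | cons a w =>
    rw [LinearMap.comp_apply, coder_cons, map_add, proj_ι_mul, counit_coder 𝒜 hm, zero_smul,
      add_zero, headOp_word, map_splitSum]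
    simp only [proj_ι_mul, counit_word]
    exact splitSum_eq_last _ _

/-- The co-Leibniz rule in the form used later, as a product rule for convolutions. -/
theorem conv_coder (hm : m 1 = 0) (β : M →ₗ[R] N →ₗ[R] P) (φ : TensorAlgebra R H →ₗ[R] M)
    (ψ : TensorAlgebra R H →ₗ[R] N) (x : TensorAlgebra R H) : conv β φ ψ (coder 𝒜 m x) =
      conv β (φ ∘ₗ coder 𝒜 m) ψ x + conv β (φ ∘ₗ barSignT 𝒜) (ψ ∘ₗ coder 𝒜 m) x := by
  rw [conv_apply, conv_apply, conv_apply, decon_coder 𝒜 hm, map_add, ← LinearMap.comp_apply,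
    ← LinearMap.comp_apply (f := TensorProduct.lift _) (g := TensorProduct.map _ (coder 𝒜 m))]
  congr 2 <;> ext <;> simp

end CoalgebraMaps

/-! ### Degrees and the structure equations -/

section Structure

variable {R H P : Type*} [CommRing R] [AddCommGroup H] [Module R H] [AddCommGroup P] [Module R P]

/-- `φ` raises the bar degree by `e`. -/
def HasBarDegree (𝒜 : ℤ → Submodule R H) (φ : TensorAlgebra R H →ₗ[R] H) (e : ℤ) : Prop :=
  ∀ w, IsHomogeneousWord 𝒜 w → φ (word R w) ∈ 𝒜 (barDeg w + e + 1)

theorem HasBarDegree.apply_mem {𝒜 : ℤ → Submodule R H} {φ : TensorAlgebra R H →ₗ[R] H} {e : ℤ}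
    (hφ : HasBarDegree 𝒜 φ e) {d : ℤ} {x : TensorAlgebra R H} (hx : x ∈ barGrade 𝒜 d) :
    φ x ∈ 𝒜 (d + e + 1) :=
  mem_of_mem_barGrade (fun w hw hd => hd ▸ hφ w hw) hx

theorem hasBarDegree_proj (𝒜 : ℤ → Submodule R H) : HasBarDegree 𝒜 (proj R H) 0 := by
  intro w hw
  rw [proj_word]
  match w, hw with
  | [], _ => simp
  | [a], hw => simpa [barDeg] using (isHomogeneousWord_cons.1 hw).1
  | a :: b :: w, _ => simp

theorem cohom_mem_barGrade {𝒜 : ℤ → Submodule R H} {φ : TensorAlgebra R H →ₗ[R] H} (h1 : φ 1 = 0)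
    (hφ : HasBarDegree 𝒜 φ 0) {d : ℤ} {x : TensorAlgebra R H} (hx : x ∈ barGrade 𝒜 d) :
    cohom φ x ∈ barGrade 𝒜 d := by
  refine mem_of_mem_barGrade (fun w hw hd => ?_) hx
  clear hx x
  induction hn : w.length using Nat.strong_induction_on generalizing w d with
  | _ n ih =>
    cases w with
    | nil => rw [← hd, word_nil, cohom_one h1]; exact word_mem_barGrade hw
    | cons a w =>
      rw [cohom_cons h1]
      refine splitSum_mem _ fun u v huv => ?_
      have h2 : IsHomogeneousWord 𝒜 ((a :: u) ++ v) := by rw [List.cons_append, huv]; exact hw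
      rw [isHomogeneousWord_append] at h2
      have h3 := ι_mul_mem_barGrade (hφ _ h2.1)
        (ih v.length (by rw [← hn, ← huv]; simp) v h2.2 rfl rfl)
      rwa [add_zero, ← barDeg_append, List.cons_append, huv, hd] at h3

variable {𝒜 : ℤ → Submodule R H} [DirectSum.Decomposition 𝒜]

theorem barSign_mem {i : ℤ} {a : H} (ha : a ∈ 𝒜 i) : barSign 𝒜 a ∈ 𝒜 i := by
  rw [barSign_apply 𝒜 ha]; exact unit_smul_mem _ _ ha

theorem coder_mem_barGrade {m : TensorAlgebra R H →ₗ[R] H} (h1 : m 1 = 0)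
    (hm : HasBarDegree 𝒜 m 1) {d : ℤ} {x : TensorAlgebra R H} (hx : x ∈ barGrade 𝒜 d) :
    coder 𝒜 m x ∈ barGrade 𝒜 (d + 1) := by
  refine mem_of_mem_barGrade (fun w hw hd => ?_) hx
  clear hx x
  induction w generalizing d with
  | nil => rw [word_nil, coder_one 𝒜 h1]; exact zero_mem _
  | cons a w ih =>
    rw [coder_cons]
    refine add_mem ?_ ?_
    · rw [headOp_word]
      refine splitSum_mem _ fun u v huv => ?_
      have h2 := hw
      rw [← huv, isHomogeneousWord_append] at h2
      have h3 := ι_mul_mem_barGrade (hm _ h2.1) (word_mem_barGrade h2.2)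
      rwa [add_right_comm, ← barDeg_append, huv, hd] at h3
    · rw [isHomogeneousWord_cons] at hw
      have h3 := ι_mul_mem_barGrade (d := a.1 - 1) (a := barSign 𝒜 a.2)
        (by rw [sub_add_cancel]; exact barSign_mem hw.1) (ih hw.2 rfl)
      rwa [← add_assoc, ← barDeg_cons, hd] at h3

theorem cohom_barSignT {φ : TensorAlgebra R H →ₗ[R] H} (h1 : φ 1 = 0) (hφ : HasBarDegree 𝒜 φ 0) :
    cohom φ ∘ₗ barSignT 𝒜 = barSignT 𝒜 ∘ₗ cohom φ := by
  refine linearMap_ext_word 𝒜 fun w hw => ?_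
  rw [LinearMap.comp_apply, LinearMap.comp_apply, barSignT_word 𝒜 hw, map_unit_smul,
    barSignT_of_mem 𝒜 (cohom_mem_barGrade h1 hφ (word_mem_barGrade hw))]

/-- A map of odd degree anticommutes with the degree sign; this cancels the mixed terms in the
square of a coderivation. -/
theorem barSignT_coder {m : TensorAlgebra R H →ₗ[R] H} (h1 : m 1 = 0) (hm : HasBarDegree 𝒜 m 1) :
    barSignT 𝒜 ∘ₗ coder 𝒜 m = -(coder 𝒜 m ∘ₗ barSignT 𝒜) := by
  refine linearMap_ext_word 𝒜 fun w hw => ?_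
  rw [LinearMap.neg_apply, LinearMap.comp_apply, LinearMap.comp_apply, barSignT_word 𝒜 hw,
    map_unit_smul, barSignT_of_mem 𝒜 (coder_mem_barGrade h1 hm (word_mem_barGrade hw)),
    Int.negOnePow_succ, Units.neg_smul]

theorem conv_sub_right {M N : Type*} [AddCommGroup M] [Module R M] [AddCommGroup N] [Module R N]
    (β : M →ₗ[R] N →ₗ[R] P) (φ : TensorAlgebra R H →ₗ[R] M)
    (ψ ψ' : TensorAlgebra R H →ₗ[R] N) : conv β φ (ψ - ψ') = conv β φ ψ - conv β φ ψ' := by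
  refine linearMap_ext_words fun w => ?_
  rw [LinearMap.sub_apply, conv_word, conv_word, conv_word, ← splitSum_sub]
  simp

theorem conv_sub_left {M N : Type*} [AddCommGroup M] [Module R M] [AddCommGroup N] [Module R N]
    (β : M →ₗ[R] N →ₗ[R] P) (φ φ' : TensorAlgebra R H →ₗ[R] M)
    (ψ : TensorAlgebra R H →ₗ[R] N) : conv β (φ - φ') ψ = conv β φ ψ - conv β φ' ψ := by
  refine linearMap_ext_words fun w => ?_
  rw [LinearMap.sub_apply, conv_word, conv_word, conv_word, ← splitSum_sub]
  simp

theorem conv_zero_left {M N : Type*} [AddCommGroup M] [Module R M] [AddCommGroup N] [Module R N]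
    (β : M →ₗ[R] N →ₗ[R] P) (ψ : TensorAlgebra R H →ₗ[R] N) : conv β 0 ψ = 0 := by
  rw [← sub_self (0 : TensorAlgebra R H →ₗ[R] M), conv_sub_left, sub_self]

theorem conv_neg_left {M N : Type*} [AddCommGroup M] [Module R M] [AddCommGroup N] [Module R N]
    (β : M →ₗ[R] N →ₗ[R] P) (φ : TensorAlgebra R H →ₗ[R] M)
    (ψ : TensorAlgebra R H →ₗ[R] N) : conv β (-φ) ψ = -conv β φ ψ := by
  rw [← zero_sub, conv_sub_left, conv_zero_left, zero_sub]

/-- A coderivation whose square projects to zero squares to zero. -/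
theorem coder_coder {m : TensorAlgebra R H →ₗ[R] H} (h1 : m 1 = 0) (hm : HasBarDegree 𝒜 m 1)
    (h : m ∘ₗ coder 𝒜 m = 0) : coder 𝒜 m ∘ₗ coder 𝒜 m = 0 := by
  -- Two applications of the product rule give four terms. The mixed ones cancel by anticommutation
  -- with the sign, and the term containing `proj ∘ coder ∘ coder` vanishes by hypothesis; the
  -- remaining term is a recursion forcing the square to be zero.
  have key : ∀ x, coder 𝒜 m (coder 𝒜 m x) = conv (LinearMap.mul R _)
      (TensorAlgebra.ι R ∘ₗ proj R H) (coder 𝒜 m ∘ₗ coder 𝒜 m) x := by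
    intro x
    have e1 := barSignT_coder h1 hm
    have e2 : proj R H ∘ₗ coder 𝒜 m ∘ₗ coder 𝒜 m = 0 := by
      rw [← LinearMap.comp_assoc, proj_coder 𝒜 h1, h]
    have e3 : barSignT 𝒜 ∘ₗ barSignT 𝒜 = LinearMap.id := LinearMap.ext (barSignT_barSignT 𝒜)
    conv_lhs => rw [eq_counit_add_conv (coder 𝒜 m (coder 𝒜 m x)), counit_coder 𝒜 h1, map_zero,
      zero_add, conv_coder 𝒜 h1, conv_coder 𝒜 h1, conv_coder 𝒜 h1]
    simp only [LinearMap.comp_assoc, e1, e2, e3, LinearMap.comp_neg, conv_neg_left,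
      LinearMap.comp_zero, conv_zero_left]
    simp
  refine linearMap_ext_words fun w => ?_
  refine eq_zero_of_splitSum (S := fun _ => True) (fun _ _ _ => trivial)
    (Y := fun w => (coder 𝒜 m ∘ₗ coder 𝒜 m) (word R w))
    (fun u x => TensorAlgebra.ι R (proj R H (word R u)) * x) (by simp) (by simp)
    (fun w _ => ?_) w trivial
  rw [LinearMap.comp_apply, key, conv_word]
  rfl

variable (𝒜) in
/-- The failure of `cohom φ` to commute with the coderivations of `m` and `m'`. -/
noncomputable def defect (m m' φ : TensorAlgebra R H →ₗ[R] H) :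
    TensorAlgebra R H →ₗ[R] TensorAlgebra R H :=
  cohom φ ∘ₗ coder 𝒜 m - coder 𝒜 m' ∘ₗ cohom φ

variable {m m' φ : TensorAlgebra R H →ₗ[R] H}

theorem proj_defect (h' : m' 1 = 0) (hφ : φ 1 = 0) :
    proj R H ∘ₗ defect 𝒜 m m' φ = φ ∘ₗ coder 𝒜 m - m' ∘ₗ cohom φ := by
  rw [defect, LinearMap.comp_sub, ← LinearMap.comp_assoc, ← LinearMap.comp_assoc, proj_cohom hφ,
    proj_coder 𝒜 h']

/-- The defect is an odd coderivation along `cohom φ`: it hits one tensor factor while `cohom φ` is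
applied to the other. -/
theorem conv_defect {M N : Type*} [AddCommGroup M] [Module R M] [AddCommGroup N] [Module R N]
    (h : m 1 = 0) (h' : m' 1 = 0) (hφ : φ 1 = 0) (hd : HasBarDegree 𝒜 φ 0)
    (β : M →ₗ[R] N →ₗ[R] P) (f : TensorAlgebra R H →ₗ[R] M) (g : TensorAlgebra R H →ₗ[R] N)
    (x : TensorAlgebra R H) : conv β f g (defect 𝒜 m m' φ x) =
      conv β (f ∘ₗ defect 𝒜 m m' φ) (g ∘ₗ cohom φ) x +
        conv β (f ∘ₗ cohom φ ∘ₗ barSignT 𝒜) (g ∘ₗ defect 𝒜 m m' φ) x := by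
  have hF := isCoalgHom_cohom hφ
  simp only [defect, LinearMap.sub_apply, LinearMap.comp_apply, map_sub, hF.conv_map,
    conv_coder 𝒜 h, conv_coder 𝒜 h', LinearMap.comp_sub, conv_sub_left, conv_sub_right]
  simp only [LinearMap.comp_assoc, cohom_barSignT hφ hd]
  abel

/-- A coderivation along `cohom φ` is determined by its projection to letters. So the morphism
equation, stated for that projection, implies that `cohom φ` intertwines the full coderivations. -/
theorem defect_eq_zero (h : m 1 = 0) (h' : m' 1 = 0) (hφ : φ 1 = 0) (hd : HasBarDegree 𝒜 φ 0)
    (h0 : φ ∘ₗ coder 𝒜 m = m' ∘ₗ cohom φ) : defect 𝒜 m m' φ = 0 := by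
  have h0' : proj R H ∘ₗ defect 𝒜 m m' φ = 0 := by rw [proj_defect h' hφ, h0, sub_self]
  refine linearMap_ext_words fun w => ?_
  refine eq_zero_of_splitSum (S := fun _ => True) (fun _ _ _ => trivial)
    (Y := fun w => defect 𝒜 m m' φ (word R w))
    (fun u x => TensorAlgebra.ι R (proj R H (cohom φ (barSignT 𝒜 (word R u)))) * x)
    (by simp [cohom_one hφ]) (by simp) (fun w _ => ?_) w trivial
  have hc : counit R H (defect 𝒜 m m' φ (word R w)) = 0 := by
    simp [defect, counit_coder 𝒜 h', (isCoalgHom_cohom hφ).counit_map, counit_coder 𝒜 h]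
  conv_lhs => rw [eq_counit_add_conv (defect 𝒜 m m' φ (word R w)), hc, map_zero, zero_add,
    conv_defect h h' hφ hd, LinearMap.comp_assoc, h0']
  rw [LinearMap.comp_zero, conv_zero_left, LinearMap.zero_apply, zero_add, conv_word]
  rfl

/-- The obstruction to extending a morphism is a cocycle. -/
theorem obstruction_cocycle (h : m 1 = 0) (h' : m' 1 = 0) (hφ : φ 1 = 0) (hd : HasBarDegree 𝒜 φ 0)
    (hmm : coder 𝒜 m ∘ₗ coder 𝒜 m = 0) (hmm' : m' ∘ₗ coder 𝒜 m' = 0)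
    (β : H →ₗ[R] H →ₗ[R] H) (hβ : m' = conv β (proj R H) (proj R H)) (x : TensorAlgebra R H) :
    conv β (φ ∘ₗ coder 𝒜 m - m' ∘ₗ cohom φ) φ x +
      conv β (φ ∘ₗ barSignT 𝒜) (φ ∘ₗ coder 𝒜 m - m' ∘ₗ cohom φ) x +
      (φ ∘ₗ coder 𝒜 m - m' ∘ₗ cohom φ) (coder 𝒜 m x) = 0 := by
  -- Since `m'` is quadratic, `m' ∘ defect` expands into the first two terms. As `m' ∘ coder m' =
  -- 0`, it also equals `m' ∘ cohom φ ∘ coder m`, which is minus the third term because `coder m`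
  -- squares to zero.
  have e1 := conv_defect h h' hφ hd β (proj R H) (proj R H) x
  rw [proj_cohom hφ, ← LinearMap.comp_assoc, proj_cohom hφ, proj_defect h' hφ, ← hβ] at e1
  rw [← e1]
  have e2 := LinearMap.congr_fun hmm x
  have e3 := LinearMap.congr_fun hmm' (cohom φ x)
  simp only [LinearMap.comp_apply, LinearMap.zero_apply] at e2 e3
  simp [defect, e2, e3]

end Structure

/-! ### The shuffle product -/

section Shuffle

variable {R H : Type*} [CommRing R] [AddCommGroup H] [Module R H]

variable (R H) in
/-- Convolution with the identity on the left. -/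
noncomputable def convId :
    Module.End R (TensorAlgebra R H) →ₗ[R] Module.End R (TensorAlgebra R H) :=
  LinearMap.lcomp R _ decon ∘ₗ LinearMap.llcomp R _ _ _ (LinearMap.mul' R (TensorAlgebra R H)) ∘ₗ
    LinearMap.lTensorHom (TensorAlgebra R H)

theorem convId_word (Y : Module.End R (TensorAlgebra R H)) (w : List (ℤ × H)) :
    convId R H Y (word R w) = splitSum w fun u v => word R u * Y (word R v) := by
  simp [convId, decon_word, map_splitSum]

@[simp] theorem convId_one (Y : Module.End R (TensorAlgebra R H)) : convId R H Y 1 = Y 1 := by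
  rw [← word_nil, convId_word]; simp

theorem convId_ι_mul (Y : Module.End R (TensorAlgebra R H)) (a : H) (x : TensorAlgebra R H) :
    convId R H Y (TensorAlgebra.ι R a * x) =
      Y (TensorAlgebra.ι R a * x) + TensorAlgebra.ι R a * convId R H Y x := by
  refine LinearMap.congr_fun (f := convId R H Y ∘ₗ LinearMap.mulLeft R (TensorAlgebra.ι R a))
    (g := Y ∘ₗ LinearMap.mulLeft R (TensorAlgebra.ι R a) +
      LinearMap.mulLeft R (TensorAlgebra.ι R a) ∘ₗ convId R H Y)
    (linearMap_ext_words fun w => ?_) x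
  simp only [LinearMap.comp_apply, LinearMap.mulLeft_apply, LinearMap.add_apply]
  rw [← word_cons (0, a), convId_word, splitSum_cons, convId_word, mul_splitSum]
  simp [mul_assoc]

variable (𝒜 : ℤ → Submodule R H) [DirectSum.Decomposition 𝒜]

/-- The projection to the part of even bar degree. -/
noncomputable def evenPart : H →ₗ[R] H := gradedScale 𝒜 fun i => if Even (i - 1) then 1 else 0

/-- The projection to the part of odd bar degree. -/
noncomputable def oddPart : H →ₗ[R] H := gradedScale 𝒜 fun i => if Even (i - 1) then 0 else 1

theorem evenPart_add_oddPart (a : H) : evenPart 𝒜 a + oddPart 𝒜 a = a := by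
  induction a using DirectSum.Decomposition.inductionOn 𝒜 with
  | zero => simp
  | @homogeneous i a =>
    rw [evenPart, oddPart, gradedScale_apply 𝒜 _ a.2, gradedScale_apply 𝒜 _ a.2]
    split_ifs <;> simp
  | add a b ha hb => rw [map_add, map_add, add_add_add_comm, ha, hb]

/-- The recursion step of the shuffle product: a letter of the second word is inserted into the
first word, followed by shuffles. -/
noncomputable def shuffleStep : H →ₗ[R] Module.End R (Module.End R (TensorAlgebra R H)) :=
  -- `convId` chooses where `b` is inserted. The sign for passing the remaining letters of the first
  -- word depends on `b` only through its parity: none for even `b`, `barSignT` for odd `b`.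
  -- Separating the parities keeps the step linear in `b`.
  LinearMap.mk₂ R (fun b X => convId R H
      (LinearMap.mulLeft R (TensorAlgebra.ι R (evenPart 𝒜 b)) ∘ₗ X +
        LinearMap.mulLeft R (TensorAlgebra.ι R (oddPart 𝒜 b)) ∘ₗ X ∘ₗ barSignT 𝒜))
    (fun a b X => by rw [← map_add]; congr 1; ext; simp [add_mul]; abel)
    (fun r b X => by rw [← map_smul]; congr 1; ext; simp)
    (fun b X Y => by rw [← map_add]; congr 1; ext; simp [mul_add]; abel)
    (fun r b X => by rw [← map_smul]; congr 1; ext; simp)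

/-- The signed shuffle product on the tensor algebra. -/
noncomputable def shuffle :
    TensorAlgebra R H →ₗ[R] TensorAlgebra R H →ₗ[R] TensorAlgebra R H :=
  (fold (shuffleStep 𝒜) LinearMap.id).flip

@[simp] theorem shuffle_one (x : TensorAlgebra R H) : shuffle 𝒜 x 1 = x := by simp [shuffle]

theorem shuffle_ι_mul_right (x : TensorAlgebra R H) (b : H) (y : TensorAlgebra R H) :
    shuffle 𝒜 x (TensorAlgebra.ι R b * y) = convId R H
      (LinearMap.mulLeft R (TensorAlgebra.ι R (evenPart 𝒜 b)) ∘ₗ (shuffle 𝒜).flip y +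
        LinearMap.mulLeft R (TensorAlgebra.ι R (oddPart 𝒜 b)) ∘ₗ (shuffle 𝒜).flip y ∘ₗ
          barSignT 𝒜) x := by
  simp only [shuffle, LinearMap.flip_apply, fold_ι_mul, LinearMap.flip_flip]
  rfl

@[simp] theorem one_shuffle (x : TensorAlgebra R H) : shuffle 𝒜 1 x = x := by
  refine LinearMap.congr_fun (f := shuffle 𝒜 1) (g := LinearMap.id)
    (linearMap_ext_words fun w => ?_) x
  induction w with
  | nil => simp
  | cons b w ih =>
    rw [word_cons, shuffle_ι_mul_right, convId_one]
    simp only [LinearMap.add_apply, LinearMap.comp_apply, LinearMap.flip_apply, barSignT_one,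
      LinearMap.mulLeft_apply, ih]
    rw [← add_mul, ← map_add, evenPart_add_oddPart]
    rfl

/-- The recursion defining `shuffles`, for arbitrary tails, with only the bar degree of the first
factor prescribed. This generality is needed because `cohom` and `coder` produce sums of words. -/
theorem shuffle_ι_mul_ι_mul {i d : ℤ} {a b : H} (hb : b ∈ 𝒜 i) {x : TensorAlgebra R H}
    (hx : TensorAlgebra.ι R a * x ∈ barGrade 𝒜 d) (y : TensorAlgebra R H) :
    shuffle 𝒜 (TensorAlgebra.ι R a * x) (TensorAlgebra.ι R b * y) =
      TensorAlgebra.ι R a * shuffle 𝒜 x (TensorAlgebra.ι R b * y) + ((i - 1) * d).negOnePow •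
        (TensorAlgebra.ι R b * shuffle 𝒜 (TensorAlgebra.ι R a * x) y) := by
  rw [shuffle_ι_mul_right, convId_ι_mul, ← shuffle_ι_mul_right, add_comm]
  congr 1
  simp only [LinearMap.add_apply, LinearMap.comp_apply, LinearMap.mulLeft_apply,
    LinearMap.flip_apply]
  rw [barSignT_of_mem 𝒜 hx, evenPart, oddPart, gradedScale_apply 𝒜 _ hb, gradedScale_apply 𝒜 _ hb]
  split_ifs with h
  · rw [Int.negOnePow_even _ (h.mul_right d)]; simp
  · rw [Int.not_even_iff_odd] at h
    have h2 : ((i - 1) * d).negOnePow = d.negOnePow := by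
      rw [Int.negOnePow_eq_iff, ← sub_one_mul]
      exact (Int.even_sub_one.2 (Int.not_even_iff_odd.2 h)).mul_right d
    rw [h2, map_unit_smul, zero_smul, map_zero, zero_mul, zero_add, one_smul, Units.smul_def,
      LinearMap.smul_apply, ← Units.smul_def, mul_unit_smul]

theorem shuffle_cons_cons {a b : ℤ × H} {u : List (ℤ × H)} (hu : IsHomogeneousWord 𝒜 (a :: u))
    (hb : b.2 ∈ 𝒜 b.1) (v : List (ℤ × H)) :
    shuffle 𝒜 (word R (a :: u)) (word R (b :: v)) =
      TensorAlgebra.ι R a.2 * shuffle 𝒜 (word R u) (word R (b :: v)) +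
        ((b.1 - 1) * barDeg (a :: u)).negOnePow •
          (TensorAlgebra.ι R b.2 * shuffle 𝒜 (word R (a :: u)) (word R v)) := by
  have := word_mem_barGrade hu
  rw [word_cons] at this
  rw [word_cons, word_cons, shuffle_ι_mul_ι_mul 𝒜 hb this]

theorem shuffle_word {u v : List (ℤ × H)} (hu : IsHomogeneousWord 𝒜 u)
    (hv : IsHomogeneousWord 𝒜 v) : shuffle 𝒜 (word R u) (word R v) =
      ((shuffles u v).map fun s => s.1 • word R s.2).sum := by
  induction u generalizing v with
  | nil => simp [shuffles]
  | cons a u ihu =>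
    induction v with
    | nil => simp [shuffles]
    | cons b v ihv =>
      have hu' := isHomogeneousWord_cons.1 hu
      have hv' := isHomogeneousWord_cons.1 hv
      rw [shuffle_cons_cons 𝒜 hu hv'.1, ihu hu'.2 hv, ihv hv'.2, shuffles]
      simp only [List.map_append, List.sum_append, List.map_map, Function.comp_def, word_cons,
        mul_unit_smul, mul_smul, List.smul_sum, ← List.sum_map_mul_left]

/-- The shuffle product is multiplicative for deconcatenation. -/
theorem decon_shuffle {u v : List (ℤ × H)} (hu : IsHomogeneousWord 𝒜 u)
    (hv : IsHomogeneousWord 𝒜 v) : decon (shuffle 𝒜 (word R u) (word R v)) =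
      splitSum u fun u₁ u₂ => splitSum v fun v₁ v₂ => (barDeg u₂ * barDeg v₁).negOnePow •
        (shuffle 𝒜 (word R u₁) (word R v₁) ⊗ₜ[R] shuffle 𝒜 (word R u₂) (word R v₂)) := by
  induction u generalizing v with
  | nil => simp [decon_word]
  | cons a u ihu =>
    induction v with
    | nil =>
      rw [word_nil, shuffle_one, decon_word]
      simp
    | cons b v ihv =>
      have hu' := isHomogeneousWord_cons.1 hu
      have hv' := isHomogeneousWord_cons.1 hv
      -- When both words contribute to the left tensor factor, the shuffle recursion separates the
      -- terms by which word supplies its first letter; `key₀` is the sign when the first word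
      -- contributes nothing to it.
      have key : ∀ u₁ u₂ v₁ v₂, u₁ ++ u₂ = u → (barDeg u₂ * barDeg (b :: v₁)).negOnePow •
          (shuffle 𝒜 (word R (a :: u₁)) (word R (b :: v₁)) ⊗ₜ[R]
            shuffle 𝒜 (word R u₂) (word R v₂)) =
          (barDeg u₂ * barDeg (b :: v₁)).negOnePow •
          ((TensorAlgebra.ι R a.2 * shuffle 𝒜 (word R u₁) (word R (b :: v₁))) ⊗ₜ[R]
            shuffle 𝒜 (word R u₂) (word R v₂)) +
          ((b.1 - 1) * barDeg (a :: u)).negOnePow • (barDeg u₂ * barDeg v₁).negOnePow •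
          ((TensorAlgebra.ι R b.2 * shuffle 𝒜 (word R (a :: u₁)) (word R v₁)) ⊗ₜ[R]
            shuffle 𝒜 (word R u₂) (word R v₂)) := by
        intro u₁ u₂ v₁ v₂ huv
        have h1 : IsHomogeneousWord 𝒜 (a :: u₁) := by
          rw [← huv, ← List.cons_append, isHomogeneousWord_append] at hu
          exact hu.1
        rw [shuffle_cons_cons 𝒜 h1 hv'.1, TensorProduct.add_tmul, smul_add, unit_smul_tmul,
          smul_smul, smul_smul, ← Int.negOnePow_add, ← Int.negOnePow_add]
        congr 3
        rw [← huv, barDeg_cons, barDeg_cons, barDeg_cons, barDeg_append]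
        ring
      have key₀ : ∀ v₁ : List (ℤ × H), (barDeg (a :: u) * barDeg (b :: v₁)).negOnePow =
          ((b.1 - 1) * barDeg (a :: u)).negOnePow * (barDeg (a :: u) * barDeg v₁).negOnePow := by
        intro v₁
        rw [← Int.negOnePow_add, barDeg_cons b]
        congr 1
        ring
      rw [shuffle_cons_cons 𝒜 hu hv'.1, map_add, map_unit_smul, decon_ι_mul, decon_ι_mul,
        ihu hu'.2 hv, ihv hv'.2]
      conv_rhs =>
        rw [splitSum_cons]
        simp only [splitSum_cons b, splitSum_add]
        rw [splitSum_congr (w := u) (g' := _) fun u₁ u₂ huv => splitSum_congr (g' := _)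
          fun v₁ v₂ _ => key u₁ u₂ v₁ v₂ huv]
      simp only [splitSum_add, splitSum_cons a u, splitSum_cons b v, mul_splitSum, mul_unit_smul,
        Algebra.TensorProduct.tmul_mul_tmul, one_mul, word_nil, one_shuffle, shuffle_one, key₀,
        mul_add, smul_add, ← splitSum_smul, mul_smul, barDeg_nil, mul_zero, Int.negOnePow_zero,
        one_smul, word_cons]
      have hs := congrArg (fun x => (1 : TensorAlgebra R H) ⊗ₜ[R] x) (shuffle_cons_cons 𝒜 hu hv'.1 v)
      simp only [word_cons, TensorProduct.tmul_add, tmul_unit_smul] at hs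
      rw [hs]
      abel

/-- `φ` vanishes on shuffle products of nonempty words. -/
def KillsShuffles {M : Type*} [AddCommGroup M] [Module R M] (φ : TensorAlgebra R H →ₗ[R] M) :
    Prop :=
  ∀ u v, u ≠ [] → v ≠ [] → IsHomogeneousWord 𝒜 u → IsHomogeneousWord 𝒜 v →
    φ (shuffle 𝒜 (word R u) (word R v)) = 0

/-- Only the two edges `u₁ = []` and `v₁ = []` of the double sum survive. Their common corner would
be counted twice, hence the assumption that it vanishes. -/
theorem splitSum_splitSum_of_eq_zero {X Y M : Type*} [AddCommGroup M] {u : List X} {v : List Y}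
    {g : List X → List X → List Y → List Y → M} (h0 : g [] u [] v = 0)
    (h : ∀ u₁ u₂ v₁ v₂, u₁ ++ u₂ = u → v₁ ++ v₂ = v → u₁ ≠ [] → v₁ ≠ [] → g u₁ u₂ v₁ v₂ = 0) :
    (splitSum u fun u₁ u₂ => splitSum v fun v₁ v₂ => g u₁ u₂ v₁ v₂) =
      (splitSum u fun u₁ u₂ => g u₁ u₂ [] v) + splitSum v fun v₁ v₂ => g [] u v₁ v₂ := by
  cases u with
  | nil => simp [h0]
  | cons a u =>
    rw [splitSum_cons, splitSum_cons, h0, zero_add, add_comm]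
    congr 1
    refine splitSum_congr fun u₁ u₂ hu => ?_
    cases v with
    | nil => rfl
    | cons b v =>
      rw [splitSum_cons, splitSum_zero, add_zero]
      intro v₁ v₂ hv
      exact h _ _ _ _ (by simp [hu]) (by simp [hv]) (by simp) (by simp)

theorem splitSum_apply {X M N P : Type*} [AddCommGroup M] [Module R M] [AddCommGroup N] [Module R N]
    [AddCommGroup P] [Module R P] (B : M →ₗ[R] N →ₗ[R] P) (w : List X)
    (g : List X → List X → M) (y : N) :
    B (splitSum w g) y = splitSum w fun u v => B (g u v) y :=
  map_splitSum (B.flip y) w g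

/-- If `φ` vanishes on shuffles, `∑ φ(x₁) ψ(x₂)` has a simple form on shuffle products. -/
theorem conv_shuffle {φ : TensorAlgebra R H →ₗ[R] H} (h1 : φ 1 = 0) (hφ : KillsShuffles 𝒜 φ)
    (ψ : Module.End R (TensorAlgebra R H)) {u v : List (ℤ × H)}
    (hu : IsHomogeneousWord 𝒜 u) (hv : IsHomogeneousWord 𝒜 v) :
    conv (LinearMap.mul R _) (TensorAlgebra.ι R ∘ₗ φ) ψ (shuffle 𝒜 (word R u) (word R v)) =
      (splitSum u fun u₁ u₂ => TensorAlgebra.ι R (φ (word R u₁)) *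
        ψ (shuffle 𝒜 (word R u₂) (word R v))) +
      splitSum v fun v₁ v₂ => (barDeg u * barDeg v₁).negOnePow •
        (TensorAlgebra.ι R (φ (word R v₁)) * ψ (shuffle 𝒜 (word R u) (word R v₂))) := by
  rw [conv_apply, decon_shuffle 𝒜 hu hv, map_splitSum]
  simp only [map_splitSum, map_unit_smul, TensorProduct.lift.tmul, LinearMap.compl₁₂_apply,
    LinearMap.mul_apply', LinearMap.comp_apply]
  rw [splitSum_splitSum_of_eq_zero]
  · simp
  · simp [h1]
  · intro u₁ u₂ v₁ v₂ hu' hv' hu₁ hv₁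
    rw [← hu', isHomogeneousWord_append] at hu
    rw [← hv', isHomogeneousWord_append] at hv
    rw [hφ u₁ v₁ hu₁ hv₁ hu.1 hv.1]
    simp

theorem counit_shuffle_cons {u v : List (ℤ × H)} (h : u ≠ []) (hu : IsHomogeneousWord 𝒜 u)
    (hv : IsHomogeneousWord 𝒜 v) : counit R H (shuffle 𝒜 (word R u) (word R v)) = 0 := by
  cases u with
  | nil => exact absurd rfl h
  | cons a u =>
    cases v with
    | nil => simp
    | cons b v =>
      rw [shuffle_cons_cons 𝒜 hu (isHomogeneousWord_cons.1 hv).1, map_add, map_unit_smul]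
      simp

/-- As `φ` kills shuffles, the first block of a shuffle of `u` and `v` comes entirely from one of
the two words. This is the recursion for shuffling the two words of blocks. -/
theorem cohom_shuffle {φ : TensorAlgebra R H →ₗ[R] H} (h1 : φ 1 = 0) (hd : HasBarDegree 𝒜 φ 0)
    (hφ : KillsShuffles 𝒜 φ) {u v : List (ℤ × H)}
    (hu : IsHomogeneousWord 𝒜 u) (hv : IsHomogeneousWord 𝒜 v) :
    cohom φ (shuffle 𝒜 (word R u) (word R v)) =
      shuffle 𝒜 (cohom φ (word R u)) (cohom φ (word R v)) := by
  induction hn : u.length + v.length using Nat.strong_induction_on generalizing u v with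
  | _ n ih =>
    by_cases hu0 : u = []
    · subst hu0; simp [cohom_one h1]
    by_cases hv0 : v = []
    · subst hv0; simp [cohom_one h1]
    have hF := isCoalgHom_cohom h1
    rw [hF.apply_eq, counit_shuffle_cons 𝒜 hu0 hu hv, map_zero, zero_add, proj_cohom h1,
      conv_shuffle 𝒜 h1 hφ _ hu hv]
    have key : ∀ u₁ u₂ v₁ v₂, u₁ ++ u₂ = u → v₁ ++ v₂ = v →
        shuffle 𝒜 (TensorAlgebra.ι R (φ (word R u₁)) * cohom φ (word R u₂))
          (TensorAlgebra.ι R (φ (word R v₁)) * cohom φ (word R v₂)) =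
        TensorAlgebra.ι R (φ (word R u₁)) * shuffle 𝒜 (cohom φ (word R u₂))
          (TensorAlgebra.ι R (φ (word R v₁)) * cohom φ (word R v₂)) +
        (barDeg u * barDeg v₁).negOnePow • (TensorAlgebra.ι R (φ (word R v₁)) *
          shuffle 𝒜 (TensorAlgebra.ι R (φ (word R u₁)) * cohom φ (word R u₂))
            (cohom φ (word R v₂))) := by
      intro u₁ u₂ v₁ v₂ hu' hv'
      rw [← hu', isHomogeneousWord_append] at hu
      rw [← hv', isHomogeneousWord_append] at hv
      have h3 := ι_mul_mem_barGrade (d := barDeg u₁) (by simpa using hd _ hu.1)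
        (cohom_mem_barGrade h1 hd (word_mem_barGrade hu.2))
      rw [← barDeg_append, hu'] at h3
      rw [shuffle_ι_mul_ι_mul 𝒜 (by simpa using hd _ hv.1) h3, add_sub_cancel_right,
        mul_comm (barDeg v₁)]
    -- The right side is expanded by the first block of each word, so that `key` applies termwise.
    trans splitSum u fun u₁ u₂ => splitSum v fun v₁ v₂ =>
        shuffle 𝒜 (TensorAlgebra.ι R (φ (word R u₁)) * cohom φ (word R u₂))
          (TensorAlgebra.ι R (φ (word R v₁)) * cohom φ (word R v₂))
    swap
    · rw [cohom_word h1 hu0, cohom_word h1 hv0, splitSum_apply]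
      simp only [map_splitSum]
    rw [splitSum_congr (w := u) (g' := _) fun u₁ u₂ hu' => splitSum_congr (g' := _)
      fun v₁ v₂ hv' => key u₁ u₂ v₁ v₂ hu' hv']
    simp only [splitSum_add]
    congr 1
    · refine splitSum_congr_homogeneous hu fun u₁ u₂ hu₁ hu₂ huv => ?_
      cases u₁ with
      | nil => simp [h1, splitSum_zero]
      | cons a u₁ =>
        rw [ih _ (by rw [← hn, ← huv]; simp) hu₂ hv rfl, ← mul_splitSum, ← map_splitSum,
          ← cohom_word h1 hv0]
    · rw [splitSum_comm]
      refine splitSum_congr_homogeneous hv fun v₁ v₂ hv₁ hv₂ huv => ?_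
      cases v₁ with
      | nil => simp [h1, splitSum_zero]
      | cons a v₁ =>
        rw [ih _ (by rw [← hn, ← huv]; simp) hu hv₂ rfl, splitSum_smul, ← mul_splitSum,
          ← splitSum_apply, ← cohom_word h1 hu0]

theorem coder_ι_mul (m : TensorAlgebra R H →ₗ[R] H) (a : H) (x : TensorAlgebra R H) :
    coder 𝒜 m (TensorAlgebra.ι R a * x) =
      headOp m (TensorAlgebra.ι R a * x) + TensorAlgebra.ι R (barSign 𝒜 a) * coder 𝒜 m x := by
  refine LinearMap.congr_fun (f := coder 𝒜 m ∘ₗ LinearMap.mulLeft R (TensorAlgebra.ι R a))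
    (g := headOp m ∘ₗ LinearMap.mulLeft R (TensorAlgebra.ι R a) +
      LinearMap.mulLeft R (TensorAlgebra.ι R (barSign 𝒜 a)) ∘ₗ coder 𝒜 m)
    (linearMap_ext_words fun w => ?_) x
  have := coder_cons 𝒜 (m := m) (0, a) w
  rw [word_cons] at this
  simpa using this

theorem headOp_shuffle {m : TensorAlgebra R H →ₗ[R] H} (h1 : m 1 = 0) (hm : KillsShuffles 𝒜 m)
    {u v : List (ℤ × H)} (hu : IsHomogeneousWord 𝒜 u) (hv : IsHomogeneousWord 𝒜 v) :
    headOp m (shuffle 𝒜 (word R u) (word R v)) =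
      (splitSum u fun u₁ u₂ => TensorAlgebra.ι R (m (word R u₁)) *
        shuffle 𝒜 (word R u₂) (word R v)) +
      splitSum v fun v₁ v₂ => (barDeg u * barDeg v₁).negOnePow •
        (TensorAlgebra.ι R (m (word R v₁)) * shuffle 𝒜 (word R u) (word R v₂)) :=
  conv_shuffle 𝒜 h1 hm _ hu hv

/-- An operation killing shuffles must take its whole segment from one word, which gives the graded
derivation rule. The proof compares the recursions by first letters, with the operation acting at
the head or past it. -/
theorem coder_shuffle {m : TensorAlgebra R H →ₗ[R] H} (h1 : m 1 = 0) (hd : HasBarDegree 𝒜 m 1)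
    (hm : KillsShuffles 𝒜 m) {u v : List (ℤ × H)}
    (hu : IsHomogeneousWord 𝒜 u) (hv : IsHomogeneousWord 𝒜 v) :
    coder 𝒜 m (shuffle 𝒜 (word R u) (word R v)) =
      shuffle 𝒜 (coder 𝒜 m (word R u)) (word R v) +
        (barDeg u).negOnePow • shuffle 𝒜 (word R u) (coder 𝒜 m (word R v)) := by
  induction u generalizing v with
  | nil => simp [coder_one 𝒜 h1]
  | cons a u ihu =>
    induction v with
    | nil => simp [coder_one 𝒜 h1]
    | cons b v ihv =>
      have hu' := isHomogeneousWord_cons.1 hu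
      have hv' := isHomogeneousWord_cons.1 hv
      have hD : ∀ w, IsHomogeneousWord 𝒜 w → coder 𝒜 m (word R w) ∈ barGrade 𝒜 (barDeg w + 1) :=
        fun w hw => coder_mem_barGrade h1 hd (word_mem_barGrade hw)
      -- the operation applied inside the first word
      have e1 : shuffle 𝒜 (headOp m (word R (a :: u))) (word R (b :: v)) =
          (splitSum (a :: u) fun u₁ u₂ => TensorAlgebra.ι R (m (word R u₁)) *
            shuffle 𝒜 (word R u₂) (word R (b :: v))) +
          ((b.1 - 1) * (barDeg (a :: u) + 1)).negOnePow • (TensorAlgebra.ι R b.2 *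
            shuffle 𝒜 (headOp m (word R (a :: u))) (word R v)) := by
        rw [headOp_word, splitSum_apply, splitSum_apply, mul_splitSum, ← splitSum_smul,
          ← splitSum_add]
        refine splitSum_congr_homogeneous hu fun u₁ u₂ hu₁ hu₂ huv => ?_
        have h3 := ι_mul_mem_barGrade (hd _ hu₁) (word_mem_barGrade hu₂)
        rw [add_right_comm, ← barDeg_append, huv] at h3
        rw [word_cons b, shuffle_ι_mul_ι_mul 𝒜 hv'.1 h3]
      have e2 : shuffle 𝒜 (TensorAlgebra.ι R (barSign 𝒜 a.2) * coder 𝒜 m (word R u))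
          (word R (b :: v)) = TensorAlgebra.ι R (barSign 𝒜 a.2) *
            shuffle 𝒜 (coder 𝒜 m (word R u)) (word R (b :: v)) +
          ((b.1 - 1) * (barDeg (a :: u) + 1)).negOnePow • (TensorAlgebra.ι R b.2 *
            shuffle 𝒜 (TensorAlgebra.ι R (barSign 𝒜 a.2) * coder 𝒜 m (word R u)) (word R v)) := by
        have h3 := ι_mul_mem_barGrade (d := a.1 - 1) (a := barSign 𝒜 a.2)
          (by rw [sub_add_cancel]; exact barSign_mem hu'.1) (hD u hu'.2)
        rw [← add_assoc, ← barDeg_cons] at h3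
        rw [word_cons b, shuffle_ι_mul_ι_mul 𝒜 hv'.1 h3]
      -- the operation applied inside the second word
      have hau := word_mem_barGrade hu
      rw [word_cons] at hau
      have e3 : shuffle 𝒜 (word R (a :: u)) (headOp m (word R (b :: v))) =
          TensorAlgebra.ι R a.2 * shuffle 𝒜 (word R u) (headOp m (word R (b :: v))) +
          splitSum (b :: v) fun v₁ v₂ => (barDeg (a :: u)).negOnePow •
            (barDeg (a :: u) * barDeg v₁).negOnePow • (TensorAlgebra.ι R (m (word R v₁)) *
            shuffle 𝒜 (word R (a :: u)) (word R v₂)) := by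
        rw [headOp_word, map_splitSum, map_splitSum, mul_splitSum, ← splitSum_add]
        refine splitSum_congr_homogeneous hv fun v₁ v₂ hv₁ hv₂ huv => ?_
        rw [word_cons a, shuffle_ι_mul_ι_mul 𝒜 (hd _ hv₁) hau, smul_smul, ← Int.negOnePow_add]
        congr 3
        ring
      have e4 : shuffle 𝒜 (word R (a :: u)) (TensorAlgebra.ι R (barSign 𝒜 b.2) *
            coder 𝒜 m (word R v)) =
          TensorAlgebra.ι R a.2 * shuffle 𝒜 (word R u) (TensorAlgebra.ι R (barSign 𝒜 b.2) *
            coder 𝒜 m (word R v)) +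
          ((b.1 - 1) * barDeg (a :: u)).negOnePow • (TensorAlgebra.ι R (barSign 𝒜 b.2) *
            shuffle 𝒜 (word R (a :: u)) (coder 𝒜 m (word R v))) := by
        rw [word_cons a, shuffle_ι_mul_ι_mul 𝒜 (barSign_mem hv'.1) hau]
      have hs := headOp_shuffle 𝒜 h1 hm hu hv
      have e5 : coder 𝒜 m (shuffle 𝒜 (word R (a :: u)) (word R (b :: v))) =
          headOp m (shuffle 𝒜 (word R (a :: u)) (word R (b :: v))) +
          TensorAlgebra.ι R (barSign 𝒜 a.2) *
            coder 𝒜 m (shuffle 𝒜 (word R u) (word R (b :: v))) +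
          ((b.1 - 1) * barDeg (a :: u)).negOnePow • (TensorAlgebra.ι R (barSign 𝒜 b.2) *
            coder 𝒜 m (shuffle 𝒜 (word R (a :: u)) (word R v))) := by
        rw [shuffle_cons_cons 𝒜 hu hv'.1, map_add, map_add, map_unit_smul, map_unit_smul,
          coder_ι_mul, coder_ι_mul, smul_add]
        abel
      have f1 : ∀ x, TensorAlgebra.ι R (barSign 𝒜 a.2) * ((barDeg u).negOnePow • x) =
          (barDeg (a :: u)).negOnePow • (TensorAlgebra.ι R a.2 * x) := by
        intro x
        rw [barSign_apply 𝒜 hu'.1, map_unit_smul, unit_smul_mul, mul_unit_smul, smul_smul,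
          ← Int.negOnePow_add, barDeg_cons]
      have f2 : ∀ x, ((b.1 - 1) * barDeg (a :: u)).negOnePow •
          (TensorAlgebra.ι R (barSign 𝒜 b.2) * x) =
          ((b.1 - 1) * (barDeg (a :: u) + 1)).negOnePow • (TensorAlgebra.ι R b.2 * x) := by
        intro x
        rw [barSign_apply 𝒜 hv'.1, map_unit_smul, unit_smul_mul, smul_smul, ← Int.negOnePow_add]
        congr 2
        ring
      have f3 : ∀ (s : ℤˣ) x, ((b.1 - 1) * barDeg (a :: u)).negOnePow •
          (TensorAlgebra.ι R (barSign 𝒜 b.2) * (s • x)) =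
          s • ((b.1 - 1) * barDeg (a :: u)).negOnePow •
            (TensorAlgebra.ι R (barSign 𝒜 b.2) * x) := by
        intro s x
        rw [mul_unit_smul, smul_comm]
      have f4 : ∀ x : TensorAlgebra R H, (barDeg (a :: u)).negOnePow •
          (barDeg (a :: u)).negOnePow • x = x := by
        intro x
        rw [smul_smul, ← Int.negOnePow_add, Int.negOnePow_even _ ⟨_, rfl⟩, one_smul]
      rw [e5, hs, ihu hu'.2 hv, ihv hv'.2, mul_add (TensorAlgebra.ι R (barSign 𝒜 a.2)), f1,
        mul_add (TensorAlgebra.ι R (barSign 𝒜 b.2)), smul_add, f3, f2, coder_cons 𝒜 a u,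
        coder_cons 𝒜 b v]
      simp only [map_add, LinearMap.add_apply, e1, e2, e3, e4, mul_add, smul_add, splitSum_smul, f4]
      abel

end Shuffle

/-! ### The ideal of shuffle products and the inverse of a coalgebra isomorphism -/

section Inverse

set_option linter.unusedSectionVars false

variable {R H M : Type*} [CommRing R] [AddCommGroup H] [Module R H] [AddCommGroup M] [Module R M]
  (𝒜 : ℤ → Submodule R H) [DirectSum.Decomposition 𝒜]

/-- The span of the shuffle products of nonempty words. -/
def shuffleSpan : Submodule R (TensorAlgebra R H) :=
  Submodule.span R {x | ∃ u v, u ≠ [] ∧ v ≠ [] ∧ IsHomogeneousWord 𝒜 u ∧ IsHomogeneousWord 𝒜 v ∧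
    shuffle 𝒜 (word R u) (word R v) = x}

variable {𝒜}

theorem killsShuffles_iff {φ : TensorAlgebra R H →ₗ[R] M} :
    KillsShuffles 𝒜 φ ↔ ∀ x ∈ shuffleSpan 𝒜, φ x = 0 := by
  constructor
  · intro h x hx
    have : shuffleSpan 𝒜 ≤ LinearMap.ker φ := Submodule.span_le.2 (by
      rintro _ ⟨u, v, hu, hv, hu', hv', rfl⟩; exact h u v hu hv hu' hv')
    exact this hx
  · intro h u v hu hv hu' hv'
    exact h _ (Submodule.subset_span ⟨u, v, hu, hv, hu', hv', rfl⟩)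

theorem mem_span_of_counit_eq_zero {x : TensorAlgebra R H} (hx : counit R H x = 0) :
    x ∈ Submodule.span R (word R '' {w | IsHomogeneousWord 𝒜 w ∧ w ≠ []}) := by
  set p := Submodule.span R (word R '' {w | IsHomogeneousWord 𝒜 w ∧ w ≠ []})
  have h : ∀ x : TensorAlgebra R H, x - algebraMap R _ (counit R H x) ∈ p := by
    intro x
    have hx : x ∈ Submodule.span R (word R '' {w : List (ℤ × H) | IsHomogeneousWord 𝒜 w}) := by
      rw [span_word_eq_top 𝒜]; trivial
    induction hx using Submodule.span_induction with
    | mem x hx =>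
      obtain ⟨w, hw, rfl⟩ := hx
      cases w with
      | nil => simp
      | cons a w =>
        rw [counit_word, if_neg (by simp), map_zero, sub_zero]
        exact Submodule.subset_span ⟨_, ⟨hw, by simp⟩, rfl⟩
    | zero => simp
    | add x y _ _ hx hy =>
      rw [map_add, map_add, add_sub_add_comm]; exact add_mem hx hy
    | smul r x _ hx =>
      rw [map_smul, Algebra.algebraMap_eq_smul_one, smul_assoc, ← Algebra.algebraMap_eq_smul_one,
        ← smul_sub]
      exact Submodule.smul_mem _ r hx
  simpa [hx] using h x

theorem shuffle_mem_shuffleSpan {x y : TensorAlgebra R H} (hx : counit R H x = 0)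
    (hy : counit R H y = 0) : shuffle 𝒜 x y ∈ shuffleSpan 𝒜 := by
  have hx' := mem_span_of_counit_eq_zero (𝒜 := 𝒜) hx
  have hy' := mem_span_of_counit_eq_zero (𝒜 := 𝒜) hy
  clear hx hy
  induction hx' using Submodule.span_induction with
  | mem x hx =>
    obtain ⟨u, hu, rfl⟩ := hx
    induction hy' using Submodule.span_induction with
    | mem y hy =>
      obtain ⟨v, hv, rfl⟩ := hy
      exact Submodule.subset_span ⟨u, v, hu.2, hv.2, hu.1, hv.1, rfl⟩
    | zero => simp
    | add x y _ _ hx hy => rw [map_add]; exact add_mem hx hy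
    | smul r x _ hx => rw [map_smul]; exact Submodule.smul_mem _ r hx
  | zero => simp
  | add x y _ _ hx hy => rw [map_add]; exact add_mem hx hy
  | smul r x _ hx => rw [map_smul]; exact Submodule.smul_mem _ r hx

theorem counit_word_of_ne_nil {w : List (ℤ × H)} (h : w ≠ []) : counit R H (word R w) = 0 := by
  rw [counit_word, if_neg h]

/-- Multiplicativity for shuffles, together with preservation of the augmentation ideal. -/
theorem cohom_mem_shuffleSpan {φ : TensorAlgebra R H →ₗ[R] H} (h1 : φ 1 = 0)
    (hd : HasBarDegree 𝒜 φ 0) (hφ : KillsShuffles 𝒜 φ) {x : TensorAlgebra R H}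
    (hx : x ∈ shuffleSpan 𝒜) : cohom φ x ∈ shuffleSpan 𝒜 := by
  have : shuffleSpan 𝒜 ≤ (shuffleSpan 𝒜).comap (cohom φ) := Submodule.span_le.2 (by
    rintro _ ⟨u, v, hu, hv, hu', hv', rfl⟩
    have hF := isCoalgHom_cohom h1
    simp only [Submodule.comap_coe, Set.mem_preimage, SetLike.mem_coe]
    rw [cohom_shuffle 𝒜 h1 hd hφ hu' hv']
    exact shuffle_mem_shuffleSpan (by rw [hF.counit_map, counit_word_of_ne_nil hu])
      (by rw [hF.counit_map, counit_word_of_ne_nil hv]))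
  exact this hx

theorem coder_mem_shuffleSpan {m : TensorAlgebra R H →ₗ[R] H} (h1 : m 1 = 0)
    (hd : HasBarDegree 𝒜 m 1) (hm : KillsShuffles 𝒜 m) {x : TensorAlgebra R H}
    (hx : x ∈ shuffleSpan 𝒜) : coder 𝒜 m x ∈ shuffleSpan 𝒜 := by
  have : shuffleSpan 𝒜 ≤ (shuffleSpan 𝒜).comap (coder 𝒜 m) := Submodule.span_le.2 (by
    rintro _ ⟨u, v, hu, hv, hu', hv', rfl⟩
    simp only [Submodule.comap_coe, Set.mem_preimage, SetLike.mem_coe]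
    rw [coder_shuffle 𝒜 h1 hd hm hu' hv']
    exact add_mem (shuffle_mem_shuffleSpan (counit_coder 𝒜 h1 _) (counit_word_of_ne_nil hv))
      (unit_smul_mem _ _
        (shuffle_mem_shuffleSpan (counit_word_of_ne_nil hu) (counit_coder 𝒜 h1 _))))
  exact this hx

theorem killsShuffles_proj : KillsShuffles 𝒜 (proj R H) := by
  intro u v hu hv hu' hv'
  cases u with
  | nil => exact absurd rfl hu
  | cons a u =>
    cases v with
    | nil => exact absurd rfl hv
    | cons b v =>
      have h1 : counit R H (shuffle 𝒜 (word R u) (word R (b :: v))) = 0 := by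
        cases u with
        | nil => simp
        | cons c u =>
          exact counit_shuffle_cons 𝒜 (by simp) (isHomogeneousWord_cons.1 hu').2 hv'
      have h2 := counit_shuffle_cons 𝒜 hu hu' (isHomogeneousWord_cons.1 hv').2
      rw [shuffle_cons_cons 𝒜 hu' (isHomogeneousWord_cons.1 hv').1, map_add, map_unit_smul,
        proj_ι_mul, proj_ι_mul, h1, h2]
      simp

/-! #### The length filtration -/

variable (𝒜) in
/-- The span of the homogeneous words of length at most `n`. -/
def lengthLE (n : ℕ) : Submodule R (TensorAlgebra R H) :=
  Submodule.span R (word R '' {w | IsHomogeneousWord 𝒜 w ∧ w.length ≤ n})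

theorem word_mem_lengthLE {w : List (ℤ × H)} {n : ℕ} (hw : IsHomogeneousWord 𝒜 w)
    (hn : w.length ≤ n) : word R w ∈ lengthLE 𝒜 n :=
  Submodule.subset_span ⟨w, ⟨hw, hn⟩, rfl⟩

theorem lengthLE_mono {n k : ℕ} (h : n ≤ k) : lengthLE 𝒜 n ≤ lengthLE 𝒜 k :=
  Submodule.span_mono (Set.image_mono fun _ hw => ⟨hw.1, hw.2.trans h⟩)

theorem ι_mul_mem_lengthLE {i : ℤ} {a : H} (ha : a ∈ 𝒜 i) {n : ℕ} {x : TensorAlgebra R H}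
    (hx : x ∈ lengthLE 𝒜 n) : TensorAlgebra.ι R a * x ∈ lengthLE 𝒜 (n + 1) := by
  induction hx using Submodule.span_induction with
  | mem x hx =>
    obtain ⟨w, ⟨hw, hn⟩, rfl⟩ := hx
    rw [← word_cons (i, a)]
    exact word_mem_lengthLE (isHomogeneousWord_cons.2 ⟨ha, hw⟩) (by simpa using hn)
  | zero => simp
  | add x y _ _ hx hy => rw [mul_add]; exact add_mem hx hy
  | smul r x _ hx => rw [mul_smul_comm]; exact Submodule.smul_mem _ r hx

variable (𝒜) in
theorem exists_mem_lengthLE (x : TensorAlgebra R H) : ∃ n, x ∈ lengthLE 𝒜 n := by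
  have hx : x ∈ Submodule.span R (word R '' {w : List (ℤ × H) | IsHomogeneousWord 𝒜 w}) := by
    rw [span_word_eq_top 𝒜]; trivial
  induction hx using Submodule.span_induction with
  | mem x hx =>
    obtain ⟨w, hw, rfl⟩ := hx
    exact ⟨_, word_mem_lengthLE hw le_rfl⟩
  | zero => exact ⟨0, zero_mem _⟩
  | add x y _ _ hx hy =>
    obtain ⟨n, hn⟩ := hx
    obtain ⟨k, hk⟩ := hy
    exact ⟨max n k, add_mem (lengthLE_mono (le_max_left _ _) hn)
      (lengthLE_mono (le_max_right _ _) hk)⟩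
  | smul r x _ hx => exact hx.imp fun n hn => Submodule.smul_mem _ r hn

theorem mem_of_mem_lengthLE {f : TensorAlgebra R H →ₗ[R] M} {p : Submodule R M} {n : ℕ}
    (h : ∀ w, IsHomogeneousWord 𝒜 w → w.length ≤ n → f (word R w) ∈ p)
    {x : TensorAlgebra R H} (hx : x ∈ lengthLE 𝒜 n) : f x ∈ p := by
  have : lengthLE 𝒜 n ≤ p.comap f :=
    Submodule.span_le.2 (by rintro _ ⟨w, ⟨hw, hd⟩, rfl⟩; exact h w hw hd)
  exact this hx

section Cohom

variable {φ : TensorAlgebra R H →ₗ[R] H}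

theorem cohom_word_mem_lengthLE (h1 : φ 1 = 0) (hd : HasBarDegree 𝒜 φ 0) {w : List (ℤ × H)}
    (hw : IsHomogeneousWord 𝒜 w) : cohom φ (word R w) ∈ lengthLE 𝒜 w.length := by
  induction hn : w.length using Nat.strong_induction_on generalizing w with
  | _ n ih =>
    cases w with
    | nil =>
      rw [word_nil, cohom_one h1, ← word_nil]
      exact word_mem_lengthLE hw (by simp)
    | cons a w =>
      rw [cohom_cons h1]
      refine splitSum_mem _ fun u v huv => ?_
      have h2 : IsHomogeneousWord 𝒜 ((a :: u) ++ v) := by rw [List.cons_append, huv]; exact hw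
      rw [isHomogeneousWord_append] at h2
      have h3 : v.length + 1 ≤ n := by rw [← hn, ← huv]; simp
      exact lengthLE_mono h3 (ι_mul_mem_lengthLE (hd _ h2.1) (ih _ h3 h2.2 rfl))

/-- When all blocks are single letters the result is the word itself, as the linear part is the
identity; any longer block shortens the word. Thus `cohom φ` is unipotent for the length filtration.
-/
theorem cohom_word_sub_mem_lengthLE (h1 : φ 1 = 0) (hd : HasBarDegree 𝒜 φ 0)
    (hι : ∀ a, φ (TensorAlgebra.ι R a) = a) {w : List (ℤ × H)} (hw : IsHomogeneousWord 𝒜 w) :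
    cohom φ (word R w) - word R w ∈ lengthLE 𝒜 (w.length - 1) := by
  induction w with
  | nil => simp [cohom_one h1]
  | cons a w ih =>
    have hw' := isHomogeneousWord_cons.1 hw
    cases w with
    | nil => rw [cohom_cons h1]; simp [hι, cohom_one h1]
    | cons b w =>
      rw [cohom_cons h1, splitSum_cons, add_sub_right_comm, word_cons a (b :: w), word_cons a [],
        word_nil, mul_one, hι, ← mul_sub]
      refine add_mem (ι_mul_mem_lengthLE hw'.1 (ih hw'.2)) (splitSum_mem _ fun u v huv => ?_)
      have h2 : IsHomogeneousWord 𝒜 ((a :: b :: u) ++ v) := by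
        rw [List.cons_append, List.cons_append, huv]; exact hw
      rw [isHomogeneousWord_append] at h2
      refine lengthLE_mono ?_ (ι_mul_mem_lengthLE (hd _ h2.1) (cohom_word_mem_lengthLE h1 hd h2.2))
      rw [← huv]; simp

theorem cohom_sub_mem_lengthLE (h1 : φ 1 = 0) (hd : HasBarDegree 𝒜 φ 0)
    (hι : ∀ a, φ (TensorAlgebra.ι R a) = a) {n : ℕ} {x : TensorAlgebra R H}
    (hx : x ∈ lengthLE 𝒜 n) : cohom φ x - x ∈ lengthLE 𝒜 (n - 1) :=
  mem_of_mem_lengthLE (f := cohom φ - LinearMap.id) (fun _ hw hn =>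
    lengthLE_mono (Nat.sub_le_sub_right hn 1) (cohom_word_sub_mem_lengthLE h1 hd hι hw)) hx

theorem cohom_eq_self (h1 : φ 1 = 0) {x : TensorAlgebra R H} (hx : x ∈ lengthLE 𝒜 0) :
    cohom φ x = x := by
  rw [← sub_eq_zero]
  refine mem_of_mem_lengthLE (f := cohom φ - LinearMap.id) (p := ⊥) (fun w _ hn => ?_) hx
  rw [Nat.le_zero, List.length_eq_zero_iff] at hn
  subst hn
  simp [cohom_one h1]

/-- Unipotence lets one solve by induction on length: a preimage `y` of the shorter element `cohom φ
x - x` gives the preimage `x - y` of `x`. Staying inside a stable `p` shows that the inverse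
preserves it too. -/
theorem exists_cohom_eq (h1 : φ 1 = 0) (hd : HasBarDegree 𝒜 φ 0)
    (hι : ∀ a, φ (TensorAlgebra.ι R a) = a) {p : Submodule R (TensorAlgebra R H)}
    (hp : ∀ x ∈ p, cohom φ x ∈ p) {x : TensorAlgebra R H} (hx : x ∈ p) :
    ∃ y ∈ p, cohom φ y = x := by
  obtain ⟨n, hn⟩ := exists_mem_lengthLE 𝒜 x
  induction n generalizing x with
  | zero => exact ⟨x, hx, cohom_eq_self h1 hn⟩
  | succ n ih =>
    have h2 : cohom φ x - x ∈ p := sub_mem (hp x hx) hx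
    have h3 := cohom_sub_mem_lengthLE h1 hd hι hn
    rw [Nat.add_sub_cancel] at h3
    obtain ⟨y, hy, hyx⟩ := ih h2 h3
    exact ⟨x - y, sub_mem hx hy, by rw [map_sub, hyx, sub_sub_cancel]⟩

theorem cohom_bijective (h1 : φ 1 = 0) (hd : HasBarDegree 𝒜 φ 0)
    (hι : ∀ a, φ (TensorAlgebra.ι R a) = a) : Function.Bijective (cohom φ) := by
  constructor
  · refine (injective_iff_map_eq_zero _).2 fun x hx => ?_
    obtain ⟨n, hn⟩ := exists_mem_lengthLE 𝒜 x
    induction n with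
    | zero => exact (cohom_eq_self h1 hn).symm.trans hx
    | succ n ih =>
      have := cohom_sub_mem_lengthLE h1 hd hι hn
      rw [hx, zero_sub, neg_mem_iff] at this
      exact ih this
  · intro x
    obtain ⟨y, -, hy⟩ := exists_cohom_eq h1 hd hι (p := ⊤) (fun _ _ => trivial) (x := x) trivial
    exact ⟨y, hy⟩

/-- A coalgebra map with identity linear part is invertible; the inverse inherits the degree and
the vanishing on shuffles, and it intertwines the same coderivations. -/
theorem exists_inverse (h1 : φ 1 = 0) (hd : HasBarDegree 𝒜 φ 0)
    (hι : ∀ a, φ (TensorAlgebra.ι R a) = a) (hφ : KillsShuffles 𝒜 φ) :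
    ∃ ψ : TensorAlgebra R H →ₗ[R] H, ψ 1 = 0 ∧ HasBarDegree 𝒜 ψ 0 ∧ KillsShuffles 𝒜 ψ ∧
      ψ ∘ₗ cohom φ = proj R H ∧ φ ∘ₗ cohom ψ = proj R H ∧
      ∀ m m' : TensorAlgebra R H →ₗ[R] H, m 1 = 0 → m' 1 = 0 → defect 𝒜 m m' φ = 0 →
        ψ ∘ₗ coder 𝒜 m' = m ∘ₗ cohom ψ := by
  have hF := isCoalgHom_cohom h1
  set e := LinearEquiv.ofBijective (cohom φ) (cohom_bijective h1 hd hι) with he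
  have e1 : ∀ x, cohom φ (e.symm x) = x := fun x => e.apply_symm_apply x
  have e2 : ∀ x, e.symm (cohom φ x) = x := fun x => e.symm_apply_apply x
  -- This is used for the bar degrees and for the span of shuffles, giving degree and shuffle
  -- vanishing of the inverse.
  have hp : ∀ p : Submodule R (TensorAlgebra R H), (∀ x ∈ p, cohom φ x ∈ p) →
      ∀ x ∈ p, e.symm x ∈ p := by
    intro p hp x hx
    obtain ⟨y, hy, rfl⟩ := exists_cohom_eq h1 hd hι hp hx
    rwa [e2]
  have hG : IsCoalgHom (e.symm : TensorAlgebra R H →ₗ[R] TensorAlgebra R H) := by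
    refine ⟨?_, fun x => ?_, fun x => ?_⟩
    · conv_lhs => rw [← cohom_one h1]
      exact e2 1
    · rw [← hF.counit_map]; exact congrArg _ (e1 x)
    · obtain ⟨y, rfl⟩ := (cohom_bijective h1 hd hι).2 x
      rw [hF.decon_map, LinearEquiv.coe_coe, e2, ← LinearMap.comp_apply, ← TensorProduct.map_comp]
      have : (e.symm : TensorAlgebra R H →ₗ[R] TensorAlgebra R H) ∘ₗ cohom φ = LinearMap.id :=
        LinearMap.ext e2
      rw [this, TensorProduct.map_id, LinearMap.id_apply]
  have hG' := hG.eq_cohom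
  -- The inverse is a coalgebra map, so its projection to letters determines it through `eq_cohom`.
  refine ⟨proj R H ∘ₗ e.symm, by rw [LinearMap.comp_apply, hG.map_one, proj_one],
    fun w hw => ?_, ?_, ?_, ?_, fun m m' hm hm' hmm => ?_⟩
  · exact (hasBarDegree_proj 𝒜).apply_mem (hp _ (fun x hx => cohom_mem_barGrade h1 hd hx) _
      (word_mem_barGrade hw))
  · rw [killsShuffles_iff]
    intro x hx
    exact killsShuffles_iff.1 killsShuffles_proj _
      (hp _ (fun x hx => cohom_mem_shuffleSpan h1 hd hφ hx) x hx)
  · exact LinearMap.ext fun x => congrArg (proj R H) (e2 x)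
  · rw [← hG']
    exact LinearMap.ext fun x => (LinearMap.congr_fun (proj_cohom h1) (e.symm x)).symm.trans
      (congrArg (proj R H) (e1 x))
  · rw [← hG', ← proj_coder 𝒜 hm]
    refine LinearMap.ext fun x => congrArg (proj R H) ?_
    apply (cohom_bijective h1 hd hι).1
    have h3 := LinearMap.congr_fun hmm (e.symm x)
    rw [defect, LinearMap.sub_apply, LinearMap.zero_apply, sub_eq_zero, LinearMap.comp_apply,
      LinearMap.comp_apply, e1] at h3
    exact (e1 _).trans h3.symm

end Cohom

end Inverse

/-! ### Sequences of operations as linear maps on the tensor algebra -/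

section Bar

set_option linter.unusedSectionVars false

variable {R H M : Type*} [CommRing R] [AddCommGroup H] [Module R H] [AddCommGroup M] [Module R M]

/-- The linear map on the tensor algebra with components `f n`. -/
noncomputable def ofComponents (f : ∀ n : ℕ, MultilinearMap R (fun _ : Fin n => H) M) :
    TensorAlgebra R H →ₗ[R] M :=
  DirectSum.toModule R ℕ M (fun n => PiTensorProduct.lift (f n)) ∘ₗ
    TensorAlgebra.toDirectSum.toLinearMap

theorem ofComponents_tprod (f : ∀ n : ℕ, MultilinearMap R (fun _ : Fin n => H) M) {n : ℕ}
    (a : Fin n → H) : ofComponents f (TensorAlgebra.tprod R H n a) = f n a := by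
  rw [ofComponents, LinearMap.comp_apply, AlgHom.toLinearMap_apply,
    TensorAlgebra.toDirectSum_tensorPower_tprod, ← DirectSum.lof_eq_of R, DirectSum.toModule_lof,
    PiTensorProduct.lift.tprod]

theorem tprod_getD (w : List (ℤ × H)) :
    TensorAlgebra.tprod R H w.length (fun i => (w.getD i (0, 0)).2) = word R w := by
  rw [TensorAlgebra.tprod_apply, word]
  congr 1
  apply List.ext_getElem <;> simp

theorem ofComponents_word (f : ∀ n : ℕ, MultilinearMap R (fun _ : Fin n => H) M)
    (w : List (ℤ × H)) :
    ofComponents f (word R w) = f w.length fun i => (w.getD i (0, 0)).2 := by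
  rw [← tprod_getD, ofComponents_tprod]

variable (𝒜 : ℤ → Submodule R H) [DirectSum.Decomposition 𝒜]

/-- The recursion step for `suspSign`; the components are the even and odd lengths. -/
noncomputable def suspStep :
    H →ₗ[R] Module.End R (TensorAlgebra R H × TensorAlgebra R H) :=
  LinearMap.mk₂ R (fun a p => (TensorAlgebra.ι R (gradedScale 𝒜 (fun i => (i.negOnePow : ℤ)) a) * p.2,
      TensorAlgebra.ι R a * p.1))
    (fun a b p => by ext <;> simp [add_mul])
    (fun r a p => by ext <;> simp)
    (fun a p q => by ext <;> simp [mul_add])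
    (fun r a p => by ext <;> simp)

/-- The Koszul sign of moving the suspensions out of a word. -/
noncomputable def suspSign : TensorAlgebra R H →ₗ[R] TensorAlgebra R H :=
  (LinearMap.fst R _ _ + LinearMap.snd R _ _) ∘ₗ fold (suspStep 𝒜) (1, 0)

theorem suspSign_word {w : List (ℤ × H)} (hw : IsHomogeneousWord 𝒜 w) :
    suspSign 𝒜 (word R w) = (suspExp w).negOnePow • word R w := by
  have h : fold (suspStep 𝒜) (1, 0) (word R w) =
      if Even w.length then ((suspExp w).negOnePow • word R w, 0)
      else (0, (suspExp w).negOnePow • word R w) := by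
    induction w with
    | nil => simp [suspExp]
    | cons a w ih =>
      have hw' := isHomogeneousWord_cons.1 hw
      rw [word_cons, fold_ι_mul, ih hw'.2, List.length_cons, suspExp, Int.negOnePow_add]
      by_cases hl : Even w.length
      · have : Even ((w.length : ℤ) * a.1) := ((Int.even_coe_nat _).2 hl).mul_right _
        rw [if_pos hl, if_neg (by rw [Nat.even_add_one]; exact not_not_intro hl),
          Int.negOnePow_even _ this, one_mul]
        simp [suspStep, mul_unit_smul]
      · have : ((w.length : ℤ) * a.1).negOnePow = a.1.negOnePow := by
          rw [Int.negOnePow_eq_iff, ← sub_one_mul]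
          exact (Int.even_sub_one.2 (by rwa [Int.even_coe_nat])).mul_right _
        rw [if_neg hl, if_pos (by rw [Nat.even_add_one]; exact hl), this]
        simp [suspStep, mul_unit_smul, gradedScale_apply 𝒜 _ hw'.1, mul_smul, unit_smul_mul,
          ← Units.smul_def]
        rw [smul_comm]
  rw [suspSign, LinearMap.comp_apply, h]
  split_ifs <;> simp

/-- A sequence of operations as one linear map on the tensor algebra, signs of the bar
construction included. -/
noncomputable def bar (f : ∀ n : ℕ, MultilinearMap R (fun _ : Fin n => H) M) :
    TensorAlgebra R H →ₗ[R] M := ofComponents f ∘ₗ suspSign 𝒜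

/-- The sequence of operations given by a linear map on the tensor algebra. -/
noncomputable def unbar (φ : TensorAlgebra R H →ₗ[R] M) (n : ℕ) :
    MultilinearMap R (fun _ : Fin n => H) M :=
  (φ ∘ₗ suspSign 𝒜).compMultilinearMap (TensorAlgebra.tprod R H n)

theorem bar_word (f : ∀ n : ℕ, MultilinearMap R (fun _ : Fin n => H) M) {w : List (ℤ × H)}
    (hw : IsHomogeneousWord 𝒜 w) {n : ℕ} (hn : w.length = n) :
    bar 𝒜 f (word R w) = barEval (f n) w := by
  subst hn
  rw [bar, LinearMap.comp_apply, suspSign_word 𝒜 hw, map_unit_smul, ofComponents_word, barEval]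

theorem barEval_unbar (φ : TensorAlgebra R H →ₗ[R] M) {w : List (ℤ × H)}
    (hw : IsHomogeneousWord 𝒜 w) {n : ℕ} (hn : w.length = n) :
    barEval (unbar 𝒜 φ n) w = φ (word R w) := by
  subst hn
  rw [barEval, unbar, LinearMap.compMultilinearMap_apply, tprod_getD, LinearMap.comp_apply,
    suspSign_word 𝒜 hw, map_unit_smul, smul_smul, ← Int.negOnePow_add,
    Int.negOnePow_even _ ⟨_, rfl⟩, one_smul]

theorem bar_unbar (φ : TensorAlgebra R H →ₗ[R] M) : bar 𝒜 (unbar 𝒜 φ) = φ :=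
  linearMap_ext_word 𝒜 fun w hw => by rw [bar_word 𝒜 _ hw rfl, barEval_unbar 𝒜 φ hw rfl]

variable {𝒜}

theorem isHomogeneousWord_ofFn {n : ℕ} {d : Fin n → ℤ} {a : Fin n → H} (h : ∀ i, a i ∈ 𝒜 (d i)) :
    IsHomogeneousWord 𝒜 (List.ofFn fun i => (d i, a i)) := by
  intro x hx
  obtain ⟨i, rfl⟩ := (List.mem_ofFn' _ _).1 hx
  exact h i

theorem barEval_ofFn {n : ℕ} (f : MultilinearMap R (fun _ : Fin n => H) M) (d : Fin n → ℤ)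
    (a : Fin n → H) : barEval f (List.ofFn fun i => (d i, a i)) =
      (suspExp (List.ofFn fun i => (d i, a i))).negOnePow • f a := by
  rw [barEval]
  congr 2
  ext i
  simp

theorem wordDeg_ofFn {n : ℕ} (d : Fin n → ℤ) (a : Fin n → H) :
    wordDeg (List.ofFn fun i => (d i, a i)) = ∑ i, d i := by
  rw [wordDeg, List.map_ofFn, List.sum_ofFn]
  rfl

theorem barDeg_eq (w : List (ℤ × H)) : barDeg w = wordDeg w - w.length := by
  induction w with
  | nil => rfl
  | cons a w ih => rw [barDeg_cons, ih]; simp [wordDeg]; ring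

theorem hasDegree_iff {n : ℕ} {f : MultilinearMap R (fun _ : Fin n => H) H} {k : ℤ} :
    HasDegree 𝒜 𝒜 f k ↔ ∀ w, w.length = n → IsHomogeneousWord 𝒜 w →
      barEval f w ∈ 𝒜 (barDeg w + n + k) := by
  constructor
  · rintro h w rfl hw
    have := h (fun i => (w.getD i (0, 0)).1) (fun i => (w.getD i (0, 0)).2) fun i => by
      rw [List.getD_eq_getElem _ _ i.2]; exact hw _ (List.getElem_mem _)
    rw [barDeg_eq, sub_add_cancel, barEval]
    have h2 : ∑ i : Fin w.length, (w.getD i (0, 0)).1 = wordDeg w := by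
      rw [wordDeg, ← List.sum_ofFn]
      congr 1
      apply List.ext_getElem <;> simp
    rw [h2] at this
    exact unit_smul_mem _ _ this
  · intro h d a ha
    have := h _ (List.length_ofFn) (isHomogeneousWord_ofFn ha)
    rw [barDeg_eq, List.length_ofFn, sub_add_cancel, wordDeg_ofFn, barEval_ofFn] at this
    have h3 := unit_smul_mem (𝒜 _) (suspExp (List.ofFn fun i => (d i, a i))).negOnePow this
    rwa [smul_smul, ← Int.negOnePow_add, Int.negOnePow_even _ ⟨_, rfl⟩, one_smul] at h3

theorem hasBarDegree_bar {f : ∀ n : ℕ, MultilinearMap R (fun _ : Fin n => H) H} {e : ℤ}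
    (h : ∀ n : ℕ, HasDegree 𝒜 𝒜 (f n) (e + 1 - n)) : HasBarDegree 𝒜 (bar 𝒜 f) e := by
  intro w hw
  have := hasDegree_iff.1 (h w.length) w rfl hw
  rw [bar_word 𝒜 f hw rfl]
  convert this using 2
  ring

theorem hasDegree_unbar {φ : TensorAlgebra R H →ₗ[R] H} {e : ℤ} (h : HasBarDegree 𝒜 φ e) (n : ℕ) :
    HasDegree 𝒜 𝒜 (unbar 𝒜 φ n) (e + 1 - n) := by
  refine hasDegree_iff.2 fun w hn hw => ?_
  rw [barEval_unbar 𝒜 φ hw hn]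
  convert h w hw using 2
  ring

theorem mem_shuffles {u v : List (ℤ × H)} {s : ℤˣ × List (ℤ × H)} (hs : s ∈ shuffles u v) :
    s.2.length = u.length + v.length ∧ ∀ x ∈ s.2, x ∈ u ∨ x ∈ v := by
  induction u generalizing v s with
  | nil => simp only [shuffles, List.mem_singleton] at hs; subst hs; simp
  | cons a u ihu =>
    induction v generalizing s with
    | nil => simp only [shuffles, List.mem_singleton] at hs; subst hs; simp
    | cons b v ihv =>
      simp only [shuffles, List.mem_append, List.mem_map] at hs
      obtain ⟨t, ht, rfl⟩ | ⟨t, ht, rfl⟩ := hs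
      · obtain ⟨h1, h2⟩ := ihu ht
        refine ⟨by simp [h1]; omega, fun x hx => ?_⟩
        obtain rfl | hx := List.mem_cons.1 hx
        · simp
        · exact (h2 x hx).imp_left (List.mem_cons_of_mem _)
      · obtain ⟨h1, h2⟩ := ihv ht
        refine ⟨by simp [h1]; omega, fun x hx => ?_⟩
        obtain rfl | hx := List.mem_cons.1 hx
        · simp
        · exact (h2 x hx).imp_right (List.mem_cons_of_mem _)

theorem isHomogeneousWord_of_mem_shuffles {u v : List (ℤ × H)} (hu : IsHomogeneousWord 𝒜 u)
    (hv : IsHomogeneousWord 𝒜 v) {s : ℤˣ × List (ℤ × H)} (hs : s ∈ shuffles u v) :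
    IsHomogeneousWord 𝒜 s.2 :=
  fun x hx => ((mem_shuffles hs).2 x hx).elim (hu x) (hv x)

theorem map_shuffle_word (φ : TensorAlgebra R H →ₗ[R] M) {u v : List (ℤ × H)}
    (hu : IsHomogeneousWord 𝒜 u) (hv : IsHomogeneousWord 𝒜 v) :
    φ (shuffle 𝒜 (word R u) (word R v)) =
      ((shuffles u v).map fun s => s.1 • φ (word R s.2)).sum := by
  rw [shuffle_word 𝒜 hu hv, map_list_sum, List.map_map]
  simp only [Function.comp_def, map_unit_smul]

theorem killsShuffles_bar {f : ∀ n : ℕ, MultilinearMap R (fun _ : Fin n => H) M}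
    (h : ∀ n : ℕ, VanishesOnShuffles 𝒜 (f n)) : KillsShuffles 𝒜 (bar 𝒜 f) := by
  intro u v hu hv hu' hv'
  rw [map_shuffle_word _ hu' hv', ← h _ u v hu hv rfl hu' hv']
  congr 1
  refine List.map_congr_left fun s hs => ?_
  rw [bar_word 𝒜 f (isHomogeneousWord_of_mem_shuffles hu' hv' hs) (mem_shuffles hs).1]

theorem vanishesOnShuffles_unbar {φ : TensorAlgebra R H →ₗ[R] M} (h : KillsShuffles 𝒜 φ) (n : ℕ) :
    VanishesOnShuffles 𝒜 (unbar 𝒜 φ n) := by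
  rintro u v hu hv rfl hu' hv'
  rw [← h u v hu hv hu' hv', map_shuffle_word _ hu' hv']
  congr 1
  refine List.map_congr_left fun s hs => ?_
  rw [barEval_unbar 𝒜 φ (isHomogeneousWord_of_mem_shuffles hu' hv' hs) (mem_shuffles hs).1]

theorem bar_one {f : ∀ n : ℕ, MultilinearMap R (fun _ : Fin n => H) M} (h : f 0 = 0) :
    bar 𝒜 f 1 = 0 := by
  have := bar_word 𝒜 f (isHomogeneousWord_nil 𝒜) rfl
  rw [word_nil] at this
  rw [this, barEval]
  simp [h]

theorem unbar_zero {φ : TensorAlgebra R H →ₗ[R] M} (h : φ 1 = 0) : unbar 𝒜 φ 0 = 0 := by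
  ext a
  have h2 := suspSign_word 𝒜 (isHomogeneousWord_nil 𝒜)
  rw [word_nil] at h2
  simp [unbar, TensorAlgebra.tprod_apply, h2, h]

/-! #### The sums in the structure equations -/

theorem barLetter_eq (f : ∀ n : ℕ, MultilinearMap R (fun _ : Fin n => H) H) (e : ℤ)
    {w : List (ℤ × H)} (hw : IsHomogeneousWord 𝒜 w) :
    barLetter f e w = (barDeg w + e, bar 𝒜 f (word R w)) := by
  rw [barLetter, bar_word 𝒜 f hw rfl, barDeg_eq]
  congr 1
  ring

/-- A composition of `n + 1` is a first block of size `i + 1` followed by a composition of `n - i`.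
Letting `G` depend on the block list alone avoids transport between composition types. -/
theorem sum_composition_succ {N : Type*} [AddCommMonoid N] (n : ℕ) (G : List ℕ → N) :
    ∑ c : Composition (n + 1), G c.blocks =
      ∑ i ∈ Finset.range (n + 1), ∑ c : Composition (n - i), G ((i + 1) :: c.blocks) := by
  rw [Finset.sum_sigma']
  symm
  refine Finset.sum_bij' (fun p hp => ⟨(p.1 + 1) :: p.2.blocks, ?_, ?_⟩)
    (fun c _ => ⟨c.blocks.headI - 1, ⟨c.blocks.tail, ?_, ?_⟩⟩) ?_ ?_ ?_ ?_ ?_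
  · intro i hi
    obtain rfl | hi := List.mem_cons.1 hi
    · omega
    · exact p.2.blocks_pos hi
  · simp only [Finset.mem_sigma, Finset.mem_range] at hp
    rw [List.sum_cons, p.2.blocks_sum]; omega
  · exact fun hi => c.blocks_pos (List.mem_of_mem_tail hi)
  · have h1 := c.blocks_sum
    have h2 : c.blocks ≠ [] := by rw [Ne, Composition.blocks_eq_nil]; omega
    obtain ⟨a, l, hl⟩ := List.exists_cons_of_ne_nil h2
    have h3 := c.blocks_pos (i := a) (by simp [hl])
    rw [hl] at h1 ⊢
    simp at h1 ⊢; omega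
  · intro p hp; simp
  · intro c _
    have h1 := c.blocks_sum
    have h2 : c.blocks ≠ [] := by rw [Ne, Composition.blocks_eq_nil]; omega
    obtain ⟨a, l, hl⟩ := List.exists_cons_of_ne_nil h2
    have h3 := c.blocks_pos (i := a) (by simp [hl])
    rw [hl] at h1
    simp [hl] at h1 ⊢; omega
  · rintro ⟨i, c⟩ hp
    simp
  · intro c _
    have h1 := c.blocks_sum
    have h2 : c.blocks ≠ [] := by rw [Ne, Composition.blocks_eq_nil]; omega
    obtain ⟨a, l, hl⟩ := List.exists_cons_of_ne_nil h2
    have h3 := c.blocks_pos (i := a) (by simp [hl])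
    ext1
    simp [hl]; omega
  · intro p hp; rfl

theorem cohom_eq_sum {f : ∀ n : ℕ, MultilinearMap R (fun _ : Fin n => H) H} (h0 : f 0 = 0)
    {w : List (ℤ × H)} (hw : IsHomogeneousWord 𝒜 w) : cohom (bar 𝒜 f) (word R w) =
      ∑ c : Composition w.length, word R ((w.splitWrtComposition c).map (barLetter f 1)) := by
  -- The composed number is separated from the length of the word, and the splitting is expressed by
  -- the block list, so that the recursion on the first block typechecks.
  suffices h : ∀ n (w : List (ℤ × H)), w.length = n → IsHomogeneousWord 𝒜 w →
      cohom (bar 𝒜 f) (word R w) = ∑ c : Composition n,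
        word R ((w.splitWrtCompositionAux c.blocks).map (barLetter f 1)) from h _ w rfl hw
  clear hw w
  intro n
  induction n using Nat.strong_induction_on with
  | _ n ih =>
    intro w hn hw
    cases w with
    | nil =>
      subst hn
      have h1 : ∀ c : Composition ([] : List (ℤ × H)).length, c.blocks = [] := fun c =>
        c.blocks_eq_nil.2 rfl
      simp [h1, composition_card, List.splitWrtCompositionAux, cohom_one (bar_one (𝒜 := 𝒜) h0)]
    | cons a w =>
      rw [List.length_cons] at hn
      subst hn
      rw [sum_composition_succ w.length fun bl =>
        word R (((a :: w).splitWrtCompositionAux bl).map (barLetter f 1)),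
        cohom_cons (bar_one h0), splitSum_eq_range]
      refine Finset.sum_congr rfl fun i hi => ?_
      have hi' := Finset.mem_range.1 hi
      rw [ih (w.length - i) (by omega) _ (by simp)
        fun x hx => hw x (List.mem_cons_of_mem _ (List.mem_of_mem_drop hx)), Finset.mul_sum]
      refine Finset.sum_congr rfl fun c _ => ?_
      have hl := barLetter_eq (𝒜 := 𝒜) f 1 (w := (a :: w).take (i + 1))
        fun x hx => hw x (List.mem_of_mem_take hx)
      rw [List.splitWrtCompositionAux_cons, List.map_cons, hl, word_cons, List.take_succ_cons,
        List.drop_succ_cons]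
      simp only [word_cons]

theorem sum_composition_eq {f : ∀ n : ℕ, MultilinearMap R (fun _ : Fin n => H) H} (h0 : f 0 = 0)
    (hd : ∀ n : ℕ, HasDegree 𝒜 𝒜 (f n) (1 - n))
    (g : ∀ n : ℕ, MultilinearMap R (fun _ : Fin n => H) M)
    {w : List (ℤ × H)} (hw : IsHomogeneousWord 𝒜 w) :
    ∑ c : Composition w.length,
        barEval (g c.length) ((w.splitWrtComposition c).map (barLetter f 1)) =
      bar 𝒜 g (cohom (bar 𝒜 f) (word R w)) := by
  rw [cohom_eq_sum h0 hw, map_sum]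
  refine Finset.sum_congr rfl fun c _ => (bar_word 𝒜 g ?_ (by simp)).symm
  intro x hx
  obtain ⟨u, hu, rfl⟩ := List.mem_map.1 hx
  have hu' : IsHomogeneousWord 𝒜 u := fun y hy => hw y (by
    rw [← List.flatten_splitWrtComposition w c]
    exact List.mem_flatten.2 ⟨u, hu, hy⟩)
  rw [barLetter_eq f 1 hu']
  have := hasBarDegree_bar (e := 0) (by simpa using hd) u hu'
  simpa using this

/-- Identifies the sum in the `A_∞`-relations and the left side of the morphism equations with the
coderivation. -/
theorem sum_insertion_eq {m : ∀ n : ℕ, MultilinearMap R (fun _ : Fin n => H) H} (h0 : m 0 = 0)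
    (hd : ∀ n : ℕ, HasDegree 𝒜 𝒜 (m n) (2 - n))
    (f : ∀ n : ℕ, MultilinearMap R (fun _ : Fin n => H) M)
    {w : List (ℤ × H)} (hw : IsHomogeneousWord 𝒜 w) :
    ∑ k ∈ Finset.range w.length, ∑ j ∈ Finset.Icc 1 (w.length - k),
      (barDeg (w.take k)).negOnePow •
        barEval (f (w.length - j + 1))
          (w.take k ++ [barLetter m 2 ((w.drop k).take j)] ++ w.drop (k + j)) =
      bar 𝒜 f (coder 𝒜 (bar 𝒜 m) (word R w)) := by
  have ht : ∀ k, IsHomogeneousWord 𝒜 (w.take k) := fun k x hx => hw x (List.mem_of_mem_take hx)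
  have hdr : ∀ k, IsHomogeneousWord 𝒜 (w.drop k) := fun k x hx => hw x (List.mem_of_mem_drop hx)
  have hm1 : bar 𝒜 m 1 = 0 := bar_one h0
  rw [coder, conv_word, splitSum_eq_range, Finset.sum_range_succ]
  -- The sum over splittings also contains `k = w.length` and, below, `j = 0`. Both feed the empty
  -- word to `m` and contribute zero.
  have hlast : headOp (bar 𝒜 m) (word R (w.drop w.length)) = 0 := by
    rw [List.drop_length, headOp_word]; simp [hm1]
  rw [hlast, map_zero, add_zero, map_sum]
  refine Finset.sum_congr rfl fun k hk => ?_
  have hk' := Finset.mem_range.1 hk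
  rw [headOp_word, splitSum_eq_range, map_sum, map_sum, List.length_drop]
  refine (Finset.sum_congr rfl fun j hj => ?_).trans
    (Finset.sum_subset (s₁ := Finset.Icc 1 (w.length - k)) (fun j hj => ?_) fun j hj hj' => ?_)
  · rw [Finset.mem_Icc] at hj
    have hl := barLetter_eq m 2 (w := (w.drop k).take j)
      fun x hx => hdr k x (List.mem_of_mem_take hx)
    have hhom : IsHomogeneousWord 𝒜
        (w.take k ++ [barLetter m 2 ((w.drop k).take j)] ++ w.drop (k + j)) := by
      rw [isHomogeneousWord_append, isHomogeneousWord_append]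
      refine ⟨⟨ht k, ?_⟩, hdr _⟩
      rw [isHomogeneousWord_cons, hl]
      refine ⟨?_, isHomogeneousWord_nil 𝒜⟩
      have := hasBarDegree_bar (e := 1) (by simpa [one_add_one_eq_two] using hd)
        ((w.drop k).take j) fun x hx => hdr k x (List.mem_of_mem_take hx)
      simpa [add_assoc, one_add_one_eq_two] using this
    rw [← bar_word 𝒜 f hhom (by simp; omega), word_append, word_append, hl, word_cons, word_nil,
      mul_one, barSignT_word 𝒜 (ht k), LinearMap.mul_apply', unit_smul_mul, map_unit_smul,
      List.drop_drop, mul_assoc]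
  · rw [Finset.mem_Icc] at hj; rw [Finset.mem_range]; omega
  · have : j = 0 := by
      rw [Finset.mem_range] at hj; rw [Finset.mem_Icc] at hj'; omega
    subst this
    simp [hm1]

end Bar

/-! ### The Hochschild differential in terms of the bar construction -/

section Hochschild

set_option linter.unusedSectionVars false

variable {R H : Type*} [CommRing R] [NonUnitalRing H] [Module R H]
  [IsScalarTower R H H] [SMulCommClass R H H]
  (𝒜 : ℤ → Submodule R H) [DirectSum.Decomposition 𝒜]

/-- The product with the sign of the bar construction: `(a, b) ↦ (-1)^{|a|} a b`. -/
noncomputable def barMul : H →ₗ[R] H →ₗ[R] H :=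
  LinearMap.mul R H ∘ₗ gradedScale 𝒜 fun i => (i.negOnePow : ℤ)

theorem barMul_apply {i : ℤ} {a : H} (ha : a ∈ 𝒜 i) (b : H) :
    barMul 𝒜 a b = i.negOnePow • (a * b) := by
  rw [barMul, LinearMap.comp_apply, gradedScale_apply 𝒜 _ ha, ← Units.smul_def, map_unit_smul,
    Units.smul_def, LinearMap.smul_apply, LinearMap.mul_apply', Units.smul_def]

/-- The structure map of the bar construction of an algebra. -/
noncomputable def barProduct : TensorAlgebra R H →ₗ[R] H :=
  conv (barMul 𝒜) (proj R H) (proj R H)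

theorem barProduct_pair (a b : ℤ × H) : barProduct 𝒜 (word R [a, b]) = barMul 𝒜 a.2 b.2 := by
  rw [barProduct, conv_word]
  simp only [splitSum_cons, splitSum_nil, proj_word]
  simp

theorem barProduct_eq_zero {w : List (ℤ × H)} (hw : w.length ≠ 2) :
    barProduct 𝒜 (word R w) = 0 := by
  rw [barProduct, conv_word]
  refine splitSum_zero fun u v huv => ?_
  rw [proj_word, proj_word]
  by_cases hu : u.length = 1
  · have hv : v.length ≠ 1 := by
      rintro hv; apply hw; rw [← huv]; simp [hu, hv]
    simp [hv]
  · simp [hu]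

theorem barProduct_one : barProduct 𝒜 (1 : TensorAlgebra R H) = 0 :=
  barProduct_eq_zero 𝒜 (w := []) (by simp)

theorem headOp_barProduct_cons_cons (a b : ℤ × H) (v : List (ℤ × H)) :
    headOp (barProduct 𝒜) (word R (a :: b :: v)) =
      TensorAlgebra.ι R (barMul 𝒜 a.2 b.2) * word R v := by
  rw [headOp_word, splitSum_cons, splitSum_cons, word_nil, barProduct_one, map_zero, zero_mul,
    zero_add, barProduct_eq_zero 𝒜 (by simp), map_zero, zero_mul, zero_add]
  cases v with
  | nil => rw [splitSum_nil, barProduct_pair]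
  | cons c v =>
    rw [splitSum_cons, barProduct_pair, splitSum_zero, add_zero]
    intro u v _
    rw [barProduct_eq_zero 𝒜 (by simp), map_zero, zero_mul]

theorem headOp_barProduct_eq_zero {w : List (ℤ × H)} (hw : w.length ≤ 1) :
    headOp (barProduct 𝒜) (word R w) = 0 := by
  rw [headOp_word]
  refine splitSum_zero fun u v huv => ?_
  rw [barProduct_eq_zero 𝒜, map_zero, zero_mul]
  have := congrArg List.length huv
  rw [List.length_append] at this
  omega

theorem suspExp_append (u v : List (ℤ × H)) :
    suspExp (u ++ v) = suspExp u + v.length * wordDeg u + suspExp v := by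
  induction u with
  | nil => simp [suspExp, wordDeg]
  | cons a u ih =>
    rw [List.cons_append, suspExp, ih, suspExp]
    simp only [wordDeg, List.map_cons, List.sum_cons, List.length_append]
    push_cast
    ring

theorem contractNth_append (u : List (ℤ × H)) (a b : ℤ × H) (v : List (ℤ × H)) {n : ℕ} (j : Fin n)
    (hj : (j : ℕ) = u.length) (d : ℤ) :
    (j.castSucc.contractNth (· * ·) fun i : Fin (n + 1) => ((u ++ a :: b :: v).getD i (0, 0)).2) =
      fun i : Fin n => ((u ++ (d, a.2 * b.2) :: v).getD i (0, 0)).2 := by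
  ext i
  simp only [Fin.contractNth, Fin.val_castSucc, hj, List.getD_eq_getElem?_getD, Fin.val_succ]
  rcases lt_trichotomy (i : ℕ) u.length with h | h | h
  · rw [if_pos h, List.getElem?_append_left h, List.getElem?_append_left h]
  · rw [if_neg (by omega), if_pos h, h]
    simp
  · rw [if_neg (by omega), if_neg (by omega), List.getElem?_append_right (by omega),
      List.getElem?_append_right (by omega)]
    obtain ⟨k, hk⟩ : ∃ k, (i : ℕ) = u.length + 1 + k := ⟨i - (u.length + 1), by omega⟩
    rw [hk, show u.length + 1 + k + 1 - u.length = k + 2 by omega,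
      show u.length + 1 + k - u.length = k + 1 by omega]
    simp

/-- Inserting the signed product at position `j` is the `j`-th contraction of the Hochschild
differential; what is to be checked is that all terms carry the same relative sign. -/
theorem sum_contract_eq {n : ℕ} (c : MultilinearMap R (fun _ : Fin n => H) H)
    {φ : TensorAlgebra R H →ₗ[R] H}
    (hφ : ∀ v, IsHomogeneousWord 𝒜 v → v.length = n → φ (word R v) = barEval c v)
    [SetLike.GradedMul 𝒜] {w : List (ℤ × H)} (hw : IsHomogeneousWord 𝒜 w) (hn : w.length = n + 1) :
    φ (coder 𝒜 (barProduct 𝒜) (word R w)) = -((suspExp w).negOnePow •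
      ∑ j : Fin n, (-1 : ℤ) ^ (j.val + 1) •
        c (j.castSucc.contractNth (· * ·) fun i : Fin (n + 1) => (w.getD i (0, 0)).2)) := by
  rw [coder, conv_word, splitSum_eq_range, hn, Finset.sum_range_succ, Finset.sum_range_succ,
    headOp_barProduct_eq_zero 𝒜 (by simp [hn]), headOp_barProduct_eq_zero 𝒜 (by simp [hn]),
    map_zero, map_zero, add_zero, add_zero, map_sum, Finset.sum_range, ← smul_neg,
    ← Finset.sum_neg_distrib, Finset.smul_sum]
  refine Finset.sum_congr rfl fun j _ => ?_
  obtain ⟨a, b, v, hv⟩ : ∃ a b v, w.drop j = a :: b :: v := by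
    have : 2 ≤ (w.drop j).length := by rw [List.length_drop]; omega
    match h : w.drop j, this with
    | a :: b :: v, _ => exact ⟨a, b, v, rfl⟩
  have hu : (w.take j).length = j := by rw [List.length_take]; omega
  have hw' : w.take j ++ a :: b :: v = w := by rw [← hv, List.take_append_drop]
  generalize w.take j = u at hu hw'
  rw [hv]
  subst hw'
  have hh := isHomogeneousWord_append.1 hw
  have hh' := isHomogeneousWord_cons.1 hh.2
  have hh'' := isHomogeneousWord_cons.1 hh'.2
  have hm : IsHomogeneousWord 𝒜 (u ++ (a.1 + b.1, a.2 * b.2) :: v) :=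
    isHomogeneousWord_append.2 ⟨hh.1, isHomogeneousWord_cons.2
      ⟨SetLike.mul_mem_graded hh'.1 hh''.1, hh''.2⟩⟩
  have hl : (u ++ (a.1 + b.1, a.2 * b.2) :: v).length = n := by
    simp only [List.length_append, List.length_cons] at hn ⊢; omega
  rw [headOp_barProduct_cons_cons, LinearMap.mul_apply', barSignT_word 𝒜 hh.1,
    barMul_apply 𝒜 hh'.1, map_unit_smul, unit_smul_mul, unit_smul_mul, mul_unit_smul,
    ← word_cons (a.1 + b.1, a.2 * b.2), ← word_append, map_unit_smul, map_unit_smul, hφ _ hm hl,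
    barEval, contractNth_append u a b v j hu.symm (a.1 + b.1), smul_smul, smul_smul,
    ← Int.negOnePow_add, ← Int.negOnePow_add, ← neg_smul, pow_succ, mul_neg_one, neg_neg,
    ← Int.coe_negOnePow_natCast, ← Units.smul_def, smul_smul, ← Int.negOnePow_add]
  congr 1
  rw [Int.negOnePow_eq_iff, suspExp_append, suspExp_append, suspExp, suspExp, suspExp, barDeg_eq,
    hu]
  simp only [List.length_cons]
  -- The two exponents differ by `-2j`.
  refine ⟨-(j : ℤ), ?_⟩
  push_cast
  ring

/-- Here `s` is the bar degree of the cochain. After suspension the two outer Hochschild terms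
become signed products with the first and last letters, and the inner terms become composition with
the coderivation of the product. The obstruction has `s = 1`, the correcting cochain `s = 0`. -/
theorem barEval_hochschildD [SetLike.GradedMul 𝒜] {n : ℕ} {k s : ℤ} (hk : k = s + 1 - n)
    {c : MultilinearMap R (fun _ : Fin n => H) H} (hc : HasDegree 𝒜 𝒜 c k)
    {φ : TensorAlgebra R H →ₗ[R] H}
    (hφ : ∀ v, IsHomogeneousWord 𝒜 v → v.length = n → φ (word R v) = barEval c v)
    {w : List (ℤ × H)} (hw : IsHomogeneousWord 𝒜 w) {a z : ℤ × H} {t u : List (ℤ × H)}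
    (ht : w = a :: t) (hu : w = u ++ [z]) (hn : t.length = n) :
    barEval (hochschildD 𝒜 n k c) w =
      (s * a.1).negOnePow • barMul 𝒜 a.2 (φ (word R t)) +
        s.negOnePow • barMul 𝒜 (φ (word R u)) z.2 - φ (coder 𝒜 (barProduct 𝒜) (word R w)) := by
  have hl : w.length = n + 1 := by rw [ht, List.length_cons, hn]
  have hul : u.length = n := by
    have := congrArg List.length hu
    rw [hl, List.length_append, List.length_singleton] at this; omega
  have ht' : a.2 ∈ 𝒜 a.1 ∧ IsHomogeneousWord 𝒜 t := by rwa [ht, isHomogeneousWord_cons] at hw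
  have hu' : IsHomogeneousWord 𝒜 u := by
    rw [hu, isHomogeneousWord_append] at hw; exact hw.1
  rw [sum_contract_eq 𝒜 c hφ hw hl, barEval, hochschildD_apply, sub_neg_eq_add, smul_add, smul_add,
    add_right_comm]
  congr 1
  congr 1
  · have e1 : (fun i : Fin n => (w.getD (i.succ : Fin (n + 1)) (0, 0)).2) =
        fun i : Fin n => (t.getD i (0, 0)).2 := by
      ext i; simp [ht]
    have e2 : (w.getD ((0 : Fin (n + 1)) : ℕ) (0, 0)).2 = a.2 := by simp [ht]
    rw [e1, e2, hφ t ht'.2 hn, barMul_apply 𝒜 ht'.1, barEval, koszulTwist_apply 𝒜 k ht'.1,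
      unit_smul_mul, mul_unit_smul, smul_smul, smul_smul, smul_smul, ← Int.negOnePow_add,
      ← Int.negOnePow_add, ← Int.negOnePow_add]
    congr 1
    rw [Int.negOnePow_eq_iff, ht, suspExp, hn, hk]
    ring_nf
    simp
  · have e1 : (fun i : Fin n => (w.getD (i.castSucc : Fin (n + 1)) (0, 0)).2) =
        fun i : Fin n => (u.getD i (0, 0)).2 := by
      ext i
      simp only [hu, List.getD_eq_getElem?_getD, Fin.val_castSucc]
      rw [List.getElem?_append_left (by omega)]
    have e2 : (w.getD (Fin.last n : Fin (n + 1)) (0, 0)).2 = z.2 := by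
      simp [hu, hul]
    have hcu := hasDegree_iff.1 hc u hul hu'
    rw [e1, e2, hφ u hu' hul, barMul_apply 𝒜 hcu, barEval,
      unit_smul_mul, ← Int.coe_negOnePow_natCast, ← Units.smul_def, smul_smul, smul_smul, smul_smul,
      ← Int.negOnePow_add, ← Int.negOnePow_add, ← Int.negOnePow_add]
    congr 1
    rw [Int.negOnePow_eq_iff, hu, suspExp_append, barDeg_eq, hul, hk]
    simp only [suspExp, List.length_singleton, List.length_nil]
    push_cast
    ring_nf
    exact ⟨n - s, by ring⟩

end Hochschild

/-! ### Lengths of words -/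

section Length

set_option linter.unusedSectionVars false

variable {R H M : Type*} [CommRing R] [AddCommGroup H] [Module R H] [AddCommGroup M]

theorem splitSum_append_singleton {X : Type*} {u : List X} {z : X} {g : List X → List X → M}
    (h : ∀ p q, p ++ q = u ++ [z] → q.length ≠ 1 → g p q = 0) :
    splitSum (u ++ [z]) g = g u [z] := by
  rw [splitSum_eq_range, Finset.sum_eq_single u.length]
  · simp
  · intro i hi hiu
    have := Finset.mem_range.1 hi
    refine h _ _ (List.take_append_drop _ _) ?_
    rw [List.length_drop, List.length_append, List.length_singleton] at *
    omega
  · intro hi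
    exact absurd (Finset.mem_range.2 (by rw [List.length_append, List.length_singleton]; omega)) hi

variable [Module R M] {𝒜 : ℤ → Submodule R H} [DirectSum.Decomposition 𝒜]

theorem headOp_sub (m m' : TensorAlgebra R H →ₗ[R] H) : headOp (m - m') = headOp m - headOp m' := by
  rw [headOp, LinearMap.comp_sub, conv_sub_left]; rfl

theorem coder_sub (m m' : TensorAlgebra R H →ₗ[R] H) :
    coder 𝒜 (m - m') = coder 𝒜 m - coder 𝒜 m' := by
  rw [coder, headOp_sub, conv_sub_right]; rfl

theorem headOp_word_eq_zero {m : TensorAlgebra R H →ₗ[R] H} {j : ℕ}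
    (h : ∀ v, IsHomogeneousWord 𝒜 v → v.length ≤ j → m (word R v) = 0) {w : List (ℤ × H)}
    (hw : IsHomogeneousWord 𝒜 w) (hj : w.length ≤ j) : headOp m (word R w) = 0 := by
  rw [headOp_word]
  refine splitSum_zero fun u v huv => ?_
  subst huv
  rw [List.length_append] at hj
  rw [h u (isHomogeneousWord_append.1 hw).1 (by omega), map_zero, zero_mul]

theorem coder_word_eq_zero {m : TensorAlgebra R H →ₗ[R] H} {j : ℕ}
    (h : ∀ v, IsHomogeneousWord 𝒜 v → v.length ≤ j → m (word R v) = 0) {w : List (ℤ × H)}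
    (hw : IsHomogeneousWord 𝒜 w) (hj : w.length ≤ j) : coder 𝒜 m (word R w) = 0 := by
  induction w with
  | nil =>
    rw [word_nil, coder_one 𝒜]
    simpa using h [] hw (by simp)
  | cons a w ih =>
    rw [coder_cons, headOp_word_eq_zero h hw hj, ih (isHomogeneousWord_cons.1 hw).2
      (by rw [List.length_cons] at hj; omega), mul_zero, add_zero]

/-- An operation vanishing on at most `j` letters consumes at least `j + 1` and returns one, so its
coderivation shortens words by at least `j`. -/
theorem coder_word_mem_lengthLE {m : TensorAlgebra R H →ₗ[R] H} (hm : HasBarDegree 𝒜 m 1) {j n : ℕ}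
    (h : ∀ v, IsHomogeneousWord 𝒜 v → v.length ≤ j → m (word R v) = 0) {w : List (ℤ × H)}
    (hw : IsHomogeneousWord 𝒜 w) (hj : w.length ≤ n + j) :
    coder 𝒜 m (word R w) ∈ lengthLE 𝒜 n := by
  induction w generalizing n with
  | nil =>
    rw [coder_word_eq_zero h hw (by simp)]; exact zero_mem _
  | cons a w ih =>
    have hw' := isHomogeneousWord_cons.1 hw
    by_cases hj' : (a :: w).length ≤ j
    · rw [coder_word_eq_zero h hw hj']; exact zero_mem _
    obtain _ | n := n
    · omega
    rw [coder_cons]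
    refine add_mem ?_ (ι_mul_mem_lengthLE (barSign_mem hw'.1)
      (ih hw'.2 (by rw [List.length_cons] at hj; omega)))
    rw [headOp_word]
    refine splitSum_mem _ fun u v huv => ?_
    have hh : IsHomogeneousWord 𝒜 u ∧ IsHomogeneousWord 𝒜 v := by
      rwa [← huv, isHomogeneousWord_append] at hw
    by_cases hu : u.length ≤ j
    · rw [h u hh.1 hu, map_zero, zero_mul]; exact zero_mem _
    · refine ι_mul_mem_lengthLE (hm u hh.1) (word_mem_lengthLE hh.2 ?_)
      have := congrArg List.length huv
      rw [List.length_append] at this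
      omega

theorem cohom_word_congr {φ ψ : TensorAlgebra R H →ₗ[R] H} (hφ : φ 1 = 0) (hψ : ψ 1 = 0) {n : ℕ}
    (h : ∀ v, IsHomogeneousWord 𝒜 v → v.length ≤ n → φ (word R v) = ψ (word R v))
    {w : List (ℤ × H)} (hw : IsHomogeneousWord 𝒜 w) (hn : w.length ≤ n) :
    cohom φ (word R w) = cohom ψ (word R w) := by
  suffices H : ∀ l (w : List (ℤ × H)), w.length = l → IsHomogeneousWord 𝒜 w → w.length ≤ n →
      cohom φ (word R w) = cohom ψ (word R w) from H _ w rfl hw hn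
  clear hw hn w
  intro l
  induction l using Nat.strong_induction_on with
  | _ l ih =>
    intro w hl hw hn
    cases w with
    | nil => rw [word_nil, cohom_one hφ, cohom_one hψ]
    | cons a w =>
      have hw' := isHomogeneousWord_cons.1 hw
      rw [cohom_cons hφ, cohom_cons hψ]
      refine splitSum_congr_homogeneous hw'.2 fun u v hu hv huv => ?_
      have := congrArg List.length huv
      rw [List.length_append] at this
      rw [List.length_cons] at hl hn
      rw [h (a :: u) (isHomogeneousWord_cons.2 ⟨hw'.1, hu⟩) (by rw [List.length_cons]; omega),
        ih v.length (by omega) v rfl hv (by omega)]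

theorem eq_of_mem_lengthLE {f g : TensorAlgebra R H →ₗ[R] M} {n : ℕ}
    (h : ∀ w, IsHomogeneousWord 𝒜 w → w.length ≤ n → f (word R w) = g (word R w))
    {x : TensorAlgebra R H} (hx : x ∈ lengthLE 𝒜 n) : f x = g x := by
  have := mem_of_mem_lengthLE (f := f - g) (p := ⊥)
    (fun w hw hn => by simp [h w hw hn]) hx
  rwa [Submodule.mem_bot, LinearMap.sub_apply, sub_eq_zero] at this

end Length

/-! ### The degenerate structure -/

section Degenerate

set_option linter.unusedSectionVars false

variable {R H : Type*} [CommRing R] [NonUnitalRing H] [Module R H]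
  [IsScalarTower R H H] [SMulCommClass R H H]
  {𝒜 : ℤ → Submodule R H} [DirectSum.Decomposition 𝒜]

/-- Only words of length three matter, and there the two terms are the two bracketings of a triple
product, with opposite signs: this is associativity. -/
theorem barProduct_comp_coder [SetLike.GradedMul 𝒜] :
    barProduct 𝒜 ∘ₗ coder 𝒜 (barProduct 𝒜) = 0 := by
  refine linearMap_ext_word 𝒜 fun w hw => ?_
  rw [LinearMap.comp_apply, LinearMap.zero_apply]
  refine (conv_coder 𝒜 (barProduct_one 𝒜) _ _ _ _).trans ?_
  rw [proj_coder 𝒜 (barProduct_one 𝒜), conv_word,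
    conv_word]
  by_cases hl : w.length = 3
  · match w, hl with
    | [a, b, c], _ =>
      have ha := isHomogeneousWord_cons.1 hw
      have hb := isHomogeneousWord_cons.1 ha.2
      have h1 : splitSum [a, b, c] (fun u v => barMul 𝒜 (barProduct 𝒜 (word R u))
          (proj R H (word R v))) = barMul 𝒜 (barMul 𝒜 a.2 b.2) c.2 := by
        simp only [splitSum_cons, splitSum_nil, proj_word, barProduct_pair]
        simp
      have h2 : splitSum [a, b, c] (fun u v => barMul 𝒜 ((proj R H ∘ₗ barSignT 𝒜) (word R u))
          (barProduct 𝒜 (word R v))) =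
            (a.1 - 1).negOnePow • barMul 𝒜 a.2 (barMul 𝒜 b.2 c.2) := by
        rw [splitSum_eq_first]
        · rw [barProduct_pair, LinearMap.comp_apply, barSignT_word 𝒜
            (isHomogeneousWord_cons.2 ⟨ha.1, isHomogeneousWord_nil 𝒜⟩), map_unit_smul, proj_word]
          simp [barDeg_cons, barDeg_nil]
        · intro u v huv hu
          rw [barProduct_eq_zero, map_zero]
          have := congrArg List.length huv
          rw [List.length_append] at this
          simp only [List.length_cons, List.length_nil] at this
          omega
      rw [h1, h2, barMul_apply 𝒜 ha.1, barMul_apply 𝒜 hb.1, barMul_apply 𝒜 ha.1,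
        barMul_apply 𝒜 (unit_smul_mem _ _ (SetLike.mul_mem_graded ha.1 hb.1)), mul_unit_smul,
        unit_smul_mul, smul_smul, smul_smul, smul_smul, mul_assoc, ← Int.negOnePow_add,
        ← Int.negOnePow_add, ← Int.negOnePow_add, add_eq_zero_iff_eq_neg, ← Units.neg_smul,
        ← Int.negOnePow_succ]
      congr 1
      rw [Int.negOnePow_eq_iff]
      exact ⟨0, by ring⟩
  · rw [splitSum_zero, splitSum_congr_homogeneous hw (g' := fun _ _ => 0), splitSum_zero, add_zero]
    · simp
    · intro u v hu hv huv
      by_cases h : v.length = 2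
      · have h3 : u.length ≠ 1 := by
          rintro h3; apply hl; rw [← huv, List.length_append, h, h3]
        rw [LinearMap.comp_apply, barSignT_word 𝒜 hu, map_unit_smul, proj_word, if_neg h3]
        simp
      · rw [barProduct_eq_zero 𝒜 h, map_zero]
    · intro u v huv
      by_cases h : u.length = 2
      · have h3 : v.length ≠ 1 := by
          rintro h3; apply hl; rw [← huv, List.length_append, h, h3]
        rw [proj_word v, if_neg h3, map_zero]
      · rw [barProduct_eq_zero 𝒜 h, map_zero, LinearMap.zero_apply]

theorem barEval_product {m : MultilinearMap R (fun _ : Fin 2 => H) H}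
    (h : ∀ a b : H, m ![a, b] = a * b) {w : List (ℤ × H)} (hw : IsHomogeneousWord 𝒜 w)
    (hl : w.length = 2) : barEval m w = barProduct 𝒜 (word R w) := by
  match w, hl with
  | [a, b], _ =>
    have ha := isHomogeneousWord_cons.1 hw
    have e : (fun i : Fin 2 => ([a, b].getD i (0, 0)).2) = ![a.2, b.2] := by
      ext i; fin_cases i <;> rfl
    rw [barProduct_pair, barMul_apply 𝒜 ha.1, barEval, e, h]
    simp [suspExp]

/-- The operations of arity other than `2` removed. -/
noncomputable def degenerate (m : ∀ n : ℕ, MultilinearMap R (fun _ : Fin n => H) H) (n : ℕ) :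
    MultilinearMap R (fun _ : Fin n => H) H := if n = 2 then m n else 0

variable {m : ∀ n : ℕ, MultilinearMap R (fun _ : Fin n => H) H}

theorem bar_degenerate (h : ∀ a b : H, m 2 ![a, b] = a * b) :
    bar 𝒜 (degenerate m) = barProduct 𝒜 := by
  refine linearMap_ext_word 𝒜 fun w hw => ?_
  by_cases hl : w.length = 2
  · rw [bar_word 𝒜 _ hw hl, ← barEval_product h hw hl]; rfl
  · rw [bar_word 𝒜 _ hw rfl, barProduct_eq_zero 𝒜 hl, degenerate, if_neg hl, barEval]
    simp

theorem IsMinimalCInfty.degenerate [SetLike.GradedMul 𝒜] (hm : IsMinimalCInfty 𝒜 m) :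
    IsMinimalCInfty 𝒜 (degenerate m) := by
  have h0 : CInfty.degenerate m 0 = 0 := if_neg (by omega)
  have hd : ∀ n : ℕ, HasDegree 𝒜 𝒜 (CInfty.degenerate m n) (2 - n) := by
    intro n
    by_cases hn : n = 2
    · rw [CInfty.degenerate, if_pos hn]; exact hm.degree n
    · rw [CInfty.degenerate, if_neg hn]
      exact fun d a _ => zero_mem _
  refine ⟨⟨⟨h0, hd, ?_⟩, ?_⟩, ?_, ?_⟩
  · intro w _ hw
    rw [sum_insertion_eq h0 hd _ hw, bar_degenerate hm.product]
    exact LinearMap.congr_fun barProduct_comp_coder _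
  · intro n
    by_cases hn : n = 2
    · rw [CInfty.degenerate, if_pos hn]; exact hm.shuffle n
    · rw [CInfty.degenerate, if_neg hn]
      exact (harrisonCochains 𝒜 n 0).zero_mem.2
  · exact if_neg (by omega)
  · exact hm.product

theorem IsMinimalCInfty.bar_eq_barProduct (hm : IsMinimalCInfty 𝒜 m) {w : List (ℤ × H)}
    (hw : IsHomogeneousWord 𝒜 w) (hl : w.length ≤ 2) :
    bar 𝒜 m (word R w) = barProduct 𝒜 (word R w) := by
  by_cases h2 : w.length = 2
  · rw [bar_word 𝒜 _ hw h2, barEval_product hm.product hw h2]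
  · rw [barProduct_eq_zero 𝒜 h2]
    obtain h | h : w.length = 0 ∨ w.length = 1 := by omega
    · rw [bar_word 𝒜 _ hw h, hm.zero, barEval]; simp
    · rw [bar_word 𝒜 _ hw h, hm.minimal, barEval]; simp

theorem IsCInfty.bar_comp_coder (hm : IsCInfty 𝒜 m) : bar 𝒜 m ∘ₗ coder 𝒜 (bar 𝒜 m) = 0 := by
  refine linearMap_ext_word 𝒜 fun w hw => ?_
  rw [LinearMap.comp_apply, LinearMap.zero_apply]
  by_cases h : w = []
  · rw [h, word_nil, coder_one 𝒜 (bar_one hm.zero), map_zero]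
  · rw [← sum_insertion_eq hm.zero hm.degree _ hw, hm.rel w h hw]

theorem IsCInfty.hasBarDegree (hm : IsCInfty 𝒜 m) : HasBarDegree 𝒜 (bar 𝒜 m) 1 :=
  hasBarDegree_bar (by simpa [one_add_one_eq_two] using hm.degree)

end Degenerate

/-! ### Convolutions on words of small length -/

section Conv

set_option linter.unusedSectionVars false

variable {R H M N P : Type*} [CommRing R] [AddCommGroup H] [Module R H] [AddCommGroup M]
  [Module R M] [AddCommGroup N] [Module R N] [AddCommGroup P] [Module R P]
  {𝒜 : ℤ → Submodule R H}

theorem conv_word_eq_zero (β : M →ₗ[R] N →ₗ[R] P) {φ : TensorAlgebra R H →ₗ[R] M}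
    {ψ : TensorAlgebra R H →ₗ[R] N} {w : List (ℤ × H)} (hw : IsHomogeneousWord 𝒜 w)
    (h : ∀ p q, IsHomogeneousWord 𝒜 p → IsHomogeneousWord 𝒜 q → p.length + q.length = w.length →
      φ (word R p) = 0 ∨ ψ (word R q) = 0) :
    conv β φ ψ (word R w) = 0 := by
  rw [conv_word]
  refine splitSum_zero fun p q hpq => ?_
  rw [← hpq, isHomogeneousWord_append] at hw
  obtain h | h := h p q hw.1 hw.2 (by rw [← hpq, List.length_append])
  · rw [h, map_zero, LinearMap.zero_apply]
  · rw [h, map_zero]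

theorem conv_word_append_singleton (β : M →ₗ[R] N →ₗ[R] P) {φ : TensorAlgebra R H →ₗ[R] M}
    {ψ : TensorAlgebra R H →ₗ[R] N} {u : List (ℤ × H)} {z : ℤ × H}
    (hw : IsHomogeneousWord 𝒜 (u ++ [z]))
    (h : ∀ p q, IsHomogeneousWord 𝒜 p → IsHomogeneousWord 𝒜 q →
      p.length + q.length = u.length + 1 → q.length ≠ 1 → φ (word R p) = 0 ∨ ψ (word R q) = 0) :
    conv β φ ψ (word R (u ++ [z])) = β (φ (word R u)) (ψ (word R [z])) := by
  rw [conv_word, splitSum_append_singleton]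
  intro p q hpq hq
  rw [← hpq, isHomogeneousWord_append] at hw
  obtain h | h := h p q hw.1 hw.2 (by rw [← List.length_append, hpq]; simp) hq
  · rw [h, map_zero, LinearMap.zero_apply]
  · rw [h, map_zero]

theorem conv_word_cons (β : M →ₗ[R] N →ₗ[R] P) {φ : TensorAlgebra R H →ₗ[R] M}
    {ψ : TensorAlgebra R H →ₗ[R] N} {a : ℤ × H} {t : List (ℤ × H)}
    (hw : IsHomogeneousWord 𝒜 (a :: t))
    (h : ∀ p q, IsHomogeneousWord 𝒜 p → IsHomogeneousWord 𝒜 q →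
      p.length + q.length = t.length + 1 → p.length ≠ 1 → φ (word R p) = 0 ∨ ψ (word R q) = 0) :
    conv β φ ψ (word R (a :: t)) = β (φ (word R [a])) (ψ (word R t)) := by
  rw [conv_word, splitSum_eq_first]
  intro p q hpq hp
  rw [← hpq, isHomogeneousWord_append] at hw
  obtain h | h := h p q hw.1 hw.2 (by rw [← List.length_append, hpq]; simp) hp
  · rw [h, map_zero, LinearMap.zero_apply]
  · rw [h, map_zero]

/-- Placing `f` in arity `n` and zero elsewhere reduces the claim to linear maps on the tensor
algebra, which homogeneous words detect. -/
theorem multilinearMap_eq_zero [DirectSum.Decomposition 𝒜] {n : ℕ}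
    {f : MultilinearMap R (fun _ : Fin n => H) M}
    (h : ∀ w : List (ℤ × H), IsHomogeneousWord 𝒜 w → w.length = n → barEval f w = 0) : f = 0 := by
  have h0 : ofComponents (Pi.single n f : ∀ n : ℕ, MultilinearMap R (fun _ : Fin n => H) M) =
      0 := by
    refine linearMap_ext_word 𝒜 fun w hw => ?_
    rw [ofComponents_word, LinearMap.zero_apply]
    by_cases hn : w.length = n
    · subst hn
      rw [Pi.single_eq_same]
      have h1 := h w hw rfl
      rw [barEval] at h1
      have h2 := congrArg (fun x => (suspExp w).negOnePow • x) h1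
      simpa [smul_smul, ← Int.negOnePow_add, Int.negOnePow_even _ ⟨_, rfl⟩] using h2
    · rw [Pi.single_eq_of_ne hn]; rfl
  ext a
  rw [← Pi.single_eq_same (M := fun n : ℕ => MultilinearMap R (fun _ : Fin n => H) M) n f,
    ← ofComponents_tprod, h0]
  rfl

theorem eq_zero_of_one_of_nil {φ : TensorAlgebra R H →ₗ[R] M} (h : φ 1 = 0) {w : List (ℤ × H)}
    (hw : w.length = 0) : φ (word R w) = 0 := by
  rw [List.length_eq_zero_iff.1 hw, word_nil, h]

end Conv

/-! ### Morphisms up to a given length -/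

section Obstruction

set_option linter.unusedSectionVars false

variable {R H : Type*} [CommRing R] [AddCommGroup H] [Module R H]
  (𝒜 : ℤ → Submodule R H) [DirectSum.Decomposition 𝒜]

/-- The failure of `φ` to be compatible with the operations `m` and `m'`. -/
noncomputable def obstruction (m m' φ : TensorAlgebra R H →ₗ[R] H) : TensorAlgebra R H →ₗ[R] H :=
  φ ∘ₗ coder 𝒜 m - m' ∘ₗ cohom φ

/-- Linear part the identity, and compatibility with the operations on words of length at
most `n`. -/
structure IsPartialMorphism (m m' : TensorAlgebra R H →ₗ[R] H) (n : ℕ)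
    (φ : TensorAlgebra R H →ₗ[R] H) : Prop where
  init : ∀ w, IsHomogeneousWord 𝒜 w → w.length ≤ 1 → φ (word R w) = proj R H (word R w)
  degree : HasBarDegree 𝒜 φ 0
  shuffle : KillsShuffles 𝒜 φ
  rel : ∀ w, IsHomogeneousWord 𝒜 w → w.length ≤ n → obstruction 𝒜 m m' φ (word R w) = 0

variable {𝒜} {m m' φ : TensorAlgebra R H →ₗ[R] H} {n : ℕ}

theorem IsPartialMorphism.map_one (h : IsPartialMorphism 𝒜 m m' n φ) : φ 1 = 0 := by
  have := h.init [] (isHomogeneousWord_nil 𝒜) (by simp)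
  rwa [word_nil, proj_one] at this

theorem IsPartialMorphism.map_singleton (h : IsPartialMorphism 𝒜 m m' n φ) {a : ℤ × H}
    (ha : IsHomogeneousWord 𝒜 [a]) : φ (word R [a]) = a.2 := by
  rw [h.init [a] ha (by simp), proj_word]; simp

theorem hasBarDegree_obstruction (h : m 1 = 0) (hφ : φ 1 = 0) (hm : HasBarDegree 𝒜 m 1)
    (hm' : HasBarDegree 𝒜 m' 1) (hd : HasBarDegree 𝒜 φ 0) :
    HasBarDegree 𝒜 (obstruction 𝒜 m m' φ) 1 := by
  intro w hw
  refine sub_mem ?_ (hm'.apply_mem (cohom_mem_barGrade hφ hd (word_mem_barGrade hw)))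
  simpa using hd.apply_mem (coder_mem_barGrade h hm (word_mem_barGrade hw))

/-- Both `coder m` and `cohom φ` preserve the span of shuffles, on which `φ` and `m'` vanish. -/
theorem killsShuffles_obstruction (h : m 1 = 0) (hφ : φ 1 = 0) (hm : HasBarDegree 𝒜 m 1)
    (hms : KillsShuffles 𝒜 m) (hms' : KillsShuffles 𝒜 m') (hd : HasBarDegree 𝒜 φ 0)
    (hs : KillsShuffles 𝒜 φ) : KillsShuffles 𝒜 (obstruction 𝒜 m m' φ) := by
  rw [killsShuffles_iff] at hms' ⊢
  intro x hx
  rw [obstruction, LinearMap.sub_apply, LinearMap.comp_apply, LinearMap.comp_apply,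
    hms' _ (cohom_mem_shuffleSpan hφ hd hs hx),
    killsShuffles_iff.1 hs _ (coder_mem_shuffleSpan h hm hms hx), sub_zero]

end Obstruction

/-! ### Extending a partial morphism by one arity -/

section Extension

set_option linter.unusedSectionVars false

variable {R H : Type*} [CommRing R] [NonUnitalRing H] [Module R H]
  [IsScalarTower R H H] [SMulCommClass R H H]
  {𝒜 : ℤ → Submodule R H} [DirectSum.Decomposition 𝒜] [SetLike.GradedMul 𝒜]
  {m φ : TensorAlgebra R H →ₗ[R] H} {n : ℕ}

theorem barProduct_cohom (hφ : φ 1 = 0) (x : TensorAlgebra R H) :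
    barProduct 𝒜 (cohom φ x) = conv (barMul 𝒜) φ φ x := by
  rw [barProduct, (isCoalgHom_cohom hφ).conv_map, proj_cohom hφ]

/-- The operations `m` and the product agree through length two, so the difference of their
coderivations shortens words by at least two and lands where `f` vanishes. Higher operations are
thus invisible to `f` in this range. -/
theorem apply_coder_eq {M : Type*} [AddCommGroup M] [Module R M] {f : TensorAlgebra R H →ₗ[R] M}
    (hm : HasBarDegree 𝒜 m 1) (hb : HasBarDegree 𝒜 (barProduct 𝒜) 1)
    (hm2 : ∀ w, IsHomogeneousWord 𝒜 w → w.length ≤ 2 → m (word R w) = barProduct 𝒜 (word R w))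
    (hf : ∀ w, IsHomogeneousWord 𝒜 w → w.length ≤ n → f (word R w) = 0) {w : List (ℤ × H)}
    (hw : IsHomogeneousWord 𝒜 w) (hn : w.length ≤ n + 2) :
    f (coder 𝒜 m (word R w)) = f (coder 𝒜 (barProduct 𝒜) (word R w)) := by
  rw [← sub_eq_zero, ← map_sub, ← LinearMap.sub_apply, ← coder_sub]
  refine eq_of_mem_lengthLE (g := 0) hf (coder_word_mem_lengthLE (j := 2) (fun v hv => ?_)
    (fun v hv hl => ?_) hw hn)
  · exact sub_mem (hm v hv) (hb v hv)
  · rw [LinearMap.sub_apply, hm2 v hv hl, sub_self]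

/-- On words of length `n + 2` the vanishing of the obstruction through length `n` leaves, in each
convolution of `obstruction_cocycle`, only the term where `φ` takes a single letter. These are the
outer Hochschild terms. -/
theorem hochschildD_obstruction (h1 : m 1 = 0) (hm : HasBarDegree 𝒜 m 1)
    (hb : HasBarDegree 𝒜 (barProduct 𝒜) 1) (hmm : m ∘ₗ coder 𝒜 m = 0)
    (hm2 : ∀ w, IsHomogeneousWord 𝒜 w → w.length ≤ 2 → m (word R w) = barProduct 𝒜 (word R w))
    (hφ : IsPartialMorphism 𝒜 m (barProduct 𝒜) n φ) :
    hochschildD 𝒜 (n + 1) (2 - (n + 1 : ℕ))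
      (unbar 𝒜 (obstruction 𝒜 m (barProduct 𝒜) φ) (n + 1)) = 0 := by
  have hob := hasBarDegree_obstruction h1 hφ.map_one hm hb hφ.degree
  refine multilinearMap_eq_zero (𝒜 := 𝒜) fun w hw hl => ?_
  obtain ⟨a, t, ht⟩ := List.exists_cons_of_length_eq_add_one hl
  obtain ⟨u, z, hu⟩ : ∃ u z, w = u ++ [z] :=
    ⟨w.dropLast, w.getLast (by rintro rfl; simp at hl), (List.dropLast_append_getLast _).symm⟩
  have htl : t.length = n + 1 := by rw [ht, List.length_cons] at hl; omega
  have hul : u.length = n + 1 := by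
    rw [hu, List.length_append, List.length_singleton] at hl; omega
  rw [barEval_hochschildD 𝒜 (k := 2 - (n + 1 : ℕ)) (s := 1) (by ring) (hasDegree_unbar hob (n + 1))
    (fun v hv hn => (barEval_unbar 𝒜 _ hv hn).symm) hw ht hu htl]
  have key := obstruction_cocycle h1 (barProduct_one 𝒜) hφ.map_one hφ.degree
    (coder_coder h1 hm hmm) barProduct_comp_coder (barMul 𝒜) rfl (word R w)
  rw [← obstruction] at key
  have e1 : conv (barMul 𝒜) (obstruction 𝒜 m (barProduct 𝒜) φ) φ (word R w) =
      barMul 𝒜 (obstruction 𝒜 m (barProduct 𝒜) φ (word R u)) z.2 := by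
    subst hu
    rw [conv_word_append_singleton (𝒜 := 𝒜) _ hw,
      hφ.map_singleton (isHomogeneousWord_append.1 hw).2]
    intro p q hp hq hpq hq1
    -- If `q` has at least two letters, then `p` has at most `n`, and the obstruction vanishes on
    -- it.
    by_cases hq0 : q.length = 0
    · exact Or.inr (eq_zero_of_one_of_nil hφ.map_one hq0)
    · exact Or.inl (hφ.rel p hp (by omega))
  have e2 : conv (barMul 𝒜) (φ ∘ₗ barSignT 𝒜) (obstruction 𝒜 m (barProduct 𝒜) φ) (word R w) =
      (a.1 - 1).negOnePow • barMul 𝒜 a.2 (obstruction 𝒜 m (barProduct 𝒜) φ (word R t)) := by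
    subst ht
    have ha : IsHomogeneousWord 𝒜 [a] := (isHomogeneousWord_append (u := [a]).1 hw).1
    rw [conv_word_cons (𝒜 := 𝒜) _ hw, LinearMap.comp_apply, barSignT_word 𝒜 ha, map_unit_smul,
      hφ.map_singleton ha]
    · simp [barDeg_cons, barDeg_nil]
    intro p q hp hq hpq hp1
    by_cases hp0 : p.length = 0
    · left
      rw [LinearMap.comp_apply, barSignT_word 𝒜 hp, map_unit_smul,
        eq_zero_of_one_of_nil hφ.map_one hp0, smul_zero]
    · exact Or.inr (hφ.rel q hq (by omega))
  rw [e1, e2, apply_coder_eq hm hb hm2 hφ.rel hw (by omega)] at key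
  rw [← neg_eq_zero, ← key, one_mul, Int.negOnePow_one, Units.neg_smul, one_smul,
    Int.negOnePow_sub, Int.negOnePow_one, mul_neg_one, Units.neg_smul]
  abel

theorem IsPartialMorphism.exists_extension (hn : 2 ≤ n) (h1 : m 1 = 0) (hm : HasBarDegree 𝒜 m 1)
    (hms : KillsShuffles 𝒜 m) (hb : HasBarDegree 𝒜 (barProduct 𝒜) 1)
    (hbs : KillsShuffles 𝒜 (barProduct 𝒜)) (hmm : m ∘ₗ coder 𝒜 m = 0)
    (hm2 : ∀ w, IsHomogeneousWord 𝒜 w → w.length ≤ 2 → m (word R w) = barProduct 𝒜 (word R w))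
    (hHarr : Subsingleton (HarrisonCohomology 𝒜 (n + 1) (2 - (n + 1 : ℕ))))
    (hφ : IsPartialMorphism 𝒜 m (barProduct 𝒜) n φ) :
    ∃ φ', IsPartialMorphism 𝒜 m (barProduct 𝒜) (n + 1) φ' ∧
      ∀ w, IsHomogeneousWord 𝒜 w → w.length < n → φ' (word R w) = φ (word R w) := by
  have hob := hasBarDegree_obstruction h1 hφ.map_one hm hb hφ.degree
  have hobs := killsShuffles_obstruction h1 hφ.map_one hm hms hbs hφ.degree hφ.shuffle
  have hmem : unbar 𝒜 (obstruction 𝒜 m (barProduct 𝒜) φ) (n + 1) ∈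
      harrisonCocycles 𝒜 (n + 1) (2 - (n + 1 : ℕ)) :=
    ⟨⟨hasDegree_unbar hob (n + 1), vanishesOnShuffles_unbar hobs (n + 1)⟩,
      hochschildD_obstruction h1 hm hb hmm hm2 hφ⟩
  obtain ⟨h, hh, hδ⟩ : unbar 𝒜 (obstruction 𝒜 m (barProduct 𝒜) φ) (n + 1) ∈
      harrisonCoboundaries 𝒜 (n + 1) (2 - (n + 1 : ℕ)) := by
    have := (Submodule.Quotient.mk_eq_zero _).1 (hHarr.elim (Submodule.Quotient.mk ⟨_, hmem⟩) 0)
    exact this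
  -- The correction lives in arity `n` alone; the preimage `h` has degree `1 - n`, as a component of
  -- a morphism must.
  set c := bar 𝒜 (Pi.single n h : ∀ n : ℕ, MultilinearMap R (fun _ : Fin n => H) H) with hc
  have hcn : ∀ v, IsHomogeneousWord 𝒜 v → v.length = n → c (word R v) = barEval h v := by
    intro v hv hvn
    rw [hc, bar_word 𝒜 _ hv hvn, Pi.single_eq_same]
  have hc0 : ∀ v, IsHomogeneousWord 𝒜 v → v.length ≠ n → c (word R v) = 0 := by
    intro v hv hvn
    rw [hc, bar_word 𝒜 _ hv rfl, Pi.single_eq_of_ne hvn, barEval]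
    simp
  have hcd : HasBarDegree 𝒜 c 0 := by
    refine hasBarDegree_bar fun k => ?_
    by_cases hk : k = n
    · subst hk
      rw [Pi.single_eq_same]
      convert hh.1 using 1
      push_cast; ring
    · rw [Pi.single_eq_of_ne hk]
      exact fun d a _ => zero_mem _
  have hcs : KillsShuffles 𝒜 c := by
    refine killsShuffles_bar fun k => ?_
    by_cases hk : k = n
    · subst hk
      rw [Pi.single_eq_same]
      exact hh.2
    · rw [Pi.single_eq_of_ne hk]
      exact (harrisonCochains 𝒜 k 0).zero_mem.2
  have hφ'1 : ∀ w, IsHomogeneousWord 𝒜 w → w.length ≠ n → (φ + c) (word R w) = φ (word R w) := by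
    intro w hw hl
    rw [LinearMap.add_apply, hc0 w hw hl, add_zero]
  have h0 : (φ + c) 1 = 0 := by
    have := hφ'1 [] (isHomogeneousWord_nil 𝒜) (by simp; omega)
    rwa [word_nil, hφ.map_one] at this
  refine ⟨φ + c, ⟨fun w hw hl => ?_, fun w hw => add_mem (hφ.degree w hw) (hcd w hw),
    fun u v hu hv hu' hv' => ?_, fun w hw hl => ?_⟩, fun w hw hl => hφ'1 w hw hl.ne⟩
  · rw [hφ'1 w hw (by omega), hφ.init w hw hl]
  · rw [LinearMap.add_apply, hφ.shuffle u v hu hv hu' hv', hcs u v hu hv hu' hv', add_zero]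
  -- The target operation is quadratic, so the change of `m' ∘ cohom` is a sum of two convolutions.
  -- Keeping `φ + c` on the right of the first absorbs the term quadratic in `c`.
  · have e : obstruction 𝒜 m (barProduct 𝒜) (φ + c) (word R w) =
        obstruction 𝒜 m (barProduct 𝒜) φ (word R w) + c (coder 𝒜 m (word R w)) -
          (conv (barMul 𝒜) c (φ + c) (word R w) + conv (barMul 𝒜) φ c (word R w)) := by
      have e1 := conv_sub_left (barMul 𝒜) (φ + c) φ (φ + c)
      have e2 := conv_sub_right (barMul 𝒜) φ (φ + c) φ
      rw [add_sub_cancel_left] at e1 e2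
      rw [e1, e2, obstruction, obstruction, LinearMap.sub_apply, LinearMap.sub_apply,
        LinearMap.sub_apply, LinearMap.sub_apply, LinearMap.comp_apply, LinearMap.comp_apply,
        LinearMap.comp_apply, LinearMap.comp_apply, barProduct_cohom h0,
        barProduct_cohom hφ.map_one, LinearMap.add_apply]
      abel
    rw [e]
    have hcd' : ∀ v, IsHomogeneousWord 𝒜 v → v.length ≤ n - 1 → c (word R v) = 0 :=
      fun v hv hl => hc0 v hv (by omega)
    rw [apply_coder_eq hm hb hm2 hcd' hw (by omega)]
    obtain hl | hl : w.length ≤ n ∨ w.length = n + 1 := by omega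
    -- In length at most `n` nothing changes: the product shortens the word to fewer than `n`
    -- letters, and a convolution would need all `n` letters in `c` and an empty word in the other
    -- factor.
    · have e3 : c (coder 𝒜 (barProduct 𝒜) (word R w)) = 0 :=
        eq_of_mem_lengthLE (g := 0) hcd' (coder_word_mem_lengthLE (j := 1) hb
          (fun v _ hv => barProduct_eq_zero 𝒜 (by omega)) hw (by omega))
      rw [hφ.rel w hw hl, e3, conv_word_eq_zero (𝒜 := 𝒜) _ hw, conv_word_eq_zero (𝒜 := 𝒜) _ hw]
      · simp
      · intro p q hp hq hpq
        by_cases hqn : q.length = n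
        · exact Or.inl (eq_zero_of_one_of_nil hφ.map_one (by omega))
        · exact Or.inr (hc0 q hq hqn)
      · intro p q hp hq hpq
        by_cases hpn : p.length = n
        · exact Or.inr (eq_zero_of_one_of_nil h0 (by omega))
        · exact Or.inl (hc0 p hp hpn)
    · obtain ⟨a, t, ht⟩ := List.exists_cons_of_length_eq_add_one hl
      obtain ⟨u, z, hu⟩ : ∃ u z, w = u ++ [z] :=
        ⟨w.dropLast, w.getLast (by rintro rfl; simp at hl), (List.dropLast_append_getLast _).symm⟩
      have htl : t.length = n := by rw [ht, List.length_cons] at hl; omega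
      have hul : u.length = n := by
        rw [hu, List.length_append, List.length_singleton] at hl; omega
      have e1 : conv (barMul 𝒜) c (φ + c) (word R w) = barMul 𝒜 (c (word R u)) z.2 := by
        subst hu
        have hz := (isHomogeneousWord_append.1 hw).2
        rw [conv_word_append_singleton (𝒜 := 𝒜) _ hw, hφ'1 _ hz (by simp; omega),
          hφ.map_singleton hz]
        intro p q hp hq hpq hq1
        by_cases hq0 : q.length = 0
        · exact Or.inr (eq_zero_of_one_of_nil h0 hq0)
        · exact Or.inl (hc0 p hp (by omega))
      have e2 : conv (barMul 𝒜) φ c (word R w) = barMul 𝒜 a.2 (c (word R t)) := by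
        subst ht
        have ha : IsHomogeneousWord 𝒜 [a] := (isHomogeneousWord_append (u := [a]).1 hw).1
        rw [conv_word_cons (𝒜 := 𝒜) _ hw, hφ.map_singleton ha]
        intro p q hp hq hpq hp1
        by_cases hp0 : p.length = 0
        · exact Or.inl (eq_zero_of_one_of_nil hφ.map_one hp0)
        · exact Or.inr (hc0 q hq (by omega))
      -- In length `n + 1` the change is exactly minus `δh`, which equals minus the old obstruction.
      have key := barEval_hochschildD 𝒜 (k := 2 - (n + 1 : ℕ)) (s := 0) (by push_cast; ring) hh.1
        hcn hw ht hu htl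
      rw [hδ, barEval_unbar 𝒜 _ hw hl, zero_mul, Int.negOnePow_zero, one_smul, one_smul] at key
      rw [e1, e2, key]
      abel

end Extension

/-! ### Existence of the isomorphism -/

section Existence

set_option linter.unusedSectionVars false

variable {R H : Type*} [CommRing R] [NonUnitalRing H] [Module R H]
  [IsScalarTower R H H] [SMulCommClass R H H]
  {𝒜 : ℤ → Submodule R H} [DirectSum.Decomposition 𝒜]

/-- The identity starts the induction at length two: the two structures agree there, having zero
unary operation and the same product. -/
theorem isPartialMorphism_proj [SetLike.GradedMul 𝒜] {m : TensorAlgebra R H →ₗ[R] H} (h1 : m 1 = 0)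
    (hm2 : ∀ w, IsHomogeneousWord 𝒜 w → w.length ≤ 2 → m (word R w) = barProduct 𝒜 (word R w)) :
    IsPartialMorphism 𝒜 m (barProduct 𝒜) 2 (proj R H) := by
  refine ⟨fun _ _ _ => rfl, hasBarDegree_proj 𝒜, killsShuffles_proj, fun w hw hl => ?_⟩
  rw [obstruction, proj_coder 𝒜 h1, LinearMap.sub_apply, LinearMap.comp_apply,
    barProduct_cohom proj_one, hm2 w hw hl, ← barProduct, sub_self]

theorem exists_forall_isPartialMorphism [SetLike.GradedMul 𝒜] {m : TensorAlgebra R H →ₗ[R] H}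
    (h1 : m 1 = 0) (hm : HasBarDegree 𝒜 m 1) (hms : KillsShuffles 𝒜 m)
    (hb : HasBarDegree 𝒜 (barProduct 𝒜) 1) (hbs : KillsShuffles 𝒜 (barProduct 𝒜))
    (hmm : m ∘ₗ coder 𝒜 m = 0)
    (hm2 : ∀ w, IsHomogeneousWord 𝒜 w → w.length ≤ 2 → m (word R w) = barProduct 𝒜 (word R w))
    (hHarr : ∀ n : ℕ, 3 ≤ n → Subsingleton (HarrisonCohomology 𝒜 n (2 - n))) :
    ∃ φ, ∀ n, IsPartialMorphism 𝒜 m (barProduct 𝒜) n φ := by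
  have step : ∀ k φ, IsPartialMorphism 𝒜 m (barProduct 𝒜) (k + 2) φ →
      ∃ φ', IsPartialMorphism 𝒜 m (barProduct 𝒜) (k + 2 + 1) φ' ∧
        ∀ w, IsHomogeneousWord 𝒜 w → w.length < k + 2 → φ' (word R w) = φ (word R w) :=
    fun k φ hφ => hφ.exists_extension (by omega) h1 hm hms hb hbs hmm hm2 (hHarr _ (by omega))
  choose! S hS hS' using step
  -- Stage `k` is compatible through length `k + 2`, and passing to the next stage leaves words
  -- shorter than `k + 2` alone. So `F k` is final on words of length at most `k`, and the limit
  -- takes its arity `n` component from `F n`.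
  let F : ℕ → TensorAlgebra R H →ₗ[R] H := fun k => Nat.rec (proj R H) S k
  have hF : ∀ k, IsPartialMorphism 𝒜 m (barProduct 𝒜) (k + 2) (F k) := by
    intro k
    induction k with
    | zero => exact isPartialMorphism_proj h1 hm2
    | succ k ih => exact hS k _ ih
  have hFeq : ∀ w, IsHomogeneousWord 𝒜 w → ∀ k, w.length ≤ k →
      F k (word R w) = F w.length (word R w) := by
    intro w hw k hk
    induction k, hk using Nat.le_induction with
    | base => rfl
    | succ k hk ih => rw [← ih]; exact hS' k _ (hF k) w hw (by omega)
  have hΦ : ∀ w, IsHomogeneousWord 𝒜 w → ∀ k, w.length ≤ k →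
      bar 𝒜 (fun n => unbar 𝒜 (F n) n) (word R w) = F k (word R w) := by
    intro w hw k hk
    rw [bar_word 𝒜 _ hw rfl, barEval_unbar 𝒜 _ hw rfl, hFeq w hw k hk]
  refine ⟨bar 𝒜 fun n => unbar 𝒜 (F n) n, fun n => ⟨fun w hw hl => ?_, fun w hw => ?_, ?_,
    fun w hw hl => ?_⟩⟩
  · rw [hΦ w hw _ le_rfl, (hF _).init w hw hl]
  · rw [hΦ w hw _ le_rfl]
    exact (hF _).degree w hw
  · exact killsShuffles_bar fun n => vanishesOnShuffles_unbar (hF n).shuffle n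
  -- On a word of length `l`, the coderivation and the coalgebra map involve `φ` only on words of
  -- length at most `l`, where the limit agrees with stage `l`.
  · have h0 := hΦ [] (isHomogeneousWord_nil 𝒜) 0 le_rfl
    rw [word_nil, (hF 0).map_one] at h0
    have key := (hF w.length).rel w hw (by omega)
    rw [obstruction, LinearMap.sub_apply, LinearMap.comp_apply, LinearMap.comp_apply] at key ⊢
    rw [cohom_word_congr h0 (hF w.length).map_one (fun v hv hl => hΦ v hv _ hl) hw le_rfl, ← key]
    congr 1
    refine eq_of_mem_lengthLE (fun v hv hl => hΦ v hv _ hl)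
      (coder_word_mem_lengthLE (j := 0) hm (fun v _ hl => ?_) hw le_rfl)
    exact eq_zero_of_one_of_nil h1 (by omega)

theorem suspSign_ι (a : H) :
    suspSign 𝒜 (TensorAlgebra.ι R a) = TensorAlgebra.ι R a := by
  have := fold_ι_mul (suspStep 𝒜) (1, 0) a 1
  rw [mul_one] at this
  rw [suspSign, LinearMap.comp_apply, this, fold_one]
  simp [suspStep]

theorem unbar_one_apply (φ : TensorAlgebra R H →ₗ[R] H) (a : H) :
    unbar 𝒜 φ 1 ![a] = φ (TensorAlgebra.ι R a) := by
  simp [unbar, TensorAlgebra.tprod_apply, suspSign_ι]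

theorem IsPartialMorphism.map_ι {m m' φ : TensorAlgebra R H →ₗ[R] H} {n : ℕ}
    (h : IsPartialMorphism 𝒜 m m' n φ) (a : H) : φ (TensorAlgebra.ι R a) = a := by
  induction a using DirectSum.Decomposition.inductionOn 𝒜 with
  | zero => simp
  | add a b ha hb => rw [map_add, map_add, ha, hb]
  | @homogeneous i a =>
    have := h.map_singleton (a := (i, (a : H)))
      (isHomogeneousWord_cons.2 ⟨a.2, isHomogeneousWord_nil 𝒜⟩)
    rwa [word_cons, word_nil, mul_one] at this

theorem isCInftyHom_unbar {m m' : ∀ n : ℕ, MultilinearMap R (fun _ : Fin n => H) H}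
    (hm : IsCInfty 𝒜 m) {φ : TensorAlgebra R H →ₗ[R] H} (h1 : φ 1 = 0) (hd : HasBarDegree 𝒜 φ 0)
    (hs : KillsShuffles 𝒜 φ) (h : φ ∘ₗ coder 𝒜 (bar 𝒜 m) = bar 𝒜 m' ∘ₗ cohom φ) :
    IsCInftyHom 𝒜 𝒜 m m' (unbar 𝒜 φ) := by
  have hd' : ∀ n : ℕ, HasDegree 𝒜 𝒜 (unbar 𝒜 φ n) (1 - n) := by
    simpa using hasDegree_unbar hd
  refine ⟨⟨unbar_zero h1, hd', fun w _ hw => ?_⟩, vanishesOnShuffles_unbar hs⟩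
  rw [sum_insertion_eq hm.zero hm.degree _ hw, sum_composition_eq (unbar_zero h1) hd' _ hw,
    bar_unbar]
  exact LinearMap.congr_fun h _

theorem compEqId_unbar {φ ψ : TensorAlgebra R H →ₗ[R] H} (h1 : φ 1 = 0)
    (hd : HasBarDegree 𝒜 φ 0) (h : ψ ∘ₗ cohom φ = proj R H) :
    CompEqId 𝒜 (unbar 𝒜 φ) (unbar 𝒜 ψ) := by
  intro w _ hw
  rw [sum_composition_eq (unbar_zero h1) (by simpa using hasDegree_unbar hd) _ hw, bar_unbar,
    bar_unbar, ← proj_word (R := R), ← h]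
  rfl

end Existence

end CInfty

/-! ### The degeneration theorem -/

theorem mainTheorem7 {R H : Type*} [CommRing R] [NonUnitalRing H] [Module R H]
    [IsScalarTower R H H] [SMulCommClass R H H]
    (𝒜 : ℤ → Submodule R H) [DirectSum.Decomposition 𝒜] [SetLike.GradedMul 𝒜]
    (hcomm : CInfty.IsGradedCommutative 𝒜)
    (hHarr : ∀ n : ℕ, 3 ≤ n → Subsingleton (CInfty.HarrisonCohomology 𝒜 n (2 - n)))
    (m : ∀ n : ℕ, MultilinearMap R (fun _ : Fin n => H) H)
    (hm : CInfty.IsMinimalCInfty 𝒜 m) :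
    ∃ m₀ f : ∀ n : ℕ, MultilinearMap R (fun _ : Fin n => H) H,
      CInfty.IsMinimalCInfty 𝒜 m₀ ∧ (∀ n : ℕ, 3 ≤ n → m₀ n = 0) ∧
      CInfty.IsCInftyIso 𝒜 𝒜 m m₀ f ∧ (∀ a : H, f 1 ![a] = a) := by
  open CInfty in
  have hm₀ := hm.degenerate
  have hb : bar 𝒜 (degenerate m) = barProduct 𝒜 := bar_degenerate hm.product
  have h1 : bar 𝒜 m 1 = 0 := bar_one hm.zero
  obtain ⟨φ, hφ⟩ := exists_forall_isPartialMorphism h1 hm.hasBarDegree (killsShuffles_bar hm.shuffle)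
    (hb ▸ hm₀.hasBarDegree) (hb ▸ killsShuffles_bar hm₀.shuffle) hm.bar_comp_coder
    (fun w hw hl => hm.bar_eq_barProduct hw hl) hHarr
  have hφ1 := (hφ 0).map_one
  have hφd := (hφ 0).degree
  have hφs := (hφ 0).shuffle
  -- Each word is tested at the stage given by its own length.
  have hrel : φ ∘ₗ coder 𝒜 (bar 𝒜 m) = bar 𝒜 (degenerate m) ∘ₗ cohom φ := by
    rw [hb, ← sub_eq_zero]
    exact linearMap_ext_word 𝒜 fun w hw => (hφ w.length).rel w hw le_rfl
  obtain ⟨ψ, hψ1, hψd, hψs, hψφ, hφψ, hψ⟩ := exists_inverse hφ1 hφd (hφ 0).map_ι hφs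
  have h1' : bar 𝒜 (degenerate m) 1 = 0 := bar_one hm₀.zero
  refine ⟨degenerate m, unbar 𝒜 φ, hm₀, fun n hn => if_neg (by omega),
    ⟨isCInftyHom_unbar hm.toIsCInfty hφ1 hφd hφs hrel, unbar 𝒜 ψ,
      isCInftyHom_unbar hm₀.toIsCInfty hψ1 hψd hψs
        -- The inverse needs the intertwining of full coderivations, which `defect_eq_zero` extracts
        -- from the morphism equation `hrel`.
        (hψ _ _ h1 h1' (defect_eq_zero h1 h1' hφ1 hφd hrel)),
      compEqId_unbar hφ1 hφd hψφ, compEqId_unbar hψ1 hψd hφψ⟩, fun a => ?_⟩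
  rw [unbar_one_apply, (hφ 0).map_ι]
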